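/- Let $n\ge 4$ and let $\Sigma\subset\{0,1\}^{n\times n}$ be an automaton with $n$ states, i.e. a set of $0/1$ matrices (letters) with exactly one $1$ in each row; $L_{ij}=1$ means that the letter $L$ maps state $i$ to state $j$, and words of length $t$ are products of $t$ letters. Suppose that $\Sigma$ is strongly connected (for all states $i,j$ some word maps $i$ to $j$) and synchronizing (some word maps all states to one single state). Let the triple rendezvous time $T_{3,\Sigma}$ be the smallest $t$ such that some word of length at most $t$ has a column with at least three non-zero entries, i.e. maps three distinct states to one state. Then such a $t$ exists, and $$T_{3,\Sigma}\le \frac{n\left(\sqrt{5n^2+4n-12}-n+6\right)}{8}.$$ The right-hand side divided by $n^2$ tends to $(\sqrt5-1)/8=1/6.47\ldots$ as $n\to\infty$; in particular, there is an $N$ such that $T_{3,\Sigma}<n^2/6.4$ for every $n\ge N$ and every strongly connected synchronizing automaton $\Sigma$ with $n$ states. -/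

import Mathlib

open scoped Matrix
open Filter Topology

/-- A (deterministic, finite state, complete) automaton with `n` states, given as its set of
letters: every letter is an `n × n` matrix with entries in `{0, 1}` such that `L eᵀ = eᵀ`,
where `e` is the all-ones vector. The entry `L i j = 1` means that the letter maps state `i`
to state `j`. -/
def IsAutomaton {n : ℕ} (S : Set (Matrix (Fin n) (Fin n) ℕ)) : Prop :=
  ∀ L ∈ S, (∀ i j, L i j = 0 ∨ L i j = 1) ∧ L *ᵥ (1 : Fin n → ℕ) = 1

/-- The products of length `t` of letters of the automaton, i.e. the words of length `t`. -/
def wordsOfLength {n : ℕ} (S : Set (Matrix (Fin n) (Fin n) ℕ)) (t : ℕ) :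
    Set (Matrix (Fin n) (Fin n) ℕ) :=
  {W | ∃ l : List (Matrix (Fin n) (Fin n) ℕ), l.length = t ∧ (∀ L ∈ l, L ∈ S) ∧ l.prod = W}

/-- The products of length at most `t` (including the empty product, the identity matrix). -/
def wordsUpTo {n : ℕ} (S : Set (Matrix (Fin n) (Fin n) ℕ)) (t : ℕ) :
    Set (Matrix (Fin n) (Fin n) ℕ) :=
  {W | ∃ s ≤ t, W ∈ wordsOfLength S s}

/-- The automaton is synchronizing: some word `W` equals `eᵀ eᵢ`, i.e. maps every state to the
same state `i`. -/
def IsSynchronizing {n : ℕ} (S : Set (Matrix (Fin n) (Fin n) ℕ)) : Prop :=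
  ∃ i : Fin n, ∃ t : ℕ,
    Matrix.vecMulVec (1 : Fin n → ℕ) (Pi.single i 1) ∈ wordsOfLength S t

/-- The automaton is strongly connected: every state can be mapped to every state by a word. -/
def IsStronglyConnected {n : ℕ} (S : Set (Matrix (Fin n) (Fin n) ℕ)) : Prop :=
  ∀ i j : Fin n, ∃ t : ℕ, ∃ W ∈ wordsOfLength S t, W i j = 1

/-- The set `A(t)` of vectors reachable at `t`: the columns of the words of length at most `t`. -/
def reachableVectors {n : ℕ} (S : Set (Matrix (Fin n) (Fin n) ℕ)) (t : ℕ) : Set (Fin n → ℕ) :=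
  {v | ∃ W ∈ wordsUpTo S t, ∃ j : Fin n, v = fun i => W i j}

/-- The weight of a vector: the number of its non-zero entries. -/
noncomputable def weight {n : ℕ} (v : Fin n → ℕ) : ℕ :=
  {i | v i ≠ 0}.ncard

/-- The integers `t` such that `A(t)` contains a column of weight at least three. -/
def tripleTimes {n : ℕ} (S : Set (Matrix (Fin n) (Fin n) ℕ)) : Set ℕ :=
  {t | ∃ v ∈ reachableVectors S t, 3 ≤ weight v}

/-- The triple rendezvous time `T₃`: the smallest `t` such that `A(t)` contains a column of
weight at least three. (Meaningful when `tripleTimes S` is nonempty.) -/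
noncomputable def tripleRendezvousTime {n : ℕ} (S : Set (Matrix (Fin n) (Fin n) ℕ)) : ℕ :=
  sInf (tripleTimes S)

/-- The bound `n (√(5n² + 4n − 12) − n + 6) / 8`. -/
noncomputable def tripleBound (n : ℕ) : ℝ :=
  (n : ℝ) * (Real.sqrt (5 * (n : ℝ) ^ 2 + 4 * (n : ℝ) - 12) - (n : ℝ) + 6) / 8

/-!
Suppose that no word of length less than `T` merges three states, and let `G t` be the graph of the
pairs of states merged by a word of length at most `t`. By synchronization `G t` gains an edge at
each step, so it suffices to bound its degrees from above. The neighbours of a state with two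
preimages under a word are missed by that word, since otherwise a triple would be merged; hence its
degree is at most the defect of the word. Strong connectivity supplies such words of slowly
increasing length for all the states.

The defect is bounded through the polytope of fractional stable sets of `G t`. A word of defect `δ`
and length `j` puts a matching with `δ` edges into `G j`. Afterwards each step either increases the
fractional matching number `s / 2` or lowers the dimension of the face of maximum fractional stable
sets: otherwise the letters would preserve the affine span of that face, and so would a
synchronizing word, which leads out of it. That dimension is at most `s / 2`, so only about
`n² / 4 - δ²` steps are possible before time `T`. Comparing the two counts of edges gives the bound.

This leaves the cases with at most thirteen states and letters of defect at most one. There all the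
letters that are not bijective duplicate the same state `q`, whose neighbours in `G t` are few; the
possible images of `q` under the bijective letters are then inspected.
-/

section Words

variable {V : Type*} {S : Set (V → V)}

/-- The maps induced by the words of length `t` over the set `S` of letters, the first letter
being applied first. -/
inductive IsWord (S : Set (V → V)) : ℕ → (V → V) → Prop
  | nil : IsWord S 0 id
  | cons {t : ℕ} {f g : V → V} : f ∈ S → IsWord S t g → IsWord S (t + 1) (g ∘ f)

theorem IsWord.append {s t : ℕ} {f g : V → V} (hf : IsWord S s f) (hg : IsWord S t g) :
    IsWord S (t + s) (g ∘ f) := by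
  induction hf with
  | nil => simpa using hg
  | @cons s f h hL _ ih => exact IsWord.cons (g := g ∘ h) hL ih

theorem IsWord.letter {f : V → V} (hf : f ∈ S) : IsWord S 1 f :=
  IsWord.cons (g := id) hf IsWord.nil

theorem IsWord.snoc {t : ℕ} {f g : V → V} (hf : IsWord S t f) (hg : g ∈ S) :
    IsWord S (t + 1) (g ∘ f) :=
  Nat.add_comm t 1 ▸ hf.append (IsWord.letter hg)

/-- No word of length less than `T` maps three distinct states to one state. -/
def TripleFree (S : Set (V → V)) (T : ℕ) : Prop :=
  ∀ t < T, ∀ f, IsWord S t f → ∀ x y z, f x = f y → f y = f z → x = y ∨ y = z ∨ x = z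

theorem TripleFree.mono {T T' : ℕ} (h : TripleFree S T) (hT : T' ≤ T) : TripleFree S T' :=
  fun t ht => h t (ht.trans_le hT)

/-- Every state is mapped to every state by some word. -/
def StronglyConnected (S : Set (V → V)) : Prop :=
  ∀ x y, ∃ t f, IsWord S t f ∧ f x = y

/-- Some word maps all states to one state. -/
def Synchronizing (S : Set (V → V)) : Prop :=
  ∃ x t f, IsWord S t f ∧ ∀ y, f y = x

/-- The graph of the pairs of states that are merged by a word of length at most `t`. -/
def mergeGraph (S : Set (V → V)) (t : ℕ) : SimpleGraph V where
  Adj x y := x ≠ y ∧ ∃ s ≤ t, ∃ f, IsWord S s f ∧ f x = f y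
  symm := ⟨fun _ _ ⟨h, s, hs, f, hf, e⟩ => ⟨h.symm, s, hs, f, hf, e.symm⟩⟩
  loopless := ⟨fun _ h => h.1 rfl⟩

theorem mergeGraph_mono {s t : ℕ} (h : s ≤ t) : mergeGraph S s ≤ mergeGraph S t :=
  fun _ _ ⟨hxy, r, hr, f, hf, e⟩ => ⟨hxy, r, hr.trans h, f, hf, e⟩

theorem mergeGraph_zero : mergeGraph S 0 = ⊥ := by
  refine eq_bot_iff.2 fun x y h => ?_
  obtain ⟨hxy, s, hs, f, hf, e⟩ := h
  obtain rfl : s = 0 := Nat.le_zero.1 hs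
  cases hf
  exact hxy e

theorem mergeGraph_succ_adj {t : ℕ} {x y : V} :
    (mergeGraph S (t + 1)).Adj x y ↔
      x ≠ y ∧ ∃ L ∈ S, L x = L y ∨ (mergeGraph S t).Adj (L x) (L y) := by
  constructor
  · rintro ⟨h, s, hs, f, hf, e⟩
    refine ⟨h, ?_⟩
    cases hf with
    | nil => exact absurd e h
    | @cons s L g hL hg =>
      exact ⟨L, hL, or_iff_not_imp_left.2 fun hxy => ⟨hxy, s, by omega, g, hg, e⟩⟩
  · rintro ⟨h, L, hL, e | ⟨_, s, hs, f, hf, e⟩⟩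
    · exact ⟨h, 1, by omega, L, IsWord.letter hL, e⟩
    · exact ⟨h, s + 1, by omega, f ∘ L, IsWord.cons hL hf, e⟩

theorem mergeGraph_adj_of_letter {t : ℕ} {x y : V} {L : V → V} (hL : L ∈ S)
    (h : (mergeGraph S t).Adj (L x) (L y)) : (mergeGraph S (t + 1)).Adj x y :=
  mergeGraph_succ_adj.2 ⟨fun e => h.1 (congrArg L e), L, hL, Or.inr h⟩

theorem mergeGraph_adj_of_eq {t : ℕ} {x y : V} {L : V → V} (hL : L ∈ S)
    (hxy : x ≠ y) (h : L x = L y) : (mergeGraph S (t + 1)).Adj x y :=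
  mergeGraph_succ_adj.2 ⟨hxy, L, hL, Or.inl h⟩

/-- A set of pairs of distinct states, given as a graph, is dead if letters map no other pair
into it. Pairs outside a dead set are then merged along words that avoid it. -/
def IsDead (S : Set (V → V)) (D : SimpleGraph V) : Prop :=
  ∀ L ∈ S, ∀ x y, x ≠ y → D.Adj (L x) (L y) → D.Adj x y

theorem isDead_bot (S : Set (V → V)) : IsDead S ⊥ := fun _ _ _ _ _ h => h.elim

theorem IsDead.mergeGraph_sdiff_le {D : SimpleGraph V} (hD : IsDead S D) {t : ℕ}
    (h : mergeGraph S (t + 1) \ D ≤ mergeGraph S t \ D) (s : ℕ) :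
    mergeGraph S s \ D ≤ mergeGraph S t \ D := by
  induction s with
  | zero => simp [mergeGraph_zero]
  | succ s ih =>
    rintro x y ⟨hs, hxy⟩
    obtain ⟨hne, L, hL, e | e⟩ := mergeGraph_succ_adj.1 hs
    · exact h ⟨mergeGraph_adj_of_eq hL hne e, hxy⟩
    · have hLxy : (mergeGraph S t \ D).Adj (L x) (L y) :=
        ih ⟨e, fun hd => hxy (hD L hL x y hne hd)⟩
      exact h ⟨mergeGraph_adj_of_letter hL hLxy.1, hxy⟩

theorem IsDead.mergeGraph_sdiff_lt_succ {D : SimpleGraph V} (hD : IsDead S D)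
    (hsync : Synchronizing S) {t : ℕ} {x y : V} (hxy : x ≠ y) (hDxy : ¬ D.Adj x y)
    (hG : ¬ (mergeGraph S t).Adj x y) : mergeGraph S t \ D < mergeGraph S (t + 1) \ D := by
  refine lt_of_le_not_ge (sdiff_le_sdiff_right (mergeGraph_mono (Nat.le_succ t))) fun h => ?_
  obtain ⟨w, s, f, hf, hw⟩ := hsync
  have hlive : (mergeGraph S s \ D).Adj x y := ⟨⟨hxy, s, le_rfl, f, hf, by rw [hw, hw]⟩, hDxy⟩
  exact hG (hD.mergeGraph_sdiff_le h s hlive).1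

theorem IsDead.adj_of_isWord {D : SimpleGraph V} (hD : IsDead S D) {l : ℕ} {f : V → V}
    (hf : IsWord S l f) {x y : V} (hxy : D.Adj (f x) (f y)) : D.Adj x y := by
  induction hf generalizing x y with
  | nil => exact hxy
  | @cons _ L _ hL _ ih => exact hD L hL x y (fun e => hxy.ne (by rw [e])) (ih hxy)

theorem TripleFree.not_adj_of_eq {T t l : ℕ} (hT : TripleFree S T) {f : V → V}
    (hf : IsWord S l f) {u u' w : V} (hu : u ≠ u') (he : f u = f u') (hl : t + l < T) :
    ¬ (mergeGraph S t).Adj (f u) (f w) := by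
  rintro ⟨hne, s, hs, g, hg, e⟩
  rcases hT (s + l) (by omega) (g ∘ f) (hf.append hg) u u' w (by simp [he]) (by simp [← he, e])
    with h | rfl | rfl
  · exact hu h
  · exact hne he
  · exact hne rfl

end Words

section OptimalFace

variable {V : Type*}

theorem map_eq_of_mem_affineSpan {k E F : Type*} [Ring k] [AddCommGroup E] [Module k E]
    [AddCommGroup F] [Module k F] {P : Set E} (φ : E →ₗ[k] F) {c : F} (h : ∀ y ∈ P, φ y = c)
    {y : E} (hy : y ∈ affineSpan k P) : φ y = c :=
  affineSpan_induction (p := fun y => φ y = c) hy h fun r u v w hu hv hw => by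
    simp [hu, hv, hw]

/-- Fractional stable sets of a graph. -/
def fracStable (G : SimpleGraph V) : Set (V → ℝ) :=
  {y | (∀ x, 0 ≤ y x ∧ y x ≤ 1) ∧ ∀ x x', G.Adj x x' → y x + y x' ≤ 1}

/-- Every point of `I` is detected by a vector of `W` vanishing on the rest of `I`; in particular
`I.card` is at most the dimension of `W`. -/
def IsSeparating {K : Type*} [Field K] (W : Submodule K (V → K)) (I : Finset V) : Prop :=
  ∀ i ∈ I, ∃ w ∈ W, w i ≠ 0 ∧ ∀ j ∈ I, j ≠ i → w j = 0

theorem exists_isSeparating [Finite V] {K : Type*} [Field K] (W : Submodule K (V → K)) :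
    ∃ I : Finset V, Module.finrank K W ≤ I.card ∧ IsSeparating W I := by
  classical
  have := Fintype.ofFinite V
  let Determines : Finset V → Prop := fun I => ∀ w ∈ W, (∀ i ∈ I, w i = 0) → w = 0
  have huniv : Determines Finset.univ := fun w _ h => funext fun i => h i (Finset.mem_univ i)
  obtain ⟨I, hI, hmin⟩ := Finset.exists_min_image (Finset.univ.filter Determines) Finset.card
    ⟨_, Finset.mem_filter.2 ⟨Finset.mem_univ _, huniv⟩⟩
  have hdet : Determines I := (Finset.mem_filter.1 hI).2
  refine ⟨I, ?_, fun i hi => ?_⟩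
  · let φ : W →ₗ[K] (I → K) := (LinearMap.funLeft K K (Subtype.val : I → V)).comp W.subtype
    have hφ : Function.Injective φ := by
      refine LinearMap.ker_eq_bot.1 (LinearMap.ker_eq_bot'.2 fun w hw => Subtype.ext ?_)
      exact hdet w w.2 fun i hi => congrFun hw ⟨i, hi⟩
    simpa using LinearMap.finrank_le_finrank_of_injective hφ
  · by_contra! hcon
    have herase : Determines (I.erase i) := fun w hw hz => hdet w hw fun j hj => by
      by_cases hji : j = i
      · subst hji
        by_contra hne
        obtain ⟨k, hk, hkj, hk0⟩ := hcon w hw hne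
        exact hk0 (hz k (Finset.mem_erase.2 ⟨hkj, hk⟩))
      · exact hz j (Finset.mem_erase.2 ⟨hji, hj⟩)
    exact (Finset.card_erase_lt_of_mem hi).not_ge
      (hmin _ (Finset.mem_filter.2 ⟨Finset.mem_univ _, herase⟩))

section Alternating

variable {K : Type*} [Field K] [NeZero (2 : K)] {W : Submodule K (V → K)}
  {σ : Equiv.Perm V} {I : Finset V}

theorem apply_ne_of_alternating {w : V → K} {i : V} (halt : w (σ i) = -w i) (hi : w i ≠ 0) :
    σ i ≠ i := by
  intro h
  have h2 : 2 * w i = 0 := by linear_combination halt - congrArg w h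
  exact hi ((mul_eq_zero.1 h2).resolve_left two_ne_zero)

theorem apply_notMem_of_alternating (halt : ∀ w ∈ W, ∀ i, w (σ i) = -w i)
    (hI : IsSeparating W I) {i : V} (hi : i ∈ I) : σ i ∉ I := by
  intro hσi
  obtain ⟨w, hw, hwi, hoff⟩ := hI i hi
  have hzero := hoff _ hσi (apply_ne_of_alternating (halt w hw i) hwi)
  exact hwi (neg_eq_zero.1 ((halt w hw i).symm.trans hzero))

open scoped Classical in
theorem card_union_image_of_alternating (halt : ∀ w ∈ W, ∀ i, w (σ i) = -w i)
    (hI : IsSeparating W I) : (I ∪ I.image σ).card = 2 * I.card := by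
  rw [Finset.card_union_of_disjoint, Finset.card_image_of_injective _ σ.injective, two_mul]
  exact Finset.disjoint_right.2 (Finset.forall_mem_image.2 fun i hi =>
    apply_notMem_of_alternating halt hI hi)

/-- The support of `W` is a union of even cycles of `σ`, so it cannot exceed `I ∪ σ I` by a single
point. -/
theorem eq_zero_of_alternating (halt : ∀ w ∈ W, ∀ i, w (σ i) = -w i) (hI : IsSeparating W I)
    {x : V} (hx : x ∉ I) (hxσ : ∀ i ∈ I, σ i ≠ x)
    (hsupp : ∀ w ∈ W, ∀ j, w j ≠ 0 → j ≠ x → j ∈ I ∨ ∃ i ∈ I, σ i = j) {w : V → K}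
    (hw : w ∈ W) : w x = 0 := by
  by_contra hwx
  have hpre : w (σ.symm x) ≠ 0 := fun h => hwx (by simpa [h] using halt w hw (σ.symm x))
  have hpre_ne : σ.symm x ≠ x := fun h =>
    apply_ne_of_alternating (halt w hw x) hwx (σ.symm_apply_eq.1 h).symm
  obtain ⟨k, hk, hkx⟩ : ∃ k ∈ I, σ k = σ.symm x :=
    (hsupp w hw _ hpre hpre_ne).resolve_left fun h => hxσ _ h (σ.apply_symm_apply x)
  have hσx : σ x ∈ I := by
    have hne : w (σ x) ≠ 0 := by rwa [halt w hw, neg_ne_zero]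
    refine (hsupp w hw _ hne (apply_ne_of_alternating (halt w hw x) hwx)).resolve_right ?_
    rintro ⟨i, hi, h⟩
    exact hx (σ.injective h ▸ hi)
  obtain ⟨v, hv, hvx, hoff⟩ := hI _ hσx
  have hvk : v k = v x := by
    rw [← σ.apply_symm_apply x, ← hkx, halt v hv, halt v hv, neg_neg]
  have hσv : v (σ x) = -v x := halt v hv x
  by_cases hkσ : k = σ x
  · have h2 : 2 * v (σ x) = 0 := by
      linear_combination hσv + hvk - congrArg v hkσ
    exact hvx ((mul_eq_zero.1 h2).resolve_left two_ne_zero)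
  · exact hvx (by rw [hσv, ← hvk, hoff k hk hkσ, neg_zero])

theorem two_mul_finrank_le_of_alternating [Finite V] {D : Finset V}
    (halt : ∀ w ∈ W, ∀ i, w (σ i) = -w i) (hsupp : ∀ w ∈ W, ∀ i ∉ D, w i = 0)
    (hσ : ∀ i ∈ D, σ i ≠ i) :
    2 * Module.finrank K W ≤ D.card ∧ (2 * Module.finrank K W + 1 = D.card →
      ∃ x ∈ D, σ x ∉ D ∧ σ.symm x ∉ D) := by
  classical
  obtain ⟨I, hdim, hI⟩ := exists_isSeparating W
  have hID : ∀ i ∈ I, i ∈ D ∧ σ i ∈ D := fun i hi => by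
    obtain ⟨w, hw, hwi, -⟩ := hI i hi
    refine ⟨by_contra fun h => hwi (hsupp w hw i h), by_contra fun h => hwi ?_⟩
    rw [← neg_eq_zero, ← halt w hw, hsupp w hw _ h]
  have hsub : I ∪ I.image σ ⊆ D := Finset.union_subset (fun i hi => (hID i hi).1)
    (Finset.image_subset_iff.2 fun i hi => (hID i hi).2)
  have hcard := card_union_image_of_alternating halt hI
  have hle := Finset.card_le_card hsub
  refine ⟨by omega, fun hodd => ?_⟩
  obtain ⟨x, hx⟩ : ∃ x, D \ (I ∪ I.image σ) = {x} := by
    rw [← Finset.card_eq_one, Finset.card_sdiff_of_subset hsub]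
    omega
  have hDx : ∀ j, j ∈ D ∧ j ∉ I ∧ (∀ i ∈ I, σ i ≠ j) ↔ j = x := fun j => by
    simpa [and_assoc] using Finset.ext_iff.1 hx j
  obtain ⟨hxD, hxI, hxσ⟩ := (hDx x).2 rfl
  have hmem : ∀ j ∈ D, j ≠ x → j ∈ I ∨ ∃ i ∈ I, σ i = j := fun j hj hjx => by
    by_contra! h
    exact hjx ((hDx j).1 ⟨hj, h⟩)
  have hzero : ∀ w ∈ W, w x = 0 := fun w hw => eq_zero_of_alternating halt hI hxI hxσ
    (fun w hw j hj => hmem j (by_contra fun h => hj (hsupp w hw j h))) hw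
  refine ⟨x, hxD, fun h => ?_, fun h => ?_⟩
  · rcases hmem _ h (hσ x hxD) with hi | ⟨i, hi, h⟩
    · obtain ⟨w, hw, hwi, -⟩ := hI _ hi
      exact hwi (by rw [halt w hw, hzero w hw, neg_zero])
    · exact hxI (σ.injective h ▸ hi)
  · rcases hmem _ h fun h => hσ x hxD (σ.symm_apply_eq.1 h).symm with hi | ⟨i, hi, h⟩
    · exact hxσ _ hi (σ.apply_symm_apply x)
    · obtain ⟨w, hw, hwi, -⟩ := hI i hi
      have hx0 := hzero w hw
      rw [← σ.apply_symm_apply x, ← h, halt w hw, halt w hw, neg_neg] at hx0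
      exact hwi hx0

end Alternating

variable [Fintype V]

open scoped Classical in
/-- The vertices adjacent to an element of `A`. -/
noncomputable def nbrs (G : SimpleGraph V) (A : Finset V) : Finset V :=
  Finset.univ.filter fun x => ∃ a ∈ A, G.Adj a x

/-- The deficiency of a graph: the maximum of `|A| - |N(A)|`. -/
noncomputable def deficiency (G : SimpleGraph V) : ℕ :=
  (Finset.univ : Finset (Finset V)).sup fun A => A.card - (nbrs G A).card

/-- The fractional stable sets of maximum total weight. By LP duality with fractional matchings
that maximum is half the number of vertices plus half the deficiency, and this value is what the
definition records. -/
def optFace (G : SimpleGraph V) : Set (V → ℝ) :=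
  {y | y ∈ fracStable G ∧ 2 * ∑ x, y x = Fintype.card V + deficiency G}

/-- The dimension of the face of optimal fractional stable sets. -/
noncomputable def optDim (G : SimpleGraph V) : ℕ :=
  Module.finrank ℝ (vectorSpan ℝ (optFace G))

theorem mem_nbrs {G : SimpleGraph V} {A : Finset V} {x : V} :
    x ∈ nbrs G A ↔ ∃ a ∈ A, G.Adj a x := by simp [nbrs]

theorem card_le_nbrs_add_deficiency (G : SimpleGraph V) (A : Finset V) :
    A.card ≤ (nbrs G A).card + deficiency G :=
  Nat.sub_le_iff_le_add'.1 <|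
    Finset.le_sup (f := fun A : Finset V => A.card - (nbrs G A).card) (Finset.mem_univ A)

theorem exists_card_eq_nbrs_add_deficiency (G : SimpleGraph V) :
    ∃ A : Finset V, A.card = (nbrs G A).card + deficiency G := by
  obtain ⟨A, -, hA⟩ := Finset.exists_mem_eq_sup (Finset.univ : Finset (Finset V))
    ⟨∅, Finset.mem_univ _⟩ fun A => A.card - (nbrs G A).card
  change deficiency G = _ at hA
  rcases Nat.eq_zero_or_pos (deficiency G) with h | h
  · exact ⟨∅, by simp [nbrs, h]⟩
  · exact ⟨A, by omega⟩

theorem deficiency_anti {G H : SimpleGraph V} (h : G ≤ H) : deficiency H ≤ deficiency G := by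
  obtain ⟨A, hA⟩ := exists_card_eq_nbrs_add_deficiency H
  have hG := card_le_nbrs_add_deficiency G A
  have hnbrs : (nbrs G A).card ≤ (nbrs H A).card := Finset.card_le_card fun x hx => by
    obtain ⟨a, ha, hax⟩ := mem_nbrs.1 hx
    exact mem_nbrs.2 ⟨a, ha, h hax⟩
  omega

theorem deficiency_le_card (G : SimpleGraph V) : deficiency G ≤ Fintype.card V := by
  obtain ⟨A, hA⟩ := exists_card_eq_nbrs_add_deficiency G
  exact (Nat.le_add_left _ _).trans (hA ▸ Finset.card_le_univ A)

theorem deficiency_pos_of_isolated {G : SimpleGraph V} {q : V} (h : ∀ x, ¬ G.Adj q x) :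
    1 ≤ deficiency G := by
  simpa [nbrs, h] using card_le_nbrs_add_deficiency G {q}

/-- Half the sum of the indicators of `A` and of the complement of `N(A)`, where `A` attains the
deficiency. -/
theorem optFace_nonempty (G : SimpleGraph V) : (optFace G).Nonempty := by
  classical
  obtain ⟨A, hA⟩ := exists_card_eq_nbrs_add_deficiency G
  refine ⟨fun x => ((if x ∈ A then 1 else 0) + (if x ∈ (nbrs G A)ᶜ then 1 else 0)) / 2,
    ⟨fun x => ?_, fun x x' hx => ?_⟩, ?_⟩
  · dsimp only
    split_ifs <;> norm_num
  · have hx' : x ∈ A → x' ∈ nbrs G A := fun h => mem_nbrs.2 ⟨x, h, hx⟩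
    have hx : x' ∈ A → x ∈ nbrs G A := fun h => mem_nbrs.2 ⟨x', h, hx.symm⟩
    simp only [Finset.mem_compl]
    split_ifs <;> first | tauto | norm_num
  · have hcompl : ((nbrs G A)ᶜ.card : ℝ) = Fintype.card V - (nbrs G A).card := by
      rw [Finset.card_compl, Nat.cast_sub (Finset.card_le_univ _)]
    have hA' : (A.card : ℝ) = (nbrs G A).card + deficiency G := by exact_mod_cast hA
    rw [← Finset.sum_div, Finset.sum_add_distrib, Finset.sum_boole, Finset.sum_boole,
      Finset.filter_univ_mem, Finset.filter_univ_mem, hcompl, hA']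
    ring

/-- Hall's theorem after adding as many universal dummy vertices as the deficiency demands. -/
theorem exists_injective_adj_or_inr (G : SimpleGraph V) :
    ∃ g : V → V ⊕ Fin (deficiency G), Function.Injective g ∧
      ∀ x y, g x = Sum.inl y → G.Adj x y := by
  classical
  let candidates : V → Finset (V ⊕ Fin (deficiency G)) := fun x =>
    (nbrs G {x}).disjSum Finset.univ
  have hall (A : Finset V) : A.card ≤ (A.biUnion candidates).card := by
    rcases A.eq_empty_or_nonempty with rfl | ⟨a, ha⟩
    · simp
    have hsub : (nbrs G A).disjSum Finset.univ ⊆ A.biUnion candidates := by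
      intro z hz
      rcases Finset.mem_disjSum.1 hz with ⟨x, hx, rfl⟩ | ⟨i, _, rfl⟩
      · obtain ⟨b, hb, hbx⟩ := mem_nbrs.1 hx
        exact Finset.mem_biUnion.2 ⟨b, hb, by simp [candidates, mem_nbrs, hbx]⟩
      · exact Finset.mem_biUnion.2 ⟨a, ha, by simp [candidates]⟩
    calc A.card ≤ (nbrs G A).card + deficiency G := card_le_nbrs_add_deficiency G A
      _ = ((nbrs G A).disjSum (Finset.univ : Finset (Fin (deficiency G)))).card := by simp
      _ ≤ (A.biUnion candidates).card := Finset.card_le_card hsub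
  obtain ⟨g, hg, hgmem⟩ :=
    (Finset.all_card_le_biUnion_card_iff_exists_injective candidates).1 hall
  refine ⟨g, hg, fun x y hxy => ?_⟩
  simpa [candidates, hxy, mem_nbrs] using hgmem x

theorem exists_perm_adj (G : SimpleGraph V) :
    ∃ (D : Finset V) (σ : Equiv.Perm V), (∀ i ∈ D, G.Adj i (σ i)) ∧
      Fintype.card V ≤ D.card + deficiency G := by
  classical
  obtain ⟨g, hg, hadj⟩ := exists_injective_adj_or_inr G
  let D := Finset.univ.filter fun x => (g x).isLeft
  have hgD : ∀ x ∈ D, g x = Sum.inl ((g x).elim id fun _ => x) := fun x hx => by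
    obtain ⟨y, hy⟩ := Sum.isLeft_iff.1 (Finset.mem_filter.1 hx).2
    simp [hy]
  have hinj : Set.InjOn (fun x => (g x).elim id fun _ => x) D := fun x hx y hy h =>
    hg ((hgD x hx).trans ((congrArg Sum.inl h).trans (hgD y hy).symm))
  obtain ⟨σ, hσ⟩ := Finset.exists_equiv_extend_of_card_eq Finset.card_univ.symm
    (Finset.subset_univ _) hinj
  refine ⟨D, σ.trans (Equiv.subtypeUnivEquiv Finset.mem_univ), fun i hi => ?_, ?_⟩
  · exact hadj i _ ((hgD i hi).trans (congrArg Sum.inl (hσ i hi).symm))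
  · have hdummy : (Dᶜ.image g).card ≤
        ((Finset.univ : Finset (Fin (deficiency G))).image (Sum.inr : _ → V ⊕ _)).card := by
      refine Finset.card_le_card fun z hz => ?_
      obtain ⟨x, hx, rfl⟩ := Finset.mem_image.1 hz
      have hx' : ¬ (g x).isLeft := by simpa [D] using hx
      cases h : g x with
      | inl y => simp [h] at hx'
      | inr i => simp
    rw [Finset.card_image_of_injective _ hg, Finset.card_compl] at hdummy
    have hfin := hdummy.trans Finset.card_image_le
    rw [Finset.card_univ, Fintype.card_fin] at hfin
    omega

/-- Complementary slackness between optimal fractional stable sets and the matching `σ`. -/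
theorem exists_perm_adj_tight (G : SimpleGraph V) :
    ∃ (D : Finset V) (σ : Equiv.Perm V), (∀ i ∈ D, G.Adj i (σ i)) ∧
      D.card + deficiency G = Fintype.card V ∧ ∀ y ∈ affineSpan ℝ (optFace G),
        (∀ i ∈ D, y i + y (σ i) = 1) ∧ ∀ i ∉ D, y i = 1 ∧ y (σ i) = 1 := by
  classical
  obtain ⟨D, σ, hadj, hD⟩ := exists_perm_adj G
  have hD' : (Fintype.card V : ℝ) ≤ D.card + deficiency G := by exact_mod_cast hD
  have hDc : (Dᶜ.card : ℝ) = Fintype.card V - D.card := by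
    rw [Finset.card_compl, Nat.cast_sub (Finset.card_le_univ D)]
  have key : ∀ y ∈ optFace G, (∀ i ∈ D, 1 - (y i + y (σ i)) = 0) ∧
      (∀ i ∈ Dᶜ, 2 - (y i + y (σ i)) = 0) ∧ (D.card + deficiency G : ℝ) = Fintype.card V := by
    rintro y ⟨⟨hbox, hedge⟩, hopt⟩
    have hslack : ∀ i ∈ D, 0 ≤ 1 - (y i + y (σ i)) := fun i hi => by
      linarith [hedge _ _ (hadj i hi)]
    have hslack' : ∀ i ∈ Dᶜ, 0 ≤ 2 - (y i + y (σ i)) := fun i _ => by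
      linarith [(hbox i).2, (hbox (σ i)).2]
    have hsum : ∑ i ∈ D, (1 - (y i + y (σ i))) + ∑ i ∈ Dᶜ, (2 - (y i + y (σ i)))
        = D.card + 2 * Dᶜ.card - 2 * ∑ i, y i := by
      have hσ : 2 * ∑ i, y i = ∑ i, (y i + y (σ i)) := by
        rw [Finset.sum_add_distrib, Equiv.sum_comp σ y, two_mul]
      rw [hσ, ← Finset.sum_add_sum_compl D fun i => y i + y (σ i)]
      simp only [Finset.sum_sub_distrib, Finset.sum_const, nsmul_eq_mul]
      ring
    have hpos := Finset.sum_nonneg hslack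
    have hpos' := Finset.sum_nonneg hslack'
    exact ⟨(Finset.sum_eq_zero_iff_of_nonneg hslack).1 (by linarith),
      (Finset.sum_eq_zero_iff_of_nonneg hslack').1 (by linarith), by linarith⟩
  obtain ⟨y₀, hy₀⟩ := optFace_nonempty G
  let coord (i : V) : (V → ℝ) →ₗ[ℝ] ℝ := LinearMap.proj i
  refine ⟨D, σ, hadj, by exact_mod_cast (key y₀ hy₀).2.2, fun y hy => ⟨fun i hi => ?_,
    fun i hi => ⟨?_, ?_⟩⟩⟩
  · refine map_eq_of_mem_affineSpan (coord i + coord (σ i)) (fun y hy => ?_) hy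
    exact (sub_eq_zero.1 ((key y hy).1 i hi)).symm
  · refine map_eq_of_mem_affineSpan (coord i) (fun y hy => ?_) hy
    change y i = 1
    linarith [(key y hy).2.1 i (Finset.mem_compl.2 hi), (hy.1.1 i).2, (hy.1.1 (σ i)).2]
  · refine map_eq_of_mem_affineSpan (coord (σ i)) (fun y hy => ?_) hy
    change y (σ i) = 1
    linarith [(key y hy).2.1 i (Finset.mem_compl.2 hi), (hy.1.1 i).2, (hy.1.1 (σ i)).2]

theorem alternating_of_mem_vectorSpan_optFace {G : SimpleGraph V} {D : Finset V}
    {σ : Equiv.Perm V} (htight : ∀ y ∈ affineSpan ℝ (optFace G),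
      (∀ i ∈ D, y i + y (σ i) = 1) ∧ ∀ i ∉ D, y i = 1 ∧ y (σ i) = 1) {w : V → ℝ}
    (hw : w ∈ vectorSpan ℝ (optFace G)) : (∀ i, w (σ i) = -w i) ∧ ∀ i ∉ D, w i = 0 := by
  obtain ⟨y, hy⟩ := optFace_nonempty G
  have hy := subset_affineSpan ℝ _ hy
  obtain ⟨hD, hDc⟩ := htight y hy
  obtain ⟨hD', hDc'⟩ := htight (w + y) <|
    AffineSubspace.vadd_mem_of_mem_direction (by rwa [direction_affineSpan]) hy
  simp only [Pi.add_apply] at hD' hDc'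
  refine ⟨fun i => ?_, fun i hi => by linarith [(hDc i hi).1, (hDc' i hi).1]⟩
  by_cases hi : i ∈ D
  · linarith [hD i hi, hD' i hi]
  · linarith [(hDc i hi).1, (hDc' i hi).1, (hDc i hi).2, (hDc' i hi).2]

theorem two_mul_optDim_add_deficiency (G : SimpleGraph V) :
    2 * optDim G + deficiency G ≤ Fintype.card V ∧
      2 * optDim G + deficiency G + 1 ≠ Fintype.card V := by
  obtain ⟨D, σ, hadj, hD, htight⟩ := exists_perm_adj_tight G
  obtain ⟨hle, hodd⟩ := two_mul_finrank_le_of_alternating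
    (fun w hw => (alternating_of_mem_vectorSpan_optFace htight hw).1)
    (fun w hw => (alternating_of_mem_vectorSpan_optFace htight hw).2)
    (fun i hi => (hadj i hi).ne')
  change 2 * optDim G ≤ _ at hle
  change 2 * optDim G + 1 = _ → _ at hodd
  refine ⟨by omega, fun hn => ?_⟩
  obtain ⟨x, hxD, hnext, hprev⟩ := hodd (by omega)
  obtain ⟨y, hy⟩ := optFace_nonempty G
  have hy := subset_affineSpan ℝ _ hy
  have hyx := ((htight y hy).2 _ hprev).2
  rw [σ.apply_symm_apply] at hyx
  linarith [(htight y hy).1 x hxD, ((htight y hy).2 _ hnext).1]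

theorem exists_ne_zero_of_mem_affineSpan_optFace (hn : 3 ≤ Fintype.card V) {G : SimpleGraph V}
    {y : V → ℝ} (hy : y ∈ affineSpan ℝ (optFace G)) (x : V) : ∃ i, i ≠ x ∧ y i ≠ 0 := by
  classical
  obtain ⟨D, σ, -, -, htight⟩ := exists_perm_adj_tight G
  obtain ⟨hD, hDc⟩ := htight y hy
  by_contra! hzero
  have hpre : ∀ i, i ≠ x → i = σ.symm x := fun i hi => by
    have hiD : i ∈ D := by
      by_contra h
      exact one_ne_zero ((hDc i h).1.symm.trans (hzero i hi))
    have hσi : σ i = x := by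
      by_contra h
      linarith [hD i hiD, hzero i hi, hzero _ h]
    exact σ.eq_symm_apply.2 hσi
  have hsub : (Finset.univ : Finset V) ⊆ {x, σ.symm x} := fun i _ => by
    simpa using or_iff_not_imp_left.2 (hpre i)
  have := (Finset.card_le_card hsub).trans Finset.card_le_two
  rw [Finset.card_univ] at this
  omega

end OptimalFace

section Stages

variable {V : Type*} {S : Set (V → V)} {T : ℕ}

open scoped Classical in
theorem TripleFree.card_fiber_le_two [Fintype V] {l : ℕ} (hT : TripleFree S T) {f : V → V}
    (hf : IsWord S l f) (hl : l < T) (j : V) : (Finset.univ.filter (f · = j)).card ≤ 2 := by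
  by_contra! h
  obtain ⟨x, hx, y, hy, z, hz, hxy, hxz, hyz⟩ := Finset.two_lt_card.1 h
  simp only [Finset.mem_filter, Finset.mem_univ, true_and] at hx hy hz
  rcases hT l hl f hf x y z (hx.trans hy.symm) (hy.trans hz.symm) with h | h | h
  exacts [hxy h, hyz h, hxz h]

theorem linearMap_eq_zero [Finite V] {f : V → V} {j : V} (hj : ∀ i, f i ≠ j) (y : V → ℝ) :
    FunOnFinite.linearMap ℝ ℝ f y j = 0 := by
  classical
  have := Fintype.ofFinite V
  rw [FunOnFinite.linearMap_apply_apply]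
  exact Finset.sum_eq_zero fun i hi => absurd (Finset.mem_filter.1 hi).2 (hj i)

theorem linearMap_mem_Icc [Finite V] {l : ℕ} (hT : TripleFree S T) {f : V → V}
    (hf : IsWord S l f) (hl : l < T) {y : V → ℝ} (hy : y ∈ fracStable (mergeGraph S l)) (j : V) :
    0 ≤ FunOnFinite.linearMap ℝ ℝ f y j ∧ FunOnFinite.linearMap ℝ ℝ f y j ≤ 1 := by
  classical
  have := Fintype.ofFinite V
  rw [FunOnFinite.linearMap_apply_apply]
  refine ⟨Finset.sum_nonneg fun i _ => (hy.1 i).1, ?_⟩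
  rcases (hT.card_fiber_le_two hf hl j).eq_or_lt with h | h
  · obtain ⟨u, u', hne, hfib⟩ := Finset.card_eq_two.1 h
    have hmem (i : V) : f i = j ↔ i = u ∨ i = u' := by simpa using Finset.ext_iff.1 hfib i
    rw [hfib, Finset.sum_pair hne]
    exact hy.2 u u' ⟨hne, l, le_rfl, f, hf,
      ((hmem u).2 (Or.inl rfl)).trans ((hmem u').2 (Or.inr rfl)).symm⟩
  · refine (Finset.sum_le_card_nsmul _ y 1 fun i _ => (hy.1 i).2).trans ?_
    simpa using Nat.le_of_lt_succ h

theorem linearMap_mem_fracStable [Finite V] {t : ℕ} (hT : TripleFree S T) {L : V → V}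
    (hL : L ∈ S) (ht : t + 1 < T) {y : V → ℝ} (hy : y ∈ fracStable (mergeGraph S (t + 1))) :
    FunOnFinite.linearMap ℝ ℝ L y ∈ fracStable (mergeGraph S t) := by
  classical
  have := Fintype.ofFinite V
  have hw := IsWord.letter hL
  have hbox := linearMap_mem_Icc hT hw (by omega)
    ⟨hy.1, fun x x' h => hy.2 x x' (mergeGraph_mono (by omega) h)⟩
  -- A state with two preimages has no neighbour in the image of `L`.
  have hsingle {u v : V} (huv : (mergeGraph S t).Adj (L u) (L v)) :
      FunOnFinite.linearMap ℝ ℝ L y (L u) = y u := by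
    rw [FunOnFinite.linearMap_apply_apply]
    refine Finset.sum_eq_single u (fun i hi hiu => ?_) (by simp)
    exact absurd huv (hT.not_adj_of_eq hw hiu.symm (Finset.mem_filter.1 hi).2.symm ht)
  refine ⟨hbox, fun j j' hjj' => ?_⟩
  by_cases hj : ∀ u, L u ≠ j
  · rw [linearMap_eq_zero hj, zero_add]
    exact (hbox j').2
  by_cases hj' : ∀ v, L v ≠ j'
  · rw [linearMap_eq_zero hj', add_zero]
    exact (hbox j).2
  push Not at hj hj'
  obtain ⟨u, rfl⟩ := hj
  obtain ⟨v, rfl⟩ := hj'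
  rw [hsingle hjj', hsingle hjj'.symm]
  exact hy.2 u v (mergeGraph_adj_of_letter hL hjj')

theorem IsWord.linearMap_mem [Finite V] {𝒜 : Set (V → ℝ)}
    (h𝒜 : ∀ L ∈ S, ∀ y ∈ 𝒜, FunOnFinite.linearMap ℝ ℝ L y ∈ 𝒜) {t : ℕ} {f : V → V}
    (hf : IsWord S t f) {y : V → ℝ} (hy : y ∈ 𝒜) : FunOnFinite.linearMap ℝ ℝ f y ∈ 𝒜 := by
  induction hf generalizing y with
  | nil => simpa using hy
  | cons hL _ ih =>
    rw [FunOnFinite.linearMap_comp]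
    exact ih (h𝒜 _ hL y hy)

variable [Fintype V]

open scoped Classical in
/-- The number of states missed by a map. -/
noncomputable def defect (f : V → V) : ℕ := Fintype.card V - (Finset.univ.image f).card

open scoped Classical in
theorem card_image_add_defect (f : V → V) :
    (Finset.univ.image f).card + defect f = Fintype.card V :=
  Nat.add_sub_cancel' (Finset.card_le_univ _)

theorem sum_linearMap (f : V → V) (y : V → ℝ) :
    ∑ j, FunOnFinite.linearMap ℝ ℝ f y j = ∑ i, y i := by
  classical
  simp only [FunOnFinite.linearMap_apply_apply]
  exact Finset.sum_fiberwise _ _ _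

theorem optFace_subset {G H : SimpleGraph V} (h : G ≤ H) (hd : deficiency G = deficiency H) :
    optFace H ⊆ optFace G :=
  fun _ hy => ⟨⟨hy.1.1, fun x x' hx => hy.1.2 x x' (h hx)⟩, by rw [hd]; exact hy.2⟩

theorem linearMap_mem_optFace {t : ℕ} (hT : TripleFree S T) {L : V → V} (hL : L ∈ S)
    (ht : t + 1 < T) (hd : deficiency (mergeGraph S t) = deficiency (mergeGraph S (t + 1)))
    {y : V → ℝ} (hy : y ∈ optFace (mergeGraph S (t + 1))) :
    FunOnFinite.linearMap ℝ ℝ L y ∈ optFace (mergeGraph S t) :=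
  ⟨linearMap_mem_fracStable hT hL ht hy.1, by rw [sum_linearMap, hd]; exact hy.2⟩

/-- If the dimension did not drop, the letters would map the affine span of the optimal face into
itself, and a synchronizing word would produce a point of it supported on a single state. -/
theorem optDim_mergeGraph_succ_lt {t : ℕ} (hn : 3 ≤ Fintype.card V) (hT : TripleFree S T)
    (hsync : Synchronizing S) (ht : t + 1 < T)
    (hd : deficiency (mergeGraph S t) = deficiency (mergeGraph S (t + 1))) :
    optDim (mergeGraph S (t + 1)) < optDim (mergeGraph S t) := by
  by_contra! hge
  have hsub := optFace_subset (mergeGraph_mono (S := S) (Nat.le_add_right t 1)) hd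
  obtain ⟨y, hy⟩ := optFace_nonempty (mergeGraph S (t + 1))
  have hspan : affineSpan ℝ (optFace (mergeGraph S (t + 1))) =
      affineSpan ℝ (optFace (mergeGraph S t)) := by
    refine AffineSubspace.eq_of_direction_eq_of_nonempty_of_le ?_
      ⟨y, subset_affineSpan ℝ _ hy⟩ (affineSpan_mono ℝ hsub)
    rw [direction_affineSpan, direction_affineSpan]
    exact Submodule.eq_of_le_of_finrank_le (vectorSpan_mono ℝ hsub) hge
  have hinv : ∀ L ∈ S, ∀ y ∈ (affineSpan ℝ (optFace (mergeGraph S t)) : Set (V → ℝ)),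
      FunOnFinite.linearMap ℝ ℝ L y ∈ affineSpan ℝ (optFace (mergeGraph S t)) := by
    intro L hL y hy
    rw [← hspan] at hy
    have himage := AffineSubspace.mem_map_of_mem
      (FunOnFinite.linearMap ℝ ℝ L).toAffineMap hy
    rw [AffineSubspace.map_span] at himage
    refine affineSpan_mono ℝ (Set.image_subset_iff.2 fun z hz => ?_) himage
    exact linearMap_mem_optFace hT hL ht hd hz
  obtain ⟨x, s, f, hf, hx⟩ := hsync
  obtain ⟨i, hi, hne⟩ := exists_ne_zero_of_mem_affineSpan_optFace hn
    (hf.linearMap_mem hinv (subset_affineSpan ℝ _ (hsub hy))) x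
  exact hne (linearMap_eq_zero (fun k hk => hi (hk.symm.trans (hx k))) y)

/-- A bound for the number of times `t` at which `mergeGraph S t` has fractional matching number
`s / 2`. -/
def stageLength (s : ℕ) : ℕ := if s % 2 = 0 then s / 2 + 1 else (s - 1) / 2

/-- The total length of the stages from `a` to `b`. -/
def stageSum (a b : ℕ) : ℕ := ∑ s ∈ Finset.Icc a b, stageLength s

theorem optDim_lt_stageLength (G : SimpleGraph V) :
    optDim G + 1 ≤ stageLength (Fintype.card V - deficiency G) := by
  have := two_mul_optDim_add_deficiency G
  unfold stageLength
  split_ifs <;> omega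

theorem stageSum_mono {a b c : ℕ} (h : b ≤ c) : stageSum a b ≤ stageSum a c :=
  Finset.sum_le_sum_of_subset (Finset.Icc_subset_Icc le_rfl h)

theorem stageLength_le_stageSum {a b : ℕ} (hab : a ≤ b) : stageLength b ≤ stageSum a b :=
  Finset.single_le_sum (fun _ _ => Nat.zero_le _) (Finset.mem_Icc.2 ⟨hab, le_rfl⟩)

theorem stageSum_add_stageLength_le {a b c : ℕ} (hab : a ≤ b) (hcb : c < b) :
    stageSum a c + stageLength b ≤ stageSum a b := by
  have hsub : Finset.Icc a c ⊆ (Finset.Icc a b).erase b := fun x hx => by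
    rw [Finset.mem_Icc] at hx
    rw [Finset.mem_erase, Finset.mem_Icc]
    omega
  unfold stageSum
  rw [← Finset.sum_erase_add _ _ (Finset.mem_Icc.2 ⟨hab, le_rfl⟩)]
  exact Nat.add_le_add_right (Finset.sum_le_sum_of_subset hsub) _

/-- As long as no triple is merged, every step increases the fractional matching number or
decreases the dimension of the optimal face. -/
theorem add_optDim_le_add_stageSum {j s t : ℕ} (hn : 3 ≤ Fintype.card V) (hT : TripleFree S T)
    (hsync : Synchronizing S) (hs : s + deficiency (mergeGraph S j) ≤ Fintype.card V)
    (hjt : j ≤ t) (ht : t < T) :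
    t + 1 + optDim (mergeGraph S t) ≤
      j + stageSum s (Fintype.card V - deficiency (mergeGraph S t)) := by
  induction t, hjt using Nat.le_induction with
  | base =>
    have hdim := optDim_lt_stageLength (mergeGraph S j)
    have hle := stageLength_le_stageSum (Nat.le_sub_of_add_le hs)
    omega
  | succ t hjt ih =>
    have ih := ih (by omega)
    rcases (deficiency_anti (mergeGraph_mono (S := S) (Nat.le_add_right t 1))).lt_or_eq with h | h
    · have hj := deficiency_anti (mergeGraph_mono (S := S) hjt)
      have hdim := optDim_lt_stageLength (mergeGraph S (t + 1))
      have hcard := deficiency_le_card (mergeGraph S t)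
      have hstep := stageSum_add_stageLength_le (a := s)
        (b := Fintype.card V - deficiency (mergeGraph S (t + 1)))
        (c := Fintype.card V - deficiency (mergeGraph S t)) (by omega) (by omega)
      omega
    · have hdim := optDim_mergeGraph_succ_lt hn hT hsync ht h.symm
      rw [h]
      omega

theorem TripleFree.two_mul_defect_add_deficiency_le {j : ℕ} (hT : TripleFree S T) {f : V → V}
    (hf : IsWord S j f) (hj : j < T) :
    2 * defect f + deficiency (mergeGraph S j) ≤ Fintype.card V := by
  classical
  obtain ⟨y, hy, hsum⟩ := optFace_nonempty (mergeGraph S j)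
  have hle : ∑ i, y i ≤ (Finset.univ.image f).card := by
    rw [← sum_linearMap f, ← Finset.sum_subset (Finset.subset_univ (Finset.univ.image f))]
    · simpa using Finset.sum_le_card_nsmul (Finset.univ.image f)
        (FunOnFinite.linearMap ℝ ℝ f y) 1 fun i _ => (linearMap_mem_Icc hT hf hj hy i).2
    · exact fun x _ hx => linearMap_eq_zero
        (fun i hi => hx (Finset.mem_image.2 ⟨i, Finset.mem_univ i, hi⟩)) y
  have hdefect := card_image_add_defect f
  have hcard : Fintype.card V + deficiency (mergeGraph S j) ≤
      2 * (Finset.univ.image f).card := by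
    rw [← @Nat.cast_le ℝ]
    push_cast
    linarith
  omega

theorem TripleFree.le_add_stageSum {j : ℕ} (hT : TripleFree S T) (hn : 3 ≤ Fintype.card V)
    (hsync : Synchronizing S) {f : V → V} (hf : IsWord S j f) :
    T ≤ j + stageSum (2 * defect f) (Fintype.card V) := by
  by_cases hj : j < T
  · have hcount := add_optDim_le_add_stageSum hn hT hsync
      (hT.two_mul_defect_add_deficiency_le hf hj) (t := T - 1) (by omega) (by omega)
    have hmono := stageSum_mono (a := 2 * defect f)
      (Nat.sub_le (Fintype.card V) (deficiency (mergeGraph S (T - 1))))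
    omega
  · omega

theorem TripleFree.lt_add_stageSum_of_isolated {j t : ℕ} (hT : TripleFree S T)
    (hn : 3 ≤ Fintype.card V) (hsync : Synchronizing S) {f : V → V} (hf : IsWord S j f)
    (ht : t < T) {q : V} (hq : ∀ x, ¬ (mergeGraph S t).Adj q x) :
    t + 1 ≤ j + stageSum (2 * defect f) (Fintype.card V - 1) := by
  by_cases hj : j ≤ t
  · have hcount := add_optDim_le_add_stageSum hn hT hsync
      (hT.two_mul_defect_add_deficiency_le hf (by omega)) hj ht
    have hpos := deficiency_pos_of_isolated hq
    have hmono := stageSum_mono (a := 2 * defect f) (Nat.sub_le_sub_left hpos (Fintype.card V))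
    omega
  · omega

end Stages

section Counting

variable {V : Type*}

/-- The number of edges of a graph. -/
noncomputable def numEdges (G : SimpleGraph V) : ℕ := G.edgeSet.ncard

/-- The degree of a vertex. -/
noncomputable def deg (G : SimpleGraph V) (x : V) : ℕ := (G.neighborSet x).ncard

theorem deg_eq_degree (G : SimpleGraph V) (x : V) [Fintype (G.neighborSet x)] :
    deg G x = G.degree x := by
  rw [deg, Set.ncard_eq_toFinset_card', Set.toFinset_card, SimpleGraph.card_neighborSet_eq_degree]

theorem numEdges_lt [Finite V] {G H : SimpleGraph V} (h : G < H) : numEdges G < numEdges H :=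
  Set.ncard_lt_ncard (SimpleGraph.edgeSet_ssubset_edgeSet.2 h) (Set.toFinite _)

theorem numEdges_sup [Finite V] (G D : SimpleGraph V) :
    numEdges (G ⊔ D) = numEdges (G \ D) + numEdges D := by
  rw [← sdiff_sup_self, numEdges, SimpleGraph.edgeSet_sup]
  exact Set.ncard_union_eq (SimpleGraph.disjoint_edgeSet.2 disjoint_sdiff_self_left)

theorem deg_mono [Finite V] {G H : SimpleGraph V} (h : G ≤ H) (x : V) : deg G x ≤ deg H x :=
  Set.ncard_le_ncard (fun _ hy => h hy) (Set.toFinite _)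

theorem deg_le_card {G : SimpleGraph V} {x : V} {A : Finset V} (h : ∀ y, G.Adj x y → y ∈ A) :
    deg G x ≤ A.card := by
  rw [← Set.ncard_coe_finset]
  exact Set.ncard_le_ncard (fun y hy => h y hy) (Set.toFinite _)

theorem mem_of_adj_of_deg_le_card [Finite V] {G : SimpleGraph V} {x y : V} {B : Finset V}
    (hB : ∀ y ∈ B, G.Adj x y) (hdeg : deg G x ≤ B.card) (hy : G.Adj x y) : y ∈ B := by
  have heq : (B : Set V) = G.neighborSet x := Set.eq_of_subset_of_ncard_le hB
    (by rwa [Set.ncard_coe_finset]) (Set.toFinite _)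
  exact heq.ge hy

variable [Fintype V]

theorem sum_deg (G : SimpleGraph V) : ∑ x, deg G x = 2 * numEdges G := by
  classical
  have := G.sum_degrees_eq_twice_card_edges
  rw [numEdges, ← SimpleGraph.coe_edgeFinset, Set.ncard_coe_finset, ← this]
  refine Finset.sum_congr rfl fun x _ => ?_
  rw [deg_eq_degree]

theorem numEdges_le (G : SimpleGraph V) (A : Finset V) :
    numEdges G ≤ ∑ x ∈ A, deg G x + (Fintype.card V - A.card).choose 2 := by
  classical
  let touching : Finset (Sym2 V) := A.biUnion fun x => G.incidenceFinset x
  let avoiding : Finset (Sym2 V) := Aᶜ.offDiag.image (Sym2.mk : V → V → Sym2 V).uncurry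
  have hsub : G.edgeFinset ⊆ touching ∪ avoiding := by
    intro e he
    induction e with
    | h x y =>
      have hxy : G.Adj x y := SimpleGraph.mem_edgeFinset.1 he
      by_cases hx : x ∈ A
      · exact Finset.mem_union_left _
          (Finset.mem_biUnion.2 ⟨x, hx, by simpa [SimpleGraph.mk'_mem_incidenceSet_iff]⟩)
      by_cases hy : y ∈ A
      · exact Finset.mem_union_left _
          (Finset.mem_biUnion.2 ⟨y, hy, by simpa [SimpleGraph.mk'_mem_incidenceSet_iff]⟩)
      · exact Finset.mem_union_right _
          (Finset.mem_image.2 ⟨(x, y), by simp [hx, hy, hxy.ne], rfl⟩)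
  have htouching : touching.card ≤ ∑ x ∈ A, deg G x := by
    refine Finset.card_biUnion_le.trans (Finset.sum_le_sum fun x _ => ?_)
    rw [SimpleGraph.card_incidenceFinset_eq_degree, deg_eq_degree]
  have havoiding : avoiding.card = (Fintype.card V - A.card).choose 2 := by
    rw [← Finset.card_compl]
    exact Sym2.card_image_offDiag _
  rw [numEdges, ← SimpleGraph.coe_edgeFinset, Set.ncard_coe_finset]
  calc G.edgeFinset.card ≤ touching.card + avoiding.card :=
        (Finset.card_le_card hsub).trans (Finset.card_union_le _ _)
    _ ≤ _ := Nat.add_le_add htouching havoiding.le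

end Counting

section Growth

variable {V : Type*} [Fintype V] {S : Set (V → V)} {T : ℕ}

theorem defect_comp_le (f g : V → V) : defect (g ∘ f) ≤ defect f + defect g := by
  classical
  have hsub : Finset.univ.image g ⊆
      Finset.univ.image (g ∘ f) ∪ (Finset.univ.image f)ᶜ.image g := by
    intro y hy
    obtain ⟨x, -, rfl⟩ := Finset.mem_image.1 hy
    by_cases hx : x ∈ Finset.univ.image f
    · obtain ⟨z, -, rfl⟩ := Finset.mem_image.1 hx
      exact Finset.mem_union_left _ (Finset.mem_image.2 ⟨z, Finset.mem_univ z, rfl⟩)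
    · exact Finset.mem_union_right _ (Finset.mem_image.2 ⟨x, Finset.mem_compl.2 hx, rfl⟩)
  have hcard := (Finset.card_le_card hsub).trans (Finset.card_union_le _ _)
  have hmissed := Finset.card_image_le (s := (Finset.univ.image f)ᶜ) (f := g)
  rw [Finset.card_compl] at hmissed
  have hf := card_image_add_defect f
  have hg := card_image_add_defect g
  have hgf := card_image_add_defect (g ∘ f)
  omega

theorem defect_id : defect (id : V → V) = 0 := by
  simp [defect, Finset.card_univ]

theorem IsWord.defect_le {r t : ℕ} (hr : ∀ L ∈ S, defect L ≤ r) {f : V → V}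
    (hf : IsWord S t f) : defect f ≤ t * r := by
  induction hf with
  | nil => simp [defect_id]
  | @cons t L g hL _ ih =>
    have := defect_comp_le L g
    have := hr L hL
    rw [Nat.add_mul]
    omega

theorem defect_eq_zero_iff {f : V → V} : defect f = 0 ↔ Function.Bijective f := by
  classical
  rw [← Finite.surjective_iff_bijective, ← Set.range_eq_univ, ← Finset.coe_univ,
    ← Set.image_univ, ← Finset.coe_univ, ← Finset.coe_image, Finset.coe_inj,
    ← Finset.card_eq_iff_eq_univ]
  have := card_image_add_defect f
  omega

open scoped Classical in
/-- The states with at least two preimages under a map. -/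
noncomputable def dups (f : V → V) : Finset V :=
  Finset.univ.filter fun x => ∃ u u', u ≠ u' ∧ f u = x ∧ f u' = x

theorem mem_dups {f : V → V} {x : V} : x ∈ dups f ↔ ∃ u u', u ≠ u' ∧ f u = x ∧ f u' = x := by
  simp [dups]

theorem exists_mem_dups {f : V → V} (h : defect f ≠ 0) : ∃ x, x ∈ dups f := by
  rw [Ne, defect_eq_zero_iff, ← Finite.injective_iff_bijective, Function.not_injective_iff] at h
  obtain ⟨u, u', he, hne⟩ := h
  exact ⟨f u, mem_dups.2 ⟨u, u', hne, rfl, he.symm⟩⟩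

theorem dups_comp {f g : V → V} {x : V} (hx : x ∈ dups f) : g x ∈ dups (g ∘ f) := by
  obtain ⟨u, u', hne, hu, hu'⟩ := mem_dups.1 hx
  exact mem_dups.2 ⟨u, u', hne, congrArg g hu, congrArg g hu'⟩

theorem TripleFree.not_adj_of_mem_dups {t l : ℕ} (hT : TripleFree S T) {f : V → V}
    (hf : IsWord S l f) {x : V} (hx : x ∈ dups f) (hl : t + l < T) (w : V) :
    ¬ (mergeGraph S t).Adj x (f w) := by
  obtain ⟨u, u', hne, rfl, hu'⟩ := mem_dups.1 hx
  exact hT.not_adj_of_eq hf hne hu'.symm hl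

theorem TripleFree.deg_le_defect {t l : ℕ} (hT : TripleFree S T) {f : V → V}
    (hf : IsWord S l f) {x : V} (hx : x ∈ dups f) (hl : t + l < T) :
    deg (mergeGraph S t) x ≤ defect f := by
  classical
  have h : deg (mergeGraph S t) x ≤ (Finset.univ.image f)ᶜ.card := by
    refine deg_le_card fun y hy => Finset.mem_compl.2 fun hyf => ?_
    obtain ⟨w, -, rfl⟩ := Finset.mem_image.1 hyf
    exact hT.not_adj_of_mem_dups hf hx hl w hy
  rw [Finset.card_compl] at h
  have := card_image_add_defect f
  omega

theorem TripleFree.card_dups {l : ℕ} (hT : TripleFree S T) {f : V → V} (hf : IsWord S l f)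
    (hl : l < T) : (dups f).card = defect f := by
  classical
  have hfiber : ∀ j ∈ Finset.univ.image f,
      (Finset.univ.filter (f · = j)).card = 1 + if j ∈ dups f then 1 else 0 := by
    intro j hj
    have hpos : 0 < (Finset.univ.filter (f · = j)).card := by
      obtain ⟨i, -, hi⟩ := Finset.mem_image.1 hj
      exact Finset.card_pos.2 ⟨i, Finset.mem_filter.2 ⟨Finset.mem_univ i, hi⟩⟩
    have hdup : j ∈ dups f ↔ 1 < (Finset.univ.filter (f · = j)).card := by
      simp only [mem_dups, Finset.one_lt_card, Finset.mem_filter, Finset.mem_univ, true_and]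
      grind
    have := hT.card_fiber_le_two hf hl j
    split_ifs with h <;> rw [hdup] at h <;> omega
  have hsub : dups f ⊆ Finset.univ.image f := fun j hj => by
    obtain ⟨u, -, -, hu, -⟩ := mem_dups.1 hj
    exact Finset.mem_image.2 ⟨u, Finset.mem_univ u, hu⟩
  have hcard := Finset.card_eq_sum_card_image f Finset.univ
  rw [Finset.sum_congr rfl hfiber, Finset.sum_add_distrib, Finset.sum_ite_mem,
    Finset.inter_eq_right.2 hsub, ← Finset.card_eq_sum_ones, ← Finset.card_eq_sum_ones,
    Finset.card_univ] at hcard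
  have := card_image_add_defect f
  omega

theorem TripleFree.exists_apply_ne {l : ℕ} (hT : TripleFree S T) (hn : 3 ≤ Fintype.card V)
    {f : V → V} (hf : IsWord S l f) (hl : l < T) (q : V) : ∃ w, f w ≠ q := by
  by_contra! h
  obtain ⟨x, y, z, hxy, hxz, hyz⟩ := Fintype.two_lt_card_iff.1 hn
  rcases hT l hl f hf x y z (by rw [h, h]) (by rw [h, h]) with h | h | h
  exacts [hxy h, hyz h, hxz h]

theorem IsDead.numEdges_sdiff_add_le {D : SimpleGraph V} (hD : IsDead S D)
    (hn : 3 ≤ Fintype.card V) (hT : TripleFree S T) (hsync : Synchronizing S) {a : V → V}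
    (ha : a ∈ S) {q : V} (hq : q ∈ dups a) (hqD : ∀ x, ¬ D.Adj q x) (t₀ t : ℕ)
    (ht : t₀ + t < T) :
    numEdges (mergeGraph S t₀ \ D) + t ≤ numEdges (mergeGraph S (t₀ + t) \ D) := by
  induction t with
  | zero => rfl
  | succ t ih =>
    have hw := IsWord.letter ha
    obtain ⟨w, hwq⟩ := hT.exists_apply_ne hn hw (by omega) q
    have hlt := numEdges_lt (hD.mergeGraph_sdiff_lt_succ hsync (t := t₀ + t) hwq.symm (hqD _)
      (hT.not_adj_of_mem_dups hw hq (by omega) w))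
    have := ih (by omega)
    rw [Nat.add_assoc] at hlt
    omega

theorem IsDead.le_numEdges_sdiff {D : SimpleGraph V} (hD : IsDead S D)
    (hn : 3 ≤ Fintype.card V) (hT : TripleFree S T) (hsync : Synchronizing S) {a : V → V}
    (ha : a ∈ S) {q : V} (hq : q ∈ dups a) (hqD : ∀ x, ¬ D.Adj q x) {t : ℕ} (ht : t < T) :
    t ≤ numEdges (mergeGraph S t \ D) := by
  have := hD.numEdges_sdiff_add_le hn hT hsync ha hq hqD 0 t (by omega)
  rw [Nat.zero_add] at this
  omega

theorem defect_le_numEdges {a : V → V} (ha : a ∈ S) :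
    defect a ≤ numEdges (mergeGraph S 1) := by
  classical
  choose! s hs using fun (y : V) (hy : ∃ x, a x = y) => hy
  have has (x : V) : a (s (a x)) = a x := hs _ ⟨x, rfl⟩
  have hidem (x : V) : s (a (s (a x))) = s (a x) := congrArg s (has x)
  have hedges : (Finset.univ.filter fun x => s (a x) ≠ x).card ≤ numEdges (mergeGraph S 1) := by
    rw [numEdges, ← Set.ncard_coe_finset]
    refine Set.ncard_le_ncard_of_injOn (fun x => s(x, s (a x))) ?_ ?_ (Set.toFinite _)
    · intro x hx
      have hx' : s (a x) ≠ x := by simpa using hx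
      exact mergeGraph_adj_of_eq (t := 0) ha hx'.symm (has x).symm
    · intro x hx y _ hxy
      have hx' : s (a x) ≠ x := by simpa using hx
      rcases Sym2.eq_iff.1 hxy with ⟨h, -⟩ | ⟨h, -⟩
      · exact h
      · exact absurd (by rw [h, hidem]) hx'
  have hfixed : (Finset.univ.filter fun x => s (a x) = x).card ≤ (Finset.univ.image a).card := by
    refine (Finset.card_le_card fun x hx => ?_).trans (Finset.card_image_le (f := s))
    exact Finset.mem_image.2
      ⟨a x, Finset.mem_image_of_mem a (Finset.mem_univ x), (Finset.mem_filter.1 hx).2⟩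
  have hsplit := Finset.card_filter_add_card_filter_not
    (s := (Finset.univ : Finset V)) (p := fun x => s (a x) = x)
  rw [Finset.card_univ, ← card_image_add_defect a] at hsplit
  change _ + (Finset.univ.filter fun x => s (a x) ≠ x).card = _ at hsplit
  omega

theorem TripleFree.add_defect_le_numEdges (hT : TripleFree S T) (hn : 3 ≤ Fintype.card V)
    (hsync : Synchronizing S) {a : V → V} (ha : a ∈ S) (hdef : 0 < defect a) {t : ℕ}
    (ht1 : 1 ≤ t) (ht : t < T) : t + defect a ≤ numEdges (mergeGraph S t) + 1 := by
  obtain ⟨q, hq⟩ := exists_mem_dups hdef.ne'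
  have hgrow := (isDead_bot S).numEdges_sdiff_add_le hn hT hsync ha hq (fun _ h => h)
    1 (t - 1) (by omega)
  rw [sdiff_bot, sdiff_bot, Nat.add_sub_cancel' ht1] at hgrow
  have := defect_le_numEdges ha
  omega

theorem StronglyConnected.exists_apply_notMem (hsc : StronglyConnected S) {B : Finset V}
    (hB : B.Nonempty) (hlt : B.card < Fintype.card V) : ∃ x ∈ B, ∃ L ∈ S, L x ∉ B := by
  by_contra! h
  obtain ⟨b, hb⟩ := hB
  obtain ⟨y, -, hy⟩ := Finset.exists_mem_notMem_of_card_lt_card (t := Finset.univ) hlt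
  obtain ⟨t, f, hf, rfl⟩ := hsc b y
  have hinv : ∀ x ∈ B, f x ∈ B := by
    clear hy
    induction hf with
    | nil => exact fun x hx => hx
    | cons hL _ ih => exact fun x hx => ih _ (h x hx _ hL)
  exact hy (hinv b hb)

theorem StronglyConnected.exists_superset_sum_le (hsc : StronglyConnected S) {R : ℕ → Set V}
    (hR : Monotone R) (hstep : ∀ {k x L}, L ∈ S → x ∈ R k → L x ∈ R (k + 1)) {A : Finset V}
    (hA : A.Nonempty) {k : ℕ} (hAk : ∀ x ∈ A, x ∈ R k) {m : ℕ}
    (hm : A.card + m ≤ Fintype.card V) {d : V → ℕ} {c : ℕ → ℕ}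
    (hd : ∀ i < m, ∀ x ∈ R (k + 1 + i), d x ≤ c (k + 1 + i)) :
    ∃ B, A ⊆ B ∧ B.card = A.card + m ∧ (∀ x ∈ B, x ∈ R (k + m)) ∧
      ∑ x ∈ B, d x ≤ ∑ x ∈ A, d x + ∑ i ∈ Finset.range m, c (k + 1 + i) := by
  classical
  induction m with
  | zero => exact ⟨A, subset_rfl, rfl, hAk, by simp⟩
  | succ m ih =>
    obtain ⟨B, hAB, hcard, hBk, hsum⟩ := ih (by omega) fun i hi => hd i (by omega)
    obtain ⟨x, hx, L, hL, hLx⟩ := hsc.exists_apply_notMem (hA.mono hAB) (by omega)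
    have hLk := hstep hL (hBk x hx)
    refine ⟨insert (L x) B, hAB.trans (Finset.subset_insert _ _), ?_, ?_, ?_⟩
    · rw [Finset.card_insert_of_notMem hLx, hcard, Nat.add_assoc]
    · intro y hy
      rcases Finset.mem_insert.1 hy with rfl | hy
      · exact hLk
      · exact hR (Nat.le_add_right _ 1) (hBk y hy)
    · rw [Finset.sum_insert hLx, Finset.sum_range_succ]
      have := hd m (Nat.lt_add_one m) (L x) (Nat.add_right_comm k m 1 ▸ hLk)
      omega

theorem StronglyConnected.mem_of_step (hsc : StronglyConnected S) {R : ℕ → Set V}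
    (hR : Monotone R) (hstep : ∀ {k x L}, L ∈ S → x ∈ R k → L x ∈ R (k + 1)) {q : V} {k : ℕ}
    (hq : q ∈ R k) (x : V) : x ∈ R (k + (Fintype.card V - 1)) := by
  have hpos : 0 < Fintype.card V := Fintype.card_pos_iff.2 ⟨q⟩
  obtain ⟨B, -, hB, hBk, -⟩ := hsc.exists_superset_sum_le hR hstep (d := 0) (c := 0)
    (m := Fintype.card V - 1) (Finset.singleton_nonempty q) (by simpa using hq)
    (by rw [Finset.card_singleton]; omega) (by simp)
  rw [Finset.card_singleton] at hB
  exact hBk x ((Finset.card_eq_iff_eq_univ B).1 (by omega) ▸ Finset.mem_univ x)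

/-- The states with at least two preimages under some word of length at most `k`. -/
def duplicated (S : Set (V → V)) (k : ℕ) : Set V :=
  {x | ∃ s ≤ k, ∃ f, IsWord S s f ∧ x ∈ dups f}

theorem mem_duplicated_one {a : V → V} (ha : a ∈ S) {x : V} (hx : x ∈ dups a) :
    x ∈ duplicated S 1 := ⟨1, le_rfl, a, IsWord.letter ha, hx⟩

theorem duplicated_mono : Monotone (duplicated S) :=
  fun _ _ h _ ⟨s, hs, hf⟩ => ⟨s, hs.trans h, hf⟩

theorem apply_mem_duplicated {k : ℕ} {x : V} {L : V → V} (hL : L ∈ S)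
    (hx : x ∈ duplicated S k) : L x ∈ duplicated S (k + 1) := by
  obtain ⟨s, hs, f, hf, hxf⟩ := hx
  exact ⟨s + 1, by omega, L ∘ f, hf.snoc hL, dups_comp hxf⟩

theorem StronglyConnected.sum_le_of_duplicated (hsc : StronglyConnected S) {A : Finset V}
    (hA : A.Nonempty) {k : ℕ} (hAk : ∀ x ∈ A, x ∈ duplicated S k) {d : V → ℕ} {c : ℕ → ℕ}
    (hd : ∀ i < Fintype.card V - A.card, ∀ x ∈ duplicated S (k + 1 + i), d x ≤ c (k + 1 + i)) :
    ∑ x, d x ≤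
      ∑ x ∈ A, d x + ∑ i ∈ Finset.range (Fintype.card V - A.card), c (k + 1 + i) := by
  have hle := Finset.card_le_univ A
  obtain ⟨B, -, hB, -, hsum⟩ := hsc.exists_superset_sum_le duplicated_mono apply_mem_duplicated
    hA hAk (by omega) hd
  rwa [(Finset.card_eq_iff_eq_univ B).1 (by omega)] at hsum

theorem StronglyConnected.exists_insert_duplicated [DecidableEq V] (hsc : StronglyConnected S)
    {A : Finset V} (hA : A.Nonempty) (hlt : A.card < Fintype.card V) {k : ℕ}
    (hAk : ∀ x ∈ A, x ∈ duplicated S k) : ∃ x ∈ A, ∃ L ∈ S, L x ∉ A ∧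
      ∀ y ∈ insert (L x) A, y ∈ duplicated S (k + 1) := by
  obtain ⟨x, hx, L, hL, hLx⟩ := hsc.exists_apply_notMem hA hlt
  refine ⟨x, hx, L, hL, hLx, fun y hy => ?_⟩
  rcases Finset.mem_insert.1 hy with rfl | hy
  · exact apply_mem_duplicated hL (hAk x hx)
  · exact duplicated_mono (Nat.le_add_right k 1) (hAk y hy)

end Growth

/-- An upper bound for the defect of a word of length at most `j` on `n` states when no word of
length below `T` maps three states to one and every letter has defect at most `r`. -/
def defectCap (n T r j : ℕ) : ℕ :=
  Nat.findGreatest (fun δ => δ ≤ j * r ∧ T ≤ j + stageSum (2 * δ) n) n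

/-- The resulting upper bound for the sum of all degrees of a merge graph: the `r` states
duplicated by a letter of defect `r` have degree at most `defectCap n T r 1`, and strong
connectivity reaches the other states one by one, by words whose length grows by one each time. -/
def degreeSumCap (n T r : ℕ) : ℕ :=
  r * defectCap n T r 1 + ∑ i ∈ Finset.range (n - r), defectCap n T r (i + 2)

section Caps

variable {V : Type*} [Fintype V] {S : Set (V → V)} {T r : ℕ}

theorem TripleFree.defect_le_defectCap (hT : TripleFree S T) (hn : 3 ≤ Fintype.card V)
    (hsync : Synchronizing S) (hr : ∀ L ∈ S, defect L ≤ r) {s j : ℕ} (hs : s ≤ j) {f : V → V}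
    (hf : IsWord S s f) : defect f ≤ defectCap (Fintype.card V) T r j := by
  refine Nat.le_findGreatest (Nat.sub_le _ _)
    ⟨(hf.defect_le hr).trans (Nat.mul_le_mul_right r hs), ?_⟩
  have := hT.le_add_stageSum hn hsync hf
  omega

theorem TripleFree.deg_le_defectCap (hT : TripleFree S T) (hn : 3 ≤ Fintype.card V)
    (hsync : Synchronizing S) (hr : ∀ L ∈ S, defect L ≤ r) {j t : ℕ} (ht : t + j < T) {x : V}
    (hx : x ∈ duplicated S j) : deg (mergeGraph S t) x ≤ defectCap (Fintype.card V) T r j := by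
  obtain ⟨s, hs, f, hf, hxf⟩ := hx
  exact (hT.deg_le_defect hf hxf (by omega)).trans (hT.defect_le_defectCap hn hsync hr hs hf)

theorem TripleFree.two_mul_numEdges_le_degreeSumCap (hT : TripleFree S T)
    (hn : 3 ≤ Fintype.card V) (hsc : StronglyConnected S) (hsync : Synchronizing S)
    {a : V → V} (ha : a ∈ S) (hr : ∀ L ∈ S, defect L ≤ defect a) (hpos : 0 < defect a) {t : ℕ}
    (ht : t + (Fintype.card V - defect a + 1) < T) :
    2 * numEdges (mergeGraph S t) ≤ degreeSumCap (Fintype.card V) T (defect a) := by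
  have hcard := hT.card_dups (IsWord.letter ha) (by omega)
  have hsum := hsc.sum_le_of_duplicated (d := deg (mergeGraph S t))
    (Finset.card_pos.1 (hcard ▸ hpos)) (fun x hx => mem_duplicated_one ha hx)
    fun i hi x hx => hT.deg_le_defectCap hn hsync hr (by omega) hx
  have hdups := Finset.sum_le_card_nsmul (dups a) (deg (mergeGraph S t)) _ fun x hx =>
    hT.deg_le_defectCap hn hsync hr (by omega) (mem_duplicated_one ha hx)
  rw [sum_deg, hcard] at hsum
  rw [hcard, smul_eq_mul] at hdups
  refine hsum.trans (Nat.add_le_add hdups (Finset.sum_le_sum fun i _ => ?_))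
  rw [show 1 + 1 + i = i + 2 by omega]

end Caps

section Numerics

theorem four_mul_stageSum (δ k : ℕ) :
    4 * stageSum (2 * δ) (2 * δ + k) + 4 * δ ^ 2 =
      (2 * δ + k + 1) ^ 2 + if k % 2 = 0 then 3 else 0 := by
  induction k with
  | zero =>
    have : stageLength (2 * δ) = δ + 1 := by simp [stageLength]
    simp only [stageSum, Nat.add_zero, Finset.Icc_self, Finset.sum_singleton, this,
      Nat.zero_mod, if_true]
    ring
  | succ k ih =>
    have hsucc : stageSum (2 * δ) (2 * δ + (k + 1)) =
        stageSum (2 * δ) (2 * δ + k) + stageLength (2 * δ + k + 1) :=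
      Finset.sum_Icc_succ_top (b := 2 * δ + k) (by omega) _
    rw [hsucc]
    rcases Nat.even_or_odd' k with ⟨m, rfl | rfl⟩
    · have hlen : stageLength (2 * δ + 2 * m + 1) = δ + m := by unfold stageLength; grind
      rw [if_pos (by omega)] at ih
      rw [if_neg (by omega), hlen]
      linarith
    · have hlen : stageLength (2 * δ + (2 * m + 1) + 1) = δ + m + 2 := by
        unfold stageLength; grind
      rw [if_neg (by omega)] at ih
      rw [if_pos (by omega), hlen]
      linarith

theorem stageSum_two_mul_le {δ n : ℕ} (h : stageSum (2 * δ) n ≠ 0) :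
    4 * stageSum (2 * δ) n + 4 * δ ^ 2 ≤ (n + 1) ^ 2 + 3 := by
  by_cases hn : 2 * δ ≤ n
  · obtain ⟨k, rfl⟩ := Nat.exists_eq_add_of_le hn
    have := four_mul_stageSum δ k
    split_ifs at this <;> omega
  · exact absurd (by rw [stageSum, Finset.Icc_eq_empty (by omega), Finset.sum_empty]) h

theorem defectCap_le_mul (n T r j : ℕ) : defectCap n T r j ≤ j * r := by
  by_cases h : defectCap n T r j = 0
  · omega
  · exact (Nat.findGreatest_of_ne_zero rfl h).1

variable {n T : ℕ} {u : ℝ}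

theorem mul_defectCap_le (hun : u ^ 2 + u * n = n ^ 2 + n - 3) (hT : n * (u + 3) / 4 < T)
    {j : ℕ} (hj : j < T) (hnonneg : 0 ≤ u ^ 2 / 2 + j - n / 2 + 7 / 4) (r : ℕ) :
    u * defectCap n T r j ≤ u ^ 2 / 2 + j - n / 2 + 7 / 4 := by
  by_cases h : defectCap n T r j = 0
  · simpa [h] using hnonneg
  · have hstage : T ≤ j + stageSum (2 * defectCap n T r j) n :=
      (Nat.findGreatest_of_ne_zero (P := fun δ => δ ≤ j * r ∧ T ≤ j + stageSum (2 * δ) n) rfl h).2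
    have hsum := stageSum_two_mul_le (δ := defectCap n T r j) (n := n) (by omega)
    generalize defectCap n T r j = ρ at *
    have hcast : (4 : ℝ) * T + 4 * ρ ^ 2 ≤ 4 * j + (n + 1) ^ 2 + 3 := by
      have : 4 * T + 4 * ρ ^ 2 ≤ 4 * j + (n + 1) ^ 2 + 3 := by omega
      exact_mod_cast this
    nlinarith [sq_nonneg (u / 2 - ρ)]

theorem mul_sum_defectCap_le (hun : u ^ 2 + u * n = n ^ 2 + n - 3) (hT : n * (u + 3) / 4 < T)
    (hnonneg : 0 ≤ u ^ 2 / 2 - n / 2 + 7 / 4) (r c : ℕ) {m : ℕ} (hm : m + c ≤ T) :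
    u * ∑ i ∈ Finset.range m, (defectCap n T r (i + c) : ℝ) ≤
      m * (u ^ 2 / 2 - n / 2 + 7 / 4 + c) + m * (m - 1) / 2 := by
  induction m with
  | zero => simp
  | succ m ih =>
    have hinit := ih (by omega)
    have hlast := mul_defectCap_le hun hT (j := m + c) (by omega)
      (by push_cast; linarith [(Nat.cast_nonneg m : (0 : ℝ) ≤ m),
        (Nat.cast_nonneg c : (0 : ℝ) ≤ c)]) r
    rw [Finset.sum_range_succ, mul_add]
    push_cast at hlast ⊢
    linarith

theorem three_mul_le_five_mul (hn : 28 ≤ n) (hu : 0 < u)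
    (hun : u ^ 2 + u * n = n ^ 2 + n - 3) : 3 / 5 * (n : ℝ) ≤ u := by
  have : (28 : ℝ) ≤ n := by exact_mod_cast hn
  nlinarith

theorem add_five_lt (hn : 28 ≤ n) (hu : 3 / 5 * (n : ℝ) ≤ u) (hT : n * (u + 3) / 4 < T) :
    n + 5 < T := by
  have hn' : (28 : ℝ) ≤ n := by exact_mod_cast hn
  have : ((n + 5 : ℕ) : ℝ) < T := by push_cast; nlinarith
  exact_mod_cast this

theorem sq_half_sub_nonneg (hn : 28 ≤ n) (hu : 3 / 5 * (n : ℝ) ≤ u) :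
    0 ≤ u ^ 2 / 2 - n / 2 + 7 / 4 := by
  have hn' : (28 : ℝ) ≤ n := by exact_mod_cast hn
  nlinarith

theorem add_twelve_mul_le_four_mul (hn : 28 ≤ n) (hu : 3 / 5 * (n : ℝ) ≤ u) :
    u * n / 2 + 12 * u + 9 * n / 4 ≤ 4 * (u ^ 2 / 2 - n / 2 + 11 / 4) := by
  have hn' : (28 : ℝ) ≤ n := by exact_mod_cast hn
  have h₁ : 0 ≤ (u - 3 / 5 * n) * (2 * u - n / 2 - 12) :=
    mul_nonneg (by linarith) (by linarith)
  have h₂ : 0 ≤ 2 * (u - 3 / 5 * n) * (3 / 5 * n) := mul_nonneg (by linarith) (by linarith)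
  nlinarith

theorem add_three_mul_le_three_mul (hn : 28 ≤ n) (hu : 3 / 5 * (n : ℝ) ≤ u) :
    u * n / 2 + 3 * u + 9 * n / 4 ≤ 3 * (u ^ 2 / 2 - n / 2 + 11 / 4) := by
  have hn' : (28 : ℝ) ≤ n := by exact_mod_cast hn
  have h₁ : 0 ≤ (u - 3 / 5 * n) * (3 / 2 * u - n / 2 - 3) :=
    mul_nonneg (by linarith) (by linarith)
  have h₂ : 0 ≤ 3 / 2 * (u - 3 / 5 * n) * (3 / 5 * n) := mul_nonneg (by linarith) (by linarith)
  nlinarith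

theorem mul_degreeSumCap_one_le (hn : 28 ≤ n) (hu : 3 / 5 * (n : ℝ) ≤ u)
    (hun : u ^ 2 + u * n = n ^ 2 + n - 3) (hT : n * (u + 3) / 4 < T) :
    u * degreeSumCap n T 1 ≤ u * (n * (u + 3) / 2 - 2 * n - 2) := by
  have hTn := add_five_lt hn hu hT
  have htail := mul_sum_defectCap_le hun hT (sq_half_sub_nonneg hn hu) 1 5 (m := n - 4) (by omega)
  have hhead (j : ℕ) : u * (defectCap n T 1 j : ℝ) ≤ u * j := by
    have := defectCap_le_mul n T 1 j
    rw [Nat.mul_one] at this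
    exact mul_le_mul_of_nonneg_left (by exact_mod_cast this)
      (hu.trans' (by positivity))
  have h₁ := hhead 1
  have h₂ := hhead 2
  have h₃ := hhead 3
  have h₄ := hhead 4
  have hquad := add_twelve_mul_le_four_mul hn hu
  rw [degreeSumCap, show n - 1 = n - 4 + 1 + 1 + 1 by omega, Finset.sum_range_succ',
    Finset.sum_range_succ', Finset.sum_range_succ']
  simp only [Nat.add_assoc, Nat.reduceAdd]
  rw [Nat.cast_sub (by omega)] at htail
  push_cast at *
  linarith

theorem mul_degreeSumCap_two_le (hn : 28 ≤ n) (hu : 3 / 5 * (n : ℝ) ≤ u)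
    (hun : u ^ 2 + u * n = n ^ 2 + n - 3) (hT : n * (u + 3) / 4 < T) :
    u * degreeSumCap n T 2 ≤ u * (n * (u + 3) / 2 - 2 * n + 2) := by
  have hTn := add_five_lt hn hu hT
  have htail := mul_sum_defectCap_le hun hT (sq_half_sub_nonneg hn hu) 2 4 (m := n - 4) (by omega)
  have hhead (j : ℕ) : u * (defectCap n T 2 j : ℝ) ≤ u * (j * 2) :=
    mul_le_mul_of_nonneg_left (by exact_mod_cast defectCap_le_mul n T 2 j)
      (hu.trans' (by positivity))
  have h₁ := hhead 1
  have h₂ := hhead 2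
  have h₃ := hhead 3
  have hquad := add_twelve_mul_le_four_mul hn hu
  rw [degreeSumCap, show n - 2 = n - 4 + 1 + 1 by omega, Finset.sum_range_succ',
    Finset.sum_range_succ']
  simp only [Nat.add_assoc, Nat.reduceAdd]
  rw [Nat.cast_sub (by omega)] at htail
  push_cast at *
  linarith

theorem mul_degreeSumCap_le_of_three_le (hn : 28 ≤ n) {r : ℕ} (hr : 3 ≤ r) (hrn : r + 3 ≤ n)
    (hu : 3 / 5 * (n : ℝ) ≤ u) (hun : u ^ 2 + u * n = n ^ 2 + n - 3)
    (hT : n * (u + 3) / 4 < T) :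
    u * degreeSumCap n T r ≤ u * (n * (u + 3) / 2 - 2 * n + 4 * r - 6) := by
  have hr' : (3 : ℝ) ≤ r := by exact_mod_cast hr
  have hrn' : (r : ℝ) + 3 ≤ n := by exact_mod_cast hrn
  have hTn := add_five_lt hn hu hT
  have hnonneg := sq_half_sub_nonneg hn hu
  have hquad₃ := add_three_mul_le_three_mul hn hu
  have hquad₄ := add_twelve_mul_le_four_mul hn hu
  have htail : u * ∑ i ∈ Finset.range (n - r), (defectCap n T r (i + 2) : ℝ) ≤
      n * u ^ 2 / 2 + 9 * n / 4 - r * (u ^ 2 / 2 - n / 2 + 11 / 4) := by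
    have hsum := mul_sum_defectCap_le hun hT hnonneg r 2 (m := n - r) (by omega)
    have : 0 ≤ ((r : ℝ) - 1) * (n - r / 2) := mul_nonneg (by linarith) (by linarith)
    rw [Nat.cast_sub (by omega)] at hsum
    push_cast at hsum
    linarith
  rw [degreeSumCap]
  push_cast
  by_cases hX : u ^ 2 / 2 - n / 2 + 11 / 4 ≤ u * r
  · have := mul_le_mul_of_nonneg_left
      (mul_defectCap_le hun hT (j := 1) (by omega) (by push_cast; linarith) r)
      (Nat.cast_nonneg (α := ℝ) r)
    push_cast at this
    linarith
  · have hcap : (defectCap n T r 1 : ℝ) ≤ r := by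
      exact_mod_cast (defectCap_le_mul n T r 1).trans_eq (Nat.one_mul r)
    have h₁ : 0 ≤ ((r : ℝ) - 3) * (u ^ 2 / 2 - n / 2 + 11 / 4 - u * r + u) :=
      mul_nonneg (by linarith) (by linarith)
    have h₂ : 0 ≤ u * r * (r - defectCap n T r 1) :=
      mul_nonneg (mul_nonneg (by linarith) (by linarith)) (by linarith)
    linarith

theorem degreeSumCap_lt_of_large (hn : 28 ≤ n) {r t : ℕ} (hr : 1 ≤ r) (hrn : r + 3 ≤ n)
    (hu : 0 < u) (hun : u ^ 2 + u * n = n ^ 2 + n - 3) (hT : n * (u + 3) / 4 < T)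
    (ht : t + (n - r + 1) + 1 = T) :
    2 + degreeSumCap n T r < 2 * (t + r) := by
  have hu' := three_mul_le_five_mul hn hu hun
  have hmul : u * degreeSumCap n T r ≤ u * (n * (u + 3) / 2 - 2 * n + 4 * r - 6) := by
    rcases (show r = 1 ∨ r = 2 ∨ 3 ≤ r by omega) with rfl | rfl | h3
    · refine (mul_degreeSumCap_one_le hn hu' hun hT).trans_eq ?_
      push_cast
      ring
    · refine (mul_degreeSumCap_two_le hn hu' hun hT).trans_eq ?_
      push_cast
      ring
    · exact mul_degreeSumCap_le_of_three_le hn h3 hrn hu' hun hT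
  have hcap := le_of_mul_le_mul_left hmul hu
  have ht' : (t : ℝ) + n + 2 = T + r := by
    have : t + n + 2 = T + r := by omega
    exact_mod_cast this
  have : (2 : ℝ) + degreeSumCap n T r < 2 * (t + r) := by linarith
  exact_mod_cast this

/-- The integer part of `tripleBound`, in a form that can be computed. -/
def floorBound (n : ℕ) : ℕ :=
  (Nat.sqrt (n ^ 2 * (5 * n ^ 2 + 4 * n - 12)) + 6 * n - n ^ 2) / 8

theorem floorBound_le_tripleBound {n : ℕ} (hn : 2 ≤ n) : (floorBound n : ℝ) ≤ tripleBound n := by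
  have hpoly : ((n ^ 2 * (5 * n ^ 2 + 4 * n - 12) : ℕ) : ℝ) =
      (n : ℝ) ^ 2 * (5 * n ^ 2 + 4 * n - 12) := by
    rw [Nat.cast_mul, Nat.cast_sub (by nlinarith)]
    push_cast
    ring
  have hroot : (Nat.sqrt (n ^ 2 * (5 * n ^ 2 + 4 * n - 12)) : ℝ) ≤
      n * √(5 * (n : ℝ) ^ 2 + 4 * n - 12) := by
    have := Real.nat_sqrt_le_real_sqrt (a := n ^ 2 * (5 * n ^ 2 + 4 * n - 12))
    rwa [hpoly, Real.sqrt_mul (sq_nonneg _), Real.sqrt_sq n.cast_nonneg] at this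
  have hsquare : n ^ 2 ≤ Nat.sqrt (n ^ 2 * (5 * n ^ 2 + 4 * n - 12)) := by
    have h : n ^ 2 ≤ 5 * n ^ 2 + 4 * n - 12 := Nat.le_sub_of_add_le (by nlinarith)
    exact Nat.le_sqrt.2 (Nat.mul_le_mul_left _ h)
  have hfloor : 8 * floorBound n + n ^ 2 ≤
      Nat.sqrt (n ^ 2 * (5 * n ^ 2 + 4 * n - 12)) + 6 * n := by
    unfold floorBound
    omega
  have hfloor' : (8 : ℝ) * floorBound n + n ^ 2 ≤
      Nat.sqrt (n ^ 2 * (5 * n ^ 2 + 4 * n - 12)) + 6 * n := by exact_mod_cast hfloor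
  rw [tripleBound]
  linarith

theorem degreeSumCap_floorBound_lt : ∀ n ∈ Finset.Ico 4 28,
    ∀ r ∈ Finset.Icc (if n < 14 then 2 else 1) (n / 2),
      n - r + 1 < floorBound n ∧ 2 + degreeSumCap n (floorBound n + 1) r <
        2 * (floorBound n - (n - r + 1) + r) := by
  decide +kernel

end Numerics

section MergeFamily

variable {V : Type*} [Fintype V] {S : Set (V → V)} {T e : ℕ} {c : ℕ → ℕ}
  {F : ℕ → SimpleGraph V}

/-- The value `c j` bounds the defects of the words of length at most `j`. -/
def BoundsDefect (S : Set (V → V)) (c : ℕ → ℕ) : Prop :=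
  ∀ j, ∀ s ≤ j, ∀ f, IsWord S s f → defect f ≤ c j

theorem TripleFree.boundsDefect_defectCap {r : ℕ} (hT : TripleFree S T)
    (hn : 3 ≤ Fintype.card V) (hsync : Synchronizing S) (hr : ∀ L ∈ S, defect L ≤ r) :
    BoundsDefect S (defectCap (Fintype.card V) T r) :=
  fun _ _ hs _ hf => hT.defect_le_defectCap hn hsync hr hs hf

/-- An increasing sequence of graphs with the properties of the merge graphs from which degrees
and edges are counted. Enlarging the merge graphs by pairs that are never merged improves the
offset `e` in the number of edges. -/
structure IsMergeFamily (S : Set (V → V)) (T e : ℕ) (F : ℕ → SimpleGraph V) : Prop where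
  monotone : Monotone F
  not_adj_of_mem_dups : ∀ {t l : ℕ} {f : V → V} {x : V}, IsWord S l f → x ∈ dups f →
    t + l < T → ∀ y, ¬ (F t).Adj x (f y)
  adj_of_letter : ∀ {t : ℕ} {L : V → V} {x y : V}, L ∈ S → (F t).Adj (L x) (L y) →
    (F (t + 1)).Adj x y
  add_le_numEdges : ∀ {t : ℕ}, t < T → t + e ≤ numEdges (F t)

namespace IsMergeFamily

theorem deg_mono (hF : IsMergeFamily S T e F) {s t : ℕ} (h : s ≤ t) (x : V) :
    deg (F s) x ≤ deg (F t) x := _root_.deg_mono (hF.monotone h) x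

theorem deg_le_of_mem_duplicated (hF : IsMergeFamily S T e F) (hc : BoundsDefect S c)
    {t j : ℕ} (ht : t + j < T) {x : V} (hx : x ∈ duplicated S j) : deg (F t) x ≤ c j := by
  classical
  obtain ⟨s, hs, f, hf, hxf⟩ := hx
  have hdeg : deg (F t) x ≤ (Finset.univ.image f)ᶜ.card := by
    refine deg_le_card fun y hy => Finset.mem_compl.2 fun hyf => ?_
    obtain ⟨w, -, rfl⟩ := Finset.mem_image.1 hyf
    exact hF.not_adj_of_mem_dups hf hxf (by omega) w hy
  rw [Finset.card_compl] at hdeg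
  exact hdeg.trans (hc j s hs f hf)

theorem deg_apply_le (hF : IsMergeFamily S T e F) {t : ℕ} {L : V → V} (hL : L ∈ S) (x : V) :
    deg (F t) (L x) ≤ deg (F (t + 1)) x + defect L := by
  classical
  have hsub : (F t).neighborSet (L x) ⊆
      L '' (F (t + 1)).neighborSet x ∪ ((Finset.univ.image L)ᶜ : Finset V) := by
    intro y hy
    by_cases hyL : ∃ u, L u = y
    · obtain ⟨u, rfl⟩ := hyL
      exact Or.inl ⟨u, hF.adj_of_letter hL hy, rfl⟩
    · exact Or.inr (by simpa using hyL)
  refine (Set.ncard_le_ncard hsub (Set.toFinite _)).trans ((Set.ncard_union_le _ _).trans ?_)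
  refine Nat.add_le_add (Set.ncard_image_le (Set.toFinite _)) ?_
  rw [Set.ncard_coe_finset, Finset.card_compl]
  exact le_rfl

theorem deg_apply_le_of_bijective (hF : IsMergeFamily S T e F) {t : ℕ} {L : V → V} (hL : L ∈ S)
    (hb : Function.Bijective L) (x : V) : deg (F t) (L x) ≤ deg (F (t + 1)) x := by
  simpa [defect_eq_zero_iff.2 hb] using hF.deg_apply_le (t := t) hL x

theorem add_le_sum_deg_add_choose (hF : IsMergeFamily S T e F) {t : ℕ} (ht : t < T)
    (A : Finset V) :
    t + e ≤ ∑ x ∈ A, deg (F t) x + (Fintype.card V - A.card).choose 2 :=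
  (hF.add_le_numEdges ht).trans (numEdges_le _ A)

theorem two_mul_add_le_sum_deg_add (hF : IsMergeFamily S T e F) (hsc : StronglyConnected S)
    (hc : BoundsDefect S c) {A : Finset V} (hA : A.Nonempty) {k : ℕ}
    (hAk : ∀ x ∈ A, x ∈ duplicated S k) {t : ℕ} (ht : t + k + (Fintype.card V - A.card) < T) :
    2 * (t + e) ≤
      ∑ x ∈ A, deg (F t) x + ∑ i ∈ Finset.range (Fintype.card V - A.card), c (k + 1 + i) := by
  have hsum := hsc.sum_le_of_duplicated (d := deg (F t)) hA hAk fun i hi x hx =>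
    hF.deg_le_of_mem_duplicated hc (by omega) hx
  rw [sum_deg] at hsum
  exact (Nat.mul_le_mul_left 2 (hF.add_le_numEdges (by omega))).trans hsum

end IsMergeFamily

theorem IsDead.isMergeFamily {D : SimpleGraph V} (hD : IsDead S D)
    (hmatching : ∀ {x y y'}, D.Adj x y → D.Adj x y' → y = y') (hn : 3 ≤ Fintype.card V)
    (hT : TripleFree S T) (hsync : Synchronizing S) {a : V → V} (ha : a ∈ S) {q : V}
    (hq : q ∈ dups a) (hqD : ∀ x, ¬ D.Adj q x) :
    IsMergeFamily S T (numEdges D) fun t => mergeGraph S t ⊔ D where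
  monotone _ _ h := sup_le_sup_right (mergeGraph_mono h) D
  not_adj_of_mem_dups {t l f x} hf hx hl y := by
    rintro (hadj | hadj)
    · exact hT.not_adj_of_mem_dups hf hx hl y hadj
    · obtain ⟨u, u', hne, rfl, hu'⟩ := mem_dups.1 hx
      have hu := hD.adj_of_isWord hf hadj
      exact hne (hmatching hu.symm (hD.adj_of_isWord hf (hu' ▸ hadj)).symm)
  adj_of_letter {t L x y} hL := by
    rintro (hadj | hadj)
    · exact Or.inl (mergeGraph_adj_of_letter hL hadj)
    · exact Or.inr (hD.adj_of_isWord (IsWord.letter hL) hadj)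
  add_le_numEdges ht := by
    rw [numEdges_sup]
    exact Nat.add_le_add_right (hD.le_numEdges_sdiff hn hT hsync ha hq hqD ht) _

theorem TripleFree.isMergeFamily_mergeGraph (hT : TripleFree S T) (hn : 3 ≤ Fintype.card V)
    (hsync : Synchronizing S) {a : V → V} (ha : a ∈ S) {q : V} (hq : q ∈ dups a) :
    IsMergeFamily S T 0 (mergeGraph S) := by
  simpa [numEdges] using (isDead_bot S).isMergeFamily (fun h => h.elim) hn hT hsync ha hq
    fun _ h => h

theorem lt_floorBound : ∀ n ∈ Finset.Ico 4 14, n < floorBound n := by decide +kernel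

theorem TripleFree.dups_unique (hT : TripleFree S (floorBound (Fintype.card V) + 1))
    (hn : 4 ≤ Fintype.card V) (hn' : Fintype.card V < 14) (hsc : StronglyConnected S)
    (hsync : Synchronizing S) (hr : ∀ L ∈ S, defect L ≤ 1) {a b : V → V} (ha : a ∈ S)
    (hb : b ∈ S) {p q : V} (hp : p ∈ dups a) (hq : q ∈ dups b) : p = q := by
  classical
  by_contra hpq
  have hF := hT.isMergeFamily_mergeGraph (by omega) hsync ha hp
  have hlt := lt_floorBound _ (Finset.mem_Ico.2 ⟨hn, hn'⟩)
  have hdup : ∀ x ∈ ({p, q} : Finset V), x ∈ duplicated S 1 := by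
    simpa using ⟨mem_duplicated_one ha hp, mem_duplicated_one hb hq⟩
  have hsum : ∀ t < floorBound (Fintype.card V),
      ∑ x ∈ ({p, q} : Finset V), deg (mergeGraph S t) x ≤ 2 := fun t ht => by
    have hp1 := (hT.deg_le_defect (IsWord.letter ha) hp (t := t) (by omega)).trans (hr a ha)
    have hq1 := (hT.deg_le_defect (IsWord.letter hb) hq (t := t) (by omega)).trans (hr b hb)
    rw [Finset.sum_pair hpq]
    omega
  have hcard := Finset.card_pair hpq
  rcases Nat.lt_or_ge (Fintype.card V) 7 with h7 | h7
  · have hsmall : ∀ n ∈ Finset.Ico 4 7, 2 + (n - 2).choose 2 < floorBound n - 1 := by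
      decide +kernel
    have hedges := hF.add_le_sum_deg_add_choose (t := floorBound (Fintype.card V) - 1)
      (by omega) {p, q}
    rw [hcard] at hedges
    have := hsmall _ (Finset.mem_Ico.2 ⟨hn, h7⟩)
    have := hsum (floorBound (Fintype.card V) - 1) (by omega)
    omega
  · have hlarge : ∀ n ∈ Finset.Ico 7 14, 2 + ∑ i ∈ Finset.range (n - 2),
        defectCap n (floorBound n + 1) 1 (1 + 1 + i) < 2 * (floorBound n + 1 - n) := by
      decide +kernel
    have hedges := hF.two_mul_add_le_sum_deg_add hsc
      (hT.boundsDefect_defectCap (by omega) hsync hr) ⟨p, by simp⟩ hdup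
      (t := floorBound (Fintype.card V) + 1 - Fintype.card V) (by omega)
    rw [hcard] at hedges
    have := hlarge _ (Finset.mem_Ico.2 ⟨h7, hn'⟩)
    have := hsum (floorBound (Fintype.card V) + 1 - Fintype.card V) (by omega)
    omega

end MergeFamily

/-- A bound for the defect of the words of length at most `j` when every letter has defect at most
one and some state is isolated in the merge graph at time `t`. -/
def isolatedDefectCap (n t j : ℕ) : ℕ :=
  Nat.findGreatest (fun δ => δ ≤ j ∧ t + 1 ≤ j + stageSum (2 * δ) (n - 1)) n

section SameDup

variable {V : Type*} [Fintype V] {S : Set (V → V)} {T : ℕ} {q z : V}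

theorem StronglyConnected.exists_apply_ne (hsc : StronglyConnected S)
    (hn : 1 < Fintype.card V) (x : V) : ∃ L ∈ S, L x ≠ x := by
  obtain ⟨y, hy, L, hL, hne⟩ := hsc.exists_apply_notMem (Finset.singleton_nonempty x) hn
  obtain rfl := Finset.mem_singleton.1 hy
  exact ⟨L, hL, fun h => hne (Finset.mem_singleton.2 h)⟩

theorem TripleFree.boundsDefect_isolatedDefectCap (hT : TripleFree S T)
    (hn : 3 ≤ Fintype.card V) (hsync : Synchronizing S) (hr : ∀ L ∈ S, defect L ≤ 1) {t : ℕ}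
    (ht : t < T) (hq : ∀ x, ¬ (mergeGraph S t).Adj q x) :
    BoundsDefect S (isolatedDefectCap (Fintype.card V) t) := fun j s hs f hf => by
  have hdef := hf.defect_le hr
  have hstage := hT.lt_add_stageSum_of_isolated hn hsync hf ht hq
  exact Nat.le_findGreatest (Nat.sub_le _ _) ⟨by omega, by omega⟩

theorem exists_range_eq_compl_singleton {f : V → V} (h : defect f = 1) :
    ∃ z, Set.range f = {z}ᶜ := by
  classical
  have hcard : (Finset.univ.image f)ᶜ.card = 1 := by rwa [Finset.card_compl]
  obtain ⟨z, hz⟩ := Finset.card_eq_one.1 hcard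
  exact ⟨z, by simpa [compl_eq_comm] using congrArg (fun A : Finset V => (A : Set V)ᶜ) hz⟩

/-- All letters are bijective or of defect one, some letter is not bijective, and all the letters
that are not bijective have the same state `q` with two preimages. -/
structure SameDup (S : Set (V → V)) (q : V) : Prop where
  defect_le : ∀ L ∈ S, defect L ≤ 1
  mem_dups : ∀ L ∈ S, ¬ Function.Bijective L → q ∈ dups L
  exists_not_bijective : ∃ a ∈ S, ¬ Function.Bijective a

namespace SameDup

theorem defect_eq (h : SameDup S q) {L : V → V} (hL : L ∈ S) (hb : ¬ Function.Bijective L) :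
    defect L = 1 := by
  have hle := h.defect_le L hL
  rw [← defect_eq_zero_iff] at hb
  omega

theorem mem_duplicated (h : SameDup S q) : q ∈ duplicated S 1 :=
  let ⟨_, ha, hb⟩ := h.exists_not_bijective
  mem_duplicated_one ha (h.mem_dups _ ha hb)

theorem isMergeFamily (h : SameDup S q) (hn : 3 ≤ Fintype.card V) (hT : TripleFree S T)
    (hsync : Synchronizing S) : IsMergeFamily S T 0 (mergeGraph S) :=
  let ⟨_, ha, hb⟩ := h.exists_not_bijective
  hT.isMergeFamily_mergeGraph hn hsync ha (h.mem_dups _ ha hb)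

theorem range_eq_of_adj (h : SameDup S q) (hT : TripleFree S T) {t : ℕ} (ht : t + 1 < T)
    (hz : (mergeGraph S t).Adj q z) {a : V → V} (ha : a ∈ S) (hb : ¬ Function.Bijective a) :
    Set.range a = {z}ᶜ := by
  obtain ⟨z', hz'⟩ := exists_range_eq_compl_singleton (h.defect_eq ha hb)
  suffices z = z' by rwa [this]
  by_contra hne
  obtain ⟨w, rfl⟩ : z ∈ Set.range a := hz' ▸ hne
  exact hT.not_adj_of_mem_dups (IsWord.letter ha) (h.mem_dups a ha hb) ht w hz

theorem deg_apply_add_deg_le_one (h : SameDup S q) {e : ℕ} {F : ℕ → SimpleGraph V}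
    (hF : IsMergeFamily S T e F) {L : V → V} (hL : L ∈ S) {t : ℕ}
    (hq : ∀ x, ¬ (F (t + 1)).Adj q x) : deg (F t) (L q) + deg (F t) q ≤ 1 := by
  have hzero : deg (F (t + 1)) q ≤ 0 := deg_le_card (A := ∅) fun y hy => absurd hy (hq y)
  have hLdeg := hF.deg_apply_le (t := t) hL q
  have hmono := hF.deg_mono (Nat.le_add_right t 1) q
  have hdef := h.defect_le L hL
  omega

theorem exists_adj_of_card_lt_seven (h : SameDup S q) (hn : 4 ≤ Fintype.card V)
    (hn' : Fintype.card V < 7) (hT : TripleFree S (floorBound (Fintype.card V) + 1))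
    (hsc : StronglyConnected S) (hsync : Synchronizing S) :
    ∃ x, (mergeGraph S (floorBound (Fintype.card V) - 1)).Adj q x := by
  classical
  by_contra! hq
  have hlt := lt_floorBound _ (Finset.mem_Ico.2 ⟨hn, by omega⟩)
  have hF := h.isMergeFamily (by omega) hT hsync
  obtain ⟨L, hL, hLq⟩ := hsc.exists_apply_ne (by omega) q
  have hedges := hF.add_le_sum_deg_add_choose (t := floorBound (Fintype.card V) - 2)
    (by omega) {L q, q}
  have hdeg := h.deg_apply_add_deg_le_one hF hL (t := floorBound (Fintype.card V) - 2)
    (by rwa [show floorBound (Fintype.card V) - 2 + 1 = floorBound (Fintype.card V) - 1 by omega])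
  have hnum : ∀ n ∈ Finset.Ico 4 7, 1 + (n - 2).choose 2 < floorBound n - 2 := by decide +kernel
  have := hnum _ (Finset.mem_Ico.2 ⟨hn, hn'⟩)
  rw [Finset.sum_pair hLq, Finset.card_pair hLq] at hedges
  omega

theorem exists_adj_of_seven_le_card (h : SameDup S q) (hn : 7 ≤ Fintype.card V)
    (hn' : Fintype.card V < 14) (hT : TripleFree S (floorBound (Fintype.card V) + 1))
    (hsc : StronglyConnected S) (hsync : Synchronizing S) :
    ∃ x, (mergeGraph S (floorBound (Fintype.card V) - 2)).Adj q x := by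
  classical
  by_contra! hq
  have hlt := lt_floorBound _ (Finset.mem_Ico.2 ⟨by omega, hn'⟩)
  have hF := h.isMergeFamily (by omega) hT hsync
  obtain ⟨L, hL, hLq⟩ := hsc.exists_apply_ne (by omega) q
  have hdup : ∀ x ∈ ({L q, q} : Finset V), x ∈ duplicated S 2 := by
    simpa using ⟨apply_mem_duplicated hL h.mem_duplicated,
      duplicated_mono one_le_two h.mem_duplicated⟩
  have hedges := hF.two_mul_add_le_sum_deg_add hsc
    (hT.boundsDefect_isolatedDefectCap (by omega) hsync h.defect_le (by omega) hq)
    ⟨q, by simp⟩ hdup (t := floorBound (Fintype.card V) - Fintype.card V)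
    (by rw [Finset.card_pair hLq]; omega)
  have hdeg := h.deg_apply_add_deg_le_one hF hL
    (t := floorBound (Fintype.card V) - Fintype.card V) fun x hx =>
      hq x (mergeGraph_mono (by omega) hx)
  have hnum : ∀ n ∈ Finset.Ico 7 14, 1 + ∑ i ∈ Finset.range (n - 2),
      isolatedDefectCap n (floorBound n - 2) (2 + 1 + i) < 2 * (floorBound n - n) := by
    decide +kernel
  have := hnum _ (Finset.mem_Ico.2 ⟨hn, hn'⟩)
  rw [Finset.sum_pair hLq, Finset.card_pair hLq] at hedges
  omega

end SameDup

/-- All the letters that are not bijective have the same state `q` with two preimages and miss the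
same state `z`, in a strongly connected synchronizing automaton without short triple words. -/
structure SameMiss (S : Set (V → V)) (T : ℕ) (q z : V) : Prop extends SameDup S q where
  three_le : 3 ≤ Fintype.card V
  tripleFree : TripleFree S T
  stronglyConnected : StronglyConnected S
  synchronizing : Synchronizing S
  range_eq : ∀ a ∈ S, ¬ Function.Bijective a → Set.range a = {z}ᶜ
  ne : q ≠ z

namespace SameMiss

theorem exists_apply_eq (h : SameMiss S T q z) {L : V → V} (hL : L ∈ S)
    (hb : ¬ Function.Bijective L) {y : V} (hy : y ≠ z) : ∃ u, L u = y := by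
  change y ∈ Set.range L
  rwa [h.range_eq L hL hb]

theorem bijective_of_apply_eq (h : SameMiss S T q z) {L : V → V} (hL : L ∈ S) {x : V}
    (hx : L x = z) : Function.Bijective L := by
  by_contra hb
  have hz : L x ∈ ({z}ᶜ : Set V) := h.range_eq L hL hb ▸ Set.mem_range_self x
  exact hz hx

theorem exists_bijective_apply_ne (h : SameMiss S T q z) :
    ∃ π ∈ S, Function.Bijective π ∧ π z ≠ z := by
  classical
  have hcard : (Finset.univ.erase z).card < Fintype.card V :=
    Finset.card_erase_lt_of_mem (Finset.mem_univ z)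
  obtain ⟨x, hx, L, hL, hLx⟩ := h.stronglyConnected.exists_apply_notMem
    ⟨q, Finset.mem_erase.2 ⟨h.ne, Finset.mem_univ q⟩⟩ hcard
  have hLz : L x = z := by simpa using hLx
  have hb := h.bijective_of_apply_eq hL hLz
  exact ⟨L, hL, hb, fun e => Finset.ne_of_mem_erase hx (hb.1 (hLz.trans e.symm))⟩

theorem isMergeFamily (h : SameMiss S T q z) : IsMergeFamily S T 0 (mergeGraph S) :=
  h.toSameDup.isMergeFamily h.three_le h.tripleFree h.synchronizing

theorem isDead_edge (h : SameMiss S T q z) {w : V}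
    (hperm : ∀ L ∈ S, Function.Bijective L → s(L z, L w) = s(z, w)) :
    IsDead S (SimpleGraph.edge z w) := by
  intro L hL x y hxy hadj
  rw [SimpleGraph.edge, SimpleGraph.fromEdgeSet_adj, Set.mem_singleton_iff] at hadj ⊢
  refine ⟨?_, hxy⟩
  have hb : Function.Bijective L := by
    rcases Sym2.eq_iff.1 hadj.1 with ⟨hz, -⟩ | ⟨-, hz⟩ <;> exact h.bijective_of_apply_eq hL hz
  rw [← hperm L hL hb, ← Sym2.map_mk, ← Sym2.map_mk] at hadj
  exact Sym2.map.injective hb.1 hadj.1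

theorem isMergeFamily_sup_edge (h : SameMiss S T q z) {w : V} (hzw : z ≠ w) (hqw : q ≠ w)
    (hperm : ∀ L ∈ S, Function.Bijective L → s(L z, L w) = s(z, w)) :
    IsMergeFamily S T 1 fun t => mergeGraph S t ⊔ SimpleGraph.edge z w := by
  obtain ⟨a, ha, hb⟩ := h.exists_not_bijective
  have hedge : numEdges (SimpleGraph.edge z w) = 1 := by
    rw [numEdges, SimpleGraph.edgeSet_edge_of_ne hzw, Set.ncard_singleton]
  have hne := h.ne
  rw [← hedge]
  refine (h.isDead_edge hperm).isMergeFamily ?_ h.three_le h.tripleFree h.synchronizing ha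
    (h.mem_dups a ha hb) ?_
  · intro x y y'
    simp only [SimpleGraph.edge_adj]
    grind
  · intro x
    simp only [SimpleGraph.edge_adj]
    grind

end SameMiss

end SameDup

theorem apply_notMem_of_closed {V : Type*} {σ : V → V} {x : V} (hσ : Function.Injective σ)
    {A : Finset V} (hA : ∀ u ∈ A, σ u ∈ A) (hx : x ∉ A) : σ x ∉ A := by
  classical
  have himage : A.image σ = A := Finset.eq_of_subset_of_card_le
    (Finset.image_subset_iff.2 hA) (Finset.card_image_of_injective A hσ).ge
  rwa [← himage, hσ.mem_finset_image]

section SameMiss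

open scoped Classical

variable {V : Type*} [Fintype V] {S : Set (V → V)} {T e k t : ℕ} {q z c x y : V} {π ρ σ L : V → V}
  {F : ℕ → SimpleGraph V}

theorem IsMergeFamily.exists_adj_of_adj_apply (hF : IsMergeFamily S T e F) (hσ : σ ∈ S)
    (hb : Function.Bijective σ) (h : (F t).Adj (σ x) y) : ∃ u, σ u = y ∧ (F (t + 1)).Adj x u := by
  obtain ⟨u, rfl⟩ := hb.2 y
  exact ⟨u, rfl, hF.adj_of_letter hσ h⟩

/-- In every merge family, `c` is the only possible neighbour of `x` before time `T - k`. -/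
def UniqueNbr (S : Set (V → V)) (T k : ℕ) (x c : V) : Prop :=
  ∀ ⦃e F⦄, IsMergeFamily S T e F → ∀ ⦃t⦄, t + k < T → ∀ ⦃y⦄, (F t).Adj x y → y = c

namespace UniqueNbr

theorem mono {l : ℕ} (h : UniqueNbr S T k x c) (hkl : k ≤ l) : UniqueNbr S T l x c :=
  fun _ _ hF _ ht _ hy => h hF (by omega) hy

theorem apply_of_bijective (h : UniqueNbr S T k x c) (hσ : σ ∈ S) (hb : Function.Bijective σ) :
    UniqueNbr S T (k + 1) (σ x) (σ c) := fun _ _ hF _ ht _ hy => by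
  obtain ⟨u, rfl, hu⟩ := hF.exists_adj_of_adj_apply hσ hb hy
  rw [h hF (by omega) hu]

theorem deg_le_one (h : UniqueNbr S T k x c) (hF : IsMergeFamily S T e F) (ht : t + k < T) :
    deg (F t) x ≤ 1 :=
  deg_le_card (A := {c}) fun _ hy => Finset.mem_singleton.2 (h hF ht hy)

theorem apply_eq_of_adj (h : UniqueNbr S T k x c) (hF : IsMergeFamily S T e F)
    (hσ : σ ∈ S) (hb : Function.Bijective σ) (ht : t + (k + 1) < T) (hy : (F t).Adj (σ x) y) :
    σ c = y :=
  (h.apply_of_bijective hσ hb hF ht hy).symm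

theorem deg_apply_le_two (h : UniqueNbr S T k x c) (hF : IsMergeFamily S T e F) (hL : L ∈ S)
    (hdef : defect L ≤ 1) (ht : t + (k + 1) < T) : deg (F t) (L x) ≤ 2 := by
  have hdeg := h.deg_le_one hF (t := t + 1) (by omega)
  have hLdeg := hF.deg_apply_le (t := t) hL x
  omega

end UniqueNbr

theorem sum_deg_le_card (hF : IsMergeFamily S T e F) {A : Finset V}
    (hA : ∀ x ∈ A, ∃ c, UniqueNbr S T k x c) (ht : t + k < T) :
    ∑ x ∈ A, deg (F t) x ≤ A.card := by
  simpa using Finset.sum_le_card_nsmul A (deg (F t)) 1 fun x hx =>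
    (hA x hx).elim fun _ hc => hc.deg_le_one hF ht

namespace SameMiss

theorem uniqueNbr (h : SameMiss S T q z) : UniqueNbr S T 1 q z := fun _ F hF t ht y hy => by
  obtain ⟨a, ha, hb⟩ := h.exists_not_bijective
  by_contra hne
  obtain ⟨w, rfl⟩ := h.exists_apply_eq ha hb hne
  exact hF.not_adj_of_mem_dups (IsWord.letter ha) (h.mem_dups a ha hb) ht w hy

theorem apply_ne (h : SameMiss S T q z) (hL : L ∈ S) (hb : ¬ Function.Bijective L) (x : V) :
    L x ≠ z := fun hx => hb (h.bijective_of_apply_eq hL hx)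

theorem eq_or_exists_of_adj_apply (h : SameMiss S T q z) (hF : IsMergeFamily S T e F)
    (hL : L ∈ S) (hb : ¬ Function.Bijective L) (hy : (F t).Adj (L x) y) :
    y = z ∨ ∃ u, L u = y ∧ (F (t + 1)).Adj x u := by
  refine or_iff_not_imp_left.2 fun hyz => ?_
  obtain ⟨u, rfl⟩ := h.exists_apply_eq hL hb hyz
  exact ⟨u, rfl, hF.adj_of_letter hL hy⟩

theorem eq_or_eq_of_adj_apply (h : SameMiss S T q z) (hx : UniqueNbr S T k x c)
    (hF : IsMergeFamily S T e F) (hL : L ∈ S) (hb : ¬ Function.Bijective L)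
    (ht : t + (k + 1) < T) (hy : (F t).Adj (L x) y) : y = z ∨ y = L c := by
  refine (h.eq_or_exists_of_adj_apply hF hL hb hy).imp_right ?_
  rintro ⟨u, rfl, hu⟩
  rw [hx hF (by omega) hu]

theorem boundsDefect (h : SameMiss S T q z) : BoundsDefect S (defectCap (Fintype.card V) T 1) :=
  h.tripleFree.boundsDefect_defectCap h.three_le h.synchronizing h.defect_le

theorem two_mul_add_le_sum_deg_add (h : SameMiss S T q z) (hF : IsMergeFamily S T e F)
    {A : Finset V} (hA : A.Nonempty) (hAk : ∀ x ∈ A, x ∈ duplicated S k)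
    (ht : t + k + (Fintype.card V - A.card) < T) :
    2 * (t + e) ≤ ∑ x ∈ A, deg (F t) x +
      ∑ i ∈ Finset.range (Fintype.card V - A.card), defectCap (Fintype.card V) T 1 (k + 1 + i) :=
  hF.two_mul_add_le_sum_deg_add h.stronglyConnected h.boundsDefect hA hAk ht

theorem deg_le_three_of_card_eq_nine (h : SameMiss S 20 q z) (hn : Fintype.card V = 9)
    (hF : IsMergeFamily S 20 e F) (hk : k ≤ 9) (ht : t + k < 20) (hx : x ∈ duplicated S k) :
    deg (F t) x ≤ 3 := by
  have hcap : ∀ k ∈ Finset.range 10, defectCap 9 20 1 k ≤ 3 := by decide +kernel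
  refine (hF.deg_le_of_mem_duplicated h.boundsDefect ht hx).trans ?_
  rw [hn]
  exact hcap k (Finset.mem_range.2 (by omega))

theorem mem_duplicated_card (h : SameMiss S T q z) (x : V) :
    x ∈ duplicated S (Fintype.card V) := by
  have hx := h.stronglyConnected.mem_of_step duplicated_mono apply_mem_duplicated
    h.mem_duplicated x
  rwa [Nat.add_sub_cancel' (h.three_le.trans' (by norm_num))] at hx

theorem two_mul_add_le_of_card_eq_nine (h : SameMiss S 20 q z) (hn : Fintype.card V = 9)
    (hF : IsMergeFamily S 20 e F) (A : Finset V) :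
    2 * (10 + e) ≤ ∑ x ∈ A, deg (F 10) x + 3 * (9 - A.card) := by
  have hcompl := Finset.sum_le_card_nsmul Aᶜ (deg (F 10)) 3 fun x _ =>
    h.deg_le_three_of_card_eq_nine hn hF le_rfl (by norm_num) (hn ▸ h.mem_duplicated_card x)
  rw [Finset.card_compl, hn, smul_eq_mul, mul_comm] at hcompl
  calc 2 * (10 + e) ≤ 2 * numEdges (F 10) :=
        Nat.mul_le_mul_left 2 (hF.add_le_numEdges (by norm_num))
    _ = ∑ x ∈ A, deg (F 10) x + ∑ x ∈ Aᶜ, deg (F 10) x := by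
        rw [← sum_deg, Finset.sum_add_sum_compl]
    _ ≤ _ := Nat.add_le_add_left hcompl _

theorem apply_mem_of_card_eq_three (h : SameMiss S 20 q z) (hn : Fintype.card V = 9)
    {A : Finset V} (hA : A.card = 3) (huniq : ∀ x ∈ A, ∃ c, UniqueNbr S 20 3 x c)
    (hσ : σ ∈ S) (hb : Function.Bijective σ) (hx : x ∈ A) : σ x ∈ A := by
  by_contra hσx
  obtain ⟨c, hc⟩ := huniq x hx
  have hdeg := (hc.apply_of_bijective hσ hb).deg_le_one h.isMergeFamily (t := 10) (by norm_num)
  have hsum := sum_deg_le_card h.isMergeFamily huniq (t := 10) (by norm_num)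
  have hedges := h.two_mul_add_le_of_card_eq_nine hn h.isMergeFamily (insert (σ x) A)
  rw [Finset.sum_insert hσx, Finset.card_insert_of_notMem hσx] at hedges
  omega

theorem adj_of_card_eq_three (h : SameMiss S 20 q z) (hn : Fintype.card V = 9)
    {A : Finset V} (hA : A.card = 3) (huniq : ∀ x ∈ A, ∃ c, UniqueNbr S 20 3 x c)
    (hx : UniqueNbr S 20 3 x c) (hL : L ∈ S) (hb : ¬ Function.Bijective L) (hLx : L x ∉ A) :
    (mergeGraph S 10).Adj (L x) z ∧ (mergeGraph S 10).Adj (L x) (L c) := by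
  have hdeg : ¬ deg (mergeGraph S 10) (L x) ≤ 1 := fun hdeg => by
    have hsum := sum_deg_le_card h.isMergeFamily huniq (t := 10) (by norm_num)
    have hedges := h.two_mul_add_le_of_card_eq_nine hn h.isMergeFamily (insert (L x) A)
    rw [Finset.sum_insert hLx, Finset.card_insert_of_notMem hLx] at hedges
    omega
  have hnbr : ∀ y, (mergeGraph S 10).Adj (L x) y → y = z ∨ y = L c := fun y hy =>
    h.eq_or_eq_of_adj_apply hx h.isMergeFamily hL hb (by norm_num) hy
  constructor <;> by_contra hno
  · exact hdeg <| deg_le_card (A := {L c}) fun y hy => Finset.mem_singleton.2 <|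
      (hnbr y hy).resolve_left fun hyz => hno (hyz ▸ hy)
  · exact hdeg <| deg_le_card (A := {z}) fun y hy => Finset.mem_singleton.2 <|
      (hnbr y hy).resolve_right fun hyc => hno (hyc ▸ hy)

theorem apply_apply_eq_of_card_eq_three (h : SameMiss S 20 q z) (hn : Fintype.card V = 9)
    {A : Finset V} (hA : A.card = 3) (huniq : ∀ x ∈ A, ∃ c, UniqueNbr S 20 3 x c) (hx : x ∈ A)
    (hL : L ∈ S) (hLx : L x ∉ A) (hσ : σ ∈ S) (hσb : Function.Bijective σ) : σ (L x) = L x := by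
  by_contra hne
  obtain ⟨c, hc⟩ := huniq x hx
  have hσLx : σ (L x) ∉ insert (L x) A := by
    simpa [hne] using apply_notMem_of_closed hσb.1
      (fun u => h.apply_mem_of_card_eq_three hn hA huniq hσ hσb) hLx
  have hdeg : ∀ t, t + 4 < 20 → deg (mergeGraph S t) (L x) ≤ 2 := fun t ht =>
    hc.deg_apply_le_two h.isMergeFamily hL (h.defect_le L hL) ht
  have hdegσ := h.isMergeFamily.deg_apply_le_of_bijective (t := 10) hσ hσb (L x)
  have hsum := sum_deg_le_card h.isMergeFamily huniq (t := 10) (by norm_num)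
  have hedges := h.two_mul_add_le_of_card_eq_nine hn h.isMergeFamily
    (insert (σ (L x)) (insert (L x) A))
  rw [Finset.sum_insert hσLx, Finset.sum_insert hLx, Finset.card_insert_of_notMem hσLx,
    Finset.card_insert_of_notMem hLx] at hedges
  have := hdeg 10 (by norm_num)
  have := hdegσ.trans (hdeg 11 (by norm_num))
  omega

/-- The two neighbours of the exit vertex are permuted by the bijective letters, so the pair they
form is dead, which leaves one edge more than the degrees allow. -/
theorem card_ne_three_of_card_eq_nine (h : SameMiss S 20 q z) (hn : Fintype.card V = 9)
    {A : Finset V} (huniq : ∀ x ∈ A, ∃ c, UniqueNbr S 20 3 x c) : A.card ≠ 3 := by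
  intro hA
  obtain ⟨x, hx, L, hL, hLx⟩ := h.stronglyConnected.exists_apply_notMem
    (Finset.card_pos.1 (by omega : 0 < A.card)) (by omega)
  have hb : ¬ Function.Bijective L := fun hb =>
    hLx (h.apply_mem_of_card_eq_three hn hA huniq hL hb hx)
  obtain ⟨c, hc⟩ := huniq x hx
  obtain ⟨hz, hLc⟩ := h.adj_of_card_eq_three hn hA huniq hc hL hb hLx
  have hzc : z ≠ L c := (h.apply_ne hL hb c).symm
  have hqc : q ≠ L c := fun hqc =>
    h.apply_ne hL hb x (h.uniqueNbr h.isMergeFamily (by norm_num) (hqc ▸ hLc.symm))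
  have hperm : ∀ σ ∈ S, Function.Bijective σ → s(σ z, σ (L c)) = s(z, L c) := fun σ hσ hσb => by
    have hfix := h.apply_apply_eq_of_card_eq_three hn hA huniq hx hL hLx hσ hσb
    have hpre : ∀ y, (mergeGraph S 10).Adj (L x) y → ∃ u, σ u = y ∧ (u = z ∨ u = L c) := by
      intro y hy
      obtain ⟨u, hu, hadj⟩ := h.isMergeFamily.exists_adj_of_adj_apply hσ hσb (by rwa [hfix])
      exact ⟨u, hu, h.eq_or_eq_of_adj_apply hc h.isMergeFamily hL hb (by norm_num) hadj⟩
    obtain ⟨u, hu, hu'⟩ := hpre z hz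
    obtain ⟨v, hv, hv'⟩ := hpre (L c) hLc
    grind
  have hF := h.isMergeFamily_sup_edge hzc hqc hperm
  have hsum := sum_deg_le_card hF huniq (t := 10) (by norm_num)
  have hedges := h.two_mul_add_le_of_card_eq_nine hn hF A
  omega

end SameMiss

/-- The situation in which a bijective letter `π` moves `q`. -/
structure MovesDup (S : Set (V → V)) (T : ℕ) (q z : V) (π : V → V) : Prop
    extends SameMiss S T q z where
  mem : π ∈ S
  bijective : Function.Bijective π
  apply_ne_self : π q ≠ q

namespace MovesDup

theorem uniqueNbr_apply (h : MovesDup S T q z π) : UniqueNbr S T 2 (π q) (π z) :=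
  h.uniqueNbr.apply_of_bijective h.mem h.bijective

theorem exists_uniqueNbr (h : MovesDup S T q z π) (hx : x ∈ ({π q, q} : Finset V)) :
    ∃ c, UniqueNbr S T 2 x c := by
  rcases Finset.mem_insert.1 hx with rfl | hx
  · exact ⟨π z, h.uniqueNbr_apply⟩
  · exact ⟨z, Finset.mem_singleton.1 hx ▸ h.uniqueNbr.mono one_le_two⟩

theorem mem_duplicated_two (h : MovesDup S T q z π) :
    ∀ x ∈ ({π q, q} : Finset V), x ∈ duplicated S 2 := by
  simpa using ⟨apply_mem_duplicated h.mem h.mem_duplicated,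
    duplicated_mono one_le_two h.mem_duplicated⟩

theorem exists_insert_pair (h : MovesDup S T q z π) : ∃ x ∈ ({π q, q} : Finset V), ∃ L ∈ S,
    L x ∉ ({π q, q} : Finset V) ∧ ∀ y ∈ (insert (L x) {π q, q} : Finset V), y ∈ duplicated S 3 :=
  h.stronglyConnected.exists_insert_duplicated ⟨q, by simp⟩
    (by rw [Finset.card_pair h.apply_ne_self]; exact h.three_le) h.mem_duplicated_two

theorem sum_pair_le (h : MovesDup S T q z π) (hF : IsMergeFamily S T e F) (ht : t + 2 < T) :
    ∑ x ∈ ({π q, q} : Finset V), deg (F t) x ≤ 2 := by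
  rw [Finset.sum_pair h.apply_ne_self]
  exact Nat.add_le_add (h.uniqueNbr_apply.deg_le_one hF ht)
    (h.uniqueNbr.deg_le_one hF (by omega))

theorem sum_insert_pair_le (h : MovesDup S T q z π) (hF : IsMergeFamily S T e F)
    (hx : x ∈ ({π q, q} : Finset V)) (hL : L ∈ S) (hLx : L x ∉ ({π q, q} : Finset V))
    (ht : t + 3 < T) : ∑ y ∈ insert (L x) ({π q, q} : Finset V), deg (F t) y ≤ 4 := by
  obtain ⟨c, hc⟩ := h.exists_uniqueNbr hx
  rw [Finset.sum_insert hLx]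
  exact Nat.add_le_add (hc.deg_apply_le_two hF hL (h.defect_le L hL) ht)
    (h.sum_pair_le hF (by omega))

theorem card_insert_pair (h : MovesDup S T q z π) (hx : x ∉ ({π q, q} : Finset V)) :
    (insert x ({π q, q} : Finset V)).card = 3 := by
  rw [Finset.card_insert_of_notMem hx, Finset.card_pair h.apply_ne_self]

theorem card_lt_twelve (h : MovesDup S T q z π) (hT : T = floorBound (Fintype.card V) + 1)
    (hn : Fintype.card V < 14) : Fintype.card V < 12 := by
  by_contra! hn'
  have hlt := lt_floorBound _ (Finset.mem_Ico.2 ⟨by omega, hn⟩)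
  obtain ⟨x, hx, L, hL, hLx, hdup⟩ := h.exists_insert_pair
  have hsum := h.sum_insert_pair_le h.isMergeFamily hx hL hLx
    (t := floorBound (Fintype.card V) - Fintype.card V) (by omega)
  have hedges := h.two_mul_add_le_sum_deg_add h.isMergeFamily ⟨_, Finset.mem_insert_self _ _⟩ hdup
    (t := floorBound (Fintype.card V) - Fintype.card V)
    (by rw [h.card_insert_pair hLx]; omega)
  have hnum : ∀ n ∈ Finset.Ico 12 14, 4 + ∑ i ∈ Finset.range (n - 3),
      defectCap n (floorBound n + 1) 1 (3 + 1 + i) < 2 * (floorBound n - n) := by decide +kernel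
  have := hnum _ (Finset.mem_Ico.2 ⟨hn', hn⟩)
  rw [h.card_insert_pair hLx, hT] at hedges
  omega

theorem exists_uniqueNbr_insert (h : MovesDup S T q z π) (hρ : ρ ∈ S)
    (hb : Function.Bijective ρ) (hx : x ∈ ({π q, q} : Finset V)) :
    ∀ y ∈ insert (ρ x) ({π q, q} : Finset V), ∃ c, UniqueNbr S T 3 y c := by
  intro y hy
  rcases Finset.mem_insert.1 hy with rfl | hy
  · exact (h.exists_uniqueNbr hx).imp' ρ fun _ hc => hc.apply_of_bijective hρ hb
  · exact (h.exists_uniqueNbr hy).imp fun _ hc => hc.mono (by norm_num)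

theorem mem_duplicated_three (h : MovesDup S T q z π) (hρ : ρ ∈ S)
    (hx : x ∈ ({π q, q} : Finset V)) :
    ∀ y ∈ insert (ρ x) ({π q, q} : Finset V), y ∈ duplicated S 3 := by
  intro y hy
  rcases Finset.mem_insert.1 hy with rfl | hy
  · exact apply_mem_duplicated hρ (h.mem_duplicated_two x hx)
  · exact duplicated_mono (by norm_num) (h.mem_duplicated_two y hy)

theorem sum_triple_le (h : MovesDup S T q z π) (hρ : ρ ∈ S) (hb : Function.Bijective ρ)
    (hx : x ∈ ({π q, q} : Finset V)) (hρx : ρ x ∉ ({π q, q} : Finset V)) (ht : t + 3 < T) :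
    ∑ y ∈ insert (ρ x) ({π q, q} : Finset V), deg (mergeGraph S t) y ≤ 3 :=
  (sum_deg_le_card h.isMergeFamily (h.exists_uniqueNbr_insert hρ hb hx) ht).trans_eq
    (h.card_insert_pair hρx)

theorem exists_quadruple (h : MovesDup S T q z π) (hn : 4 ≤ Fintype.card V) (hρ : ρ ∈ S)
    (hb : Function.Bijective ρ) (hx : x ∈ ({π q, q} : Finset V))
    (hρx : ρ x ∉ ({π q, q} : Finset V)) :
    ∃ A : Finset V, A.card = 4 ∧ (∀ y ∈ A, y ∈ duplicated S 4) ∧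
      ∀ t, t + 4 < T → ∑ y ∈ A, deg (mergeGraph S t) y ≤ 5 := by
  obtain ⟨y, hy, L, hL, hLy, hdup⟩ := h.stronglyConnected.exists_insert_duplicated
    ⟨_, Finset.mem_insert_self _ _⟩ (by rw [h.card_insert_pair hρx]; omega)
    (h.mem_duplicated_three hρ hx)
  refine ⟨_, by rw [Finset.card_insert_of_notMem hLy, h.card_insert_pair hρx], hdup,
    fun t ht => ?_⟩
  obtain ⟨c, hc⟩ := h.exists_uniqueNbr_insert hρ hb hx y hy
  rw [Finset.sum_insert hLy]
  exact Nat.add_le_add (hc.deg_apply_le_two h.isMergeFamily hL (h.defect_le L hL) ht)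
    (h.sum_triple_le hρ hb hx hρx (by omega))

theorem apply_mem_pair (h : MovesDup S T q z π) (hT : T = floorBound (Fintype.card V) + 1)
    (hn : Fintype.card V ∈ Finset.Ico 6 12) (hρ : ρ ∈ S) (hb : Function.Bijective ρ)
    (hx : x ∈ ({π q, q} : Finset V)) : ρ x ∈ ({π q, q} : Finset V) := by
  by_contra hρx
  obtain ⟨hn6, hn12⟩ := Finset.mem_Ico.1 hn
  obtain ⟨A, hA, hdup, hsum⟩ := h.exists_quadruple (by omega) hρ hb hx hρx
  have hlt := lt_floorBound (Fintype.card V) (Finset.mem_Ico.2 ⟨by omega, by omega⟩)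
  obtain hn8 | hn8 | hn9 | hn10 : Fintype.card V < 8 ∨ Fintype.card V = 8 ∨ Fintype.card V = 9 ∨
    10 ≤ Fintype.card V := by omega
  · have hnum : ∀ n ∈ Finset.Ico 6 8, 3 + (n - 3).choose 2 < floorBound n - 3 := by
      decide +kernel
    have hedges := h.isMergeFamily.add_le_sum_deg_add_choose
      (t := floorBound (Fintype.card V) - 3) (by omega) (insert (ρ x) {π q, q})
    have := h.sum_triple_le hρ hb hx hρx (t := floorBound (Fintype.card V) - 3) (by omega)
    have := hnum _ (Finset.mem_Ico.2 ⟨hn6, hn8⟩)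
    rw [h.card_insert_pair hρx] at hedges
    omega
  · have hT' : T = 17 := by rw [hT, hn8]; decide +kernel
    have hedges := h.isMergeFamily.add_le_sum_deg_add_choose (t := 12) (by omega) A
    have := hsum 12 (by omega)
    rw [hA, hn8] at hedges
    norm_num [Nat.choose] at hedges
    omega
  · obtain rfl : T = 20 := by rw [hT, hn9]; decide +kernel
    exact h.card_ne_three_of_card_eq_nine hn9 (h.exists_uniqueNbr_insert hρ hb hx)
      (h.card_insert_pair hρx)
  · have hnum : ∀ n ∈ Finset.Ico 10 12, 5 + ∑ i ∈ Finset.range (n - 4),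
        defectCap n (floorBound n + 1) 1 (4 + 1 + i) < 2 * (floorBound n - n) := by decide +kernel
    have hedges := h.two_mul_add_le_sum_deg_add h.isMergeFamily (Finset.card_pos.1 (by omega)) hdup
      (t := floorBound (Fintype.card V) - Fintype.card V) (by omega)
    have := hsum (floorBound (Fintype.card V) - Fintype.card V) (by omega)
    have := hnum _ (Finset.mem_Ico.2 ⟨hn10, hn12⟩)
    rw [hA, hT] at hedges
    omega

end MovesDup

/-- The orbit of `q` under the bijective letters is `{π q, q}`. -/
structure OrbitTwo (S : Set (V → V)) (T : ℕ) (q z : V) (π : V → V) : Prop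
    extends MovesDup S T q z π where
  apply_mem : ∀ ρ ∈ S, Function.Bijective ρ →
    ∀ x ∈ ({π q, q} : Finset V), ρ x ∈ ({π q, q} : Finset V)

namespace OrbitTwo

theorem apply_apply (h : OrbitTwo S T q z π) : π (π q) = q := by
  have hmem := h.apply_mem π h.mem h.bijective (π q) (by simp)
  rw [Finset.mem_insert, Finset.mem_singleton] at hmem
  exact hmem.resolve_left fun heq => h.apply_ne_self (h.bijective.1 heq)

theorem fixes_or_swaps (h : OrbitTwo S T q z π) (hρ : ρ ∈ S) (hb : Function.Bijective ρ) :
    ρ q = q ∧ ρ (π q) = π q ∨ ρ q = π q ∧ ρ (π q) = q := by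
  have hq := h.apply_mem ρ hρ hb q (by simp)
  have hπq := h.apply_mem ρ hρ hb (π q) (by simp)
  have hne : ρ q ≠ ρ (π q) := fun heq => h.apply_ne_self (hb.1 heq).symm
  simp only [Finset.mem_insert, Finset.mem_singleton] at hq hπq
  grind

theorem deg_apply_le_one_of_eq_apply (h : OrbitTwo S T q z π) (hz : z = π q) (hL : L ∈ S)
    (ht : t + 2 < T) (hx : deg (mergeGraph S (t + 1)) x ≤ 1) : deg (mergeGraph S t) (L x) ≤ 1 := by
  have hF := h.isMergeFamily
  by_cases hb : Function.Bijective L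
  · exact (hF.deg_apply_le_of_bijective hL hb x).trans hx
  by_cases hLx : L x ∈ ({π q, q} : Finset V)
  · obtain ⟨c, hc⟩ := h.exists_uniqueNbr hLx
    exact hc.deg_le_one hF ht
  have hsub : (mergeGraph S t).neighborSet (L x) ⊆
      L '' (mergeGraph S (t + 1)).neighborSet x := fun y hy => by
    rcases h.eq_or_exists_of_adj_apply hF hL hb hy with hyz | ⟨u, rfl, hu⟩
    · rw [hyz, hz] at hy
      have hLxz := h.uniqueNbr_apply hF ht hy.symm
      rw [hz, h.apply_apply] at hLxz
      simp [hLxz] at hLx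
    · exact ⟨u, hu, rfl⟩
  exact (Set.ncard_le_ncard hsub (Set.toFinite _)).trans
    ((Set.ncard_image_le (Set.toFinite _)).trans hx)

/-- If `z = π q`, then `q` and `π q` can only be adjacent to each other, and the degree bound one
propagates from `q` to all vertices. -/
theorem ne_apply (h : OrbitTwo S T q z π) (hT : T = floorBound (Fintype.card V) + 1)
    (hn : Fintype.card V ∈ Finset.Ico 6 14) : z ≠ π q := by
  intro hz
  have hnum : ∀ n ∈ Finset.Ico 6 14, n < floorBound n ∧ 3 * n < 2 * floorBound n := by
    decide +kernel
  obtain ⟨hlt, hlt'⟩ := hnum _ hn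
  have hF := h.isMergeFamily
  let R : ℕ → Set V := fun k => {x | ∀ t, t + 1 + k < T → deg (mergeGraph S t) x ≤ 1}
  have hR : Monotone R := fun k l hkl x hx t ht => hx t (by omega)
  have hstep : ∀ {k x L}, L ∈ S → x ∈ R k → L x ∈ R (k + 1) := fun hL hx t ht =>
    h.deg_apply_le_one_of_eq_apply hz hL (by omega) (hx (t + 1) (by omega))
  have hq : q ∈ R 0 := fun t ht => h.uniqueNbr.deg_le_one hF (by omega)
  have hdeg := Finset.sum_le_card_nsmul Finset.univ (deg (mergeGraph S (T - 1 - Fintype.card V))) 1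
    fun x _ => h.stronglyConnected.mem_of_step hR hstep hq x _
      (by have := h.three_le; omega)
  have hedges := hF.add_le_numEdges (t := T - 1 - Fintype.card V) (by omega)
  rw [sum_deg, Finset.card_univ, smul_eq_mul, mul_one] at hdeg
  omega

theorem adj_and_adj_of_adj (h : OrbitTwo S T q z π) (ht : t + 3 < T)
    (hx : x ∈ ({π q, q} : Finset V)) (hadj : (mergeGraph S t).Adj x y) :
    (mergeGraph S (t + 1)).Adj q z ∧ (mergeGraph S (t + 1)).Adj (π q) (π z) := by
  have hF := h.isMergeFamily
  have hadj' := mergeGraph_mono (Nat.le_add_right t 1) hadj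
  rcases Finset.mem_insert.1 hx with rfl | hx
  · obtain ⟨u, -, hu⟩ := hF.exists_adj_of_adj_apply h.mem h.bijective hadj
    obtain rfl := h.uniqueNbr hF (by omega) hu
    obtain rfl := h.uniqueNbr_apply hF (by omega) hadj'
    exact ⟨hu, hadj'⟩
  · obtain rfl := Finset.mem_singleton.1 hx
    rw [← h.apply_apply] at hadj
    obtain ⟨u, -, hu⟩ := hF.exists_adj_of_adj_apply h.mem h.bijective hadj
    obtain rfl := h.uniqueNbr hF (by omega) hadj'
    obtain rfl := h.uniqueNbr_apply hF (by omega) hu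
    exact ⟨hadj', hu⟩

theorem not_adj_of_sym2_ne (h : OrbitTwo S T q z π) (hρ : ρ ∈ S) (hb : Function.Bijective ρ)
    (hne : s(ρ z, ρ (π z)) ≠ s(z, π z)) (ht : t + 4 < T) (hx : x ∈ ({π q, q} : Finset V)) (y : V) :
    ¬ (mergeGraph S t).Adj x y := by
  intro hadj
  have hF := h.isMergeFamily
  obtain ⟨hqz, hπ⟩ := h.adj_and_adj_of_adj (by omega) hx hadj
  refine hne (Sym2.eq_iff.2 ?_)
  rcases h.fixes_or_swaps hρ hb with ⟨hρq, hρπ⟩ | ⟨hρq, hρπ⟩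
  · rw [← hρq] at hqz
    rw [← hρπ] at hπ
    exact Or.inl ⟨h.uniqueNbr.apply_eq_of_adj hF hρ hb (by omega) hqz,
      h.uniqueNbr_apply.apply_eq_of_adj hF hρ hb (by omega) hπ⟩
  · rw [← hρπ] at hqz
    rw [← hρq] at hπ
    exact Or.inr ⟨h.uniqueNbr.apply_eq_of_adj hF hρ hb (by omega) hπ,
      h.uniqueNbr_apply.apply_eq_of_adj hF hρ hb (by omega) hqz⟩

theorem sym2_apply_eq (h : OrbitTwo S T q z π) (hT : T = floorBound (Fintype.card V) + 1)
    (hn : Fintype.card V ∈ Finset.Ico 6 14) (hρ : ρ ∈ S) (hb : Function.Bijective ρ) :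
    s(ρ z, ρ (π z)) = s(z, π z) := by
  by_contra hne
  have hn6 := (Finset.mem_Ico.1 hn).1
  have hnum : ∀ n ∈ Finset.Ico 6 14, n < floorBound n - 3 ∧
      1 + ∑ i ∈ Finset.range (n - 3), isolatedDefectCap n (floorBound n - 4) (3 + 1 + i) <
        2 * (floorBound n - n) := by decide +kernel
  obtain ⟨_, hcount⟩ := hnum _ hn
  have hisolated : ∀ t, t + 4 < T → ∀ x ∈ ({π q, q} : Finset V), ∀ y,
      ¬ (mergeGraph S t).Adj x y := fun t ht x hx => h.not_adj_of_sym2_ne hρ hb hne ht hx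
  obtain ⟨x, hx, L, hL, hLx, hdup⟩ := h.exists_insert_pair
  set t := floorBound (Fintype.card V) - Fintype.card V
  have hedges := h.isMergeFamily.two_mul_add_le_sum_deg_add (t := t) h.stronglyConnected
    (h.tripleFree.boundsDefect_isolatedDefectCap h.three_le h.synchronizing h.defect_le
      (by omega) (hisolated (floorBound (Fintype.card V) - 4) (by omega) q (by simp)))
    ⟨_, Finset.mem_insert_self _ _⟩ hdup (by rw [h.card_insert_pair hLx]; omega)
  have hdeg : ∀ s, s + 4 < T → ∀ x ∈ ({π q, q} : Finset V), deg (mergeGraph S s) x = 0 :=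
    fun s hs x hx => Nat.le_zero.1 <|
      deg_le_card (A := ∅) fun y hy => (hisolated s hs x hx y hy).elim
  have hdegL := h.isMergeFamily.deg_apply_le (t := t) hL x
  rw [hdeg (t + 1) (by omega) x hx] at hdegL
  rw [h.card_insert_pair hLx, Finset.sum_insert hLx,
    Finset.sum_eq_zero (hdeg t (by omega))] at hedges
  have := h.defect_le L hL
  omega

theorem ne_apply_miss (h : OrbitTwo S T q z π) (hT : T = floorBound (Fintype.card V) + 1)
    (hn : Fintype.card V ∈ Finset.Ico 6 14) : z ≠ π z := by
  intro hz
  obtain ⟨σ, hσ, hσb, hne⟩ := h.exists_bijective_apply_ne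
  have hsym := h.sym2_apply_eq hT hn hσ hσb
  rw [← hz] at hsym
  exact hne (by simpa using hsym)

theorem isMergeFamily_sup_edge_apply (h : OrbitTwo S T q z π)
    (hT : T = floorBound (Fintype.card V) + 1) (hn : Fintype.card V ∈ Finset.Ico 6 14) :
    IsMergeFamily S T 1 fun t => mergeGraph S t ⊔ SimpleGraph.edge z (π z) :=
  h.isMergeFamily_sup_edge (h.ne_apply_miss hT hn)
    (fun hq => h.ne_apply hT hn (h.bijective.1 (by rw [h.apply_apply, ← hq])))
    fun _ hρ hb => h.sym2_apply_eq hT hn hρ hb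

end OrbitTwo

/-- The tight case of nine vertices: the pair `{z, π z}` is preserved by the bijective letters and
forms an edge of every graph of the merge family `F`, and `v` is an image of `q` or `π q` under a
letter that is not bijective, with possible neighbours `z` and `c`. -/
structure TightNine (S : Set (V → V)) (q z : V) (π : V → V) (F : ℕ → SimpleGraph V) (v c : V) : Prop
    extends OrbitTwo S 20 q z π where
  card_eq : Fintype.card V = 9
  family : IsMergeFamily S 20 1 F
  ne_apply_miss : z ≠ π z
  miss_ne_apply : z ≠ π q
  sym2_apply_eq : ∀ ρ ∈ S, Function.Bijective ρ → s(ρ z, ρ (π z)) = s(z, π z)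
  adj_miss : ∀ t, (F t).Adj z (π z)
  exit_notMem : v ∉ ({π q, q} : Finset V)
  exit_ne : v ≠ z
  exit_mem_duplicated : v ∈ duplicated S 3
  exit_nbr : ∀ ⦃t⦄, t + 3 < 20 → ∀ ⦃y⦄, (F t).Adj v y → y = z ∨ y = c

namespace TightNine

variable {v u : V}

theorem apply_apply_miss (h : TightNine S q z π F v c) : π (π z) = z := by
  rcases Sym2.eq_iff.1 (h.sym2_apply_eq π h.mem h.bijective) with ⟨hz, -⟩ | ⟨-, hz⟩
  · exact absurd hz.symm h.ne_apply_miss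
  · exact hz

theorem deg_exit_le_two (h : TightNine S q z π F v c) (ht : t + 3 < 20) : deg (F t) v ≤ 2 :=
  (deg_le_card (A := {z, c}) fun y hy => by simpa using h.exit_nbr ht hy).trans Finset.card_le_two

theorem four_le_sum_deg (h : TightNine S q z π F v c) :
    4 ≤ deg (F 10) v + (deg (F 10) (π q) + deg (F 10) q) := by
  have hedges := h.two_mul_add_le_of_card_eq_nine h.card_eq h.family (insert v {π q, q})
  rw [h.card_insert_pair h.exit_notMem, Finset.sum_insert h.exit_notMem,
    Finset.sum_pair h.apply_ne_self] at hedges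
  omega

theorem three_le_deg (h : TightNine S q z π F v c) (hu : u ∉ insert v ({π q, q} : Finset V)) :
    3 ≤ deg (F 10) u := by
  have hedges := h.two_mul_add_le_of_card_eq_nine h.card_eq h.family (insert u (insert v {π q, q}))
  have hpair := h.sum_pair_le h.family (t := 10) (by norm_num)
  have hv := h.deg_exit_le_two (t := 10) (by norm_num)
  rw [Finset.card_insert_of_notMem hu, h.card_insert_pair h.exit_notMem, Finset.sum_insert hu,
    Finset.sum_insert h.exit_notMem] at hedges
  omega

theorem adj_of_deg (h : TightNine S q z π F v c) : (F 10).Adj q z ∧ (F 10).Adj (π q) (π z) ∧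
    (F 10).Adj v z ∧ (F 10).Adj v c := by
  have hsum := h.four_le_sum_deg
  have hv := h.deg_exit_le_two (t := 10) (by norm_num)
  have hq := h.uniqueNbr.deg_le_one h.family (t := 10) (by norm_num)
  have hπ := h.uniqueNbr_apply.deg_le_one h.family (t := 10) (by norm_num)
  have hfull : ∀ {x a : V} {A : Finset V}, (∀ y, (F 10).Adj x y → y = a ∨ y ∈ A) →
      A.card < deg (F 10) x → (F 10).Adj x a := fun hnbr hlt => by
    by_contra hno
    exact hlt.not_ge (deg_le_card fun y hy => (hnbr y hy).resolve_left fun hya => hno (hya ▸ hy))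
  refine ⟨hfull (A := ∅) (fun y hy => Or.inl (h.uniqueNbr h.family (by norm_num) hy)) ?_,
    hfull (A := ∅) (fun y hy => Or.inl (h.uniqueNbr_apply h.family (by norm_num) hy)) ?_,
    hfull (A := {c}) (fun y hy => by simpa using h.exit_nbr (by norm_num) hy) ?_,
    hfull (A := {z}) (fun y hy => by simpa using (h.exit_nbr (by norm_num) hy).symm) ?_⟩ <;>
  simp only [Finset.card_empty, Finset.card_singleton] <;> omega

theorem apply_exit (h : TightNine S q z π F v c) (hσ : σ ∈ S) (hb : Function.Bijective σ) :
    σ v = v := by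
  by_contra hne
  have hσv : σ v ∉ ({π q, q} : Finset V) :=
    apply_notMem_of_closed hb.1 (h.apply_mem σ hσ hb) h.exit_notMem
  have hthree := h.three_le_deg (u := σ v) (by simp only [Finset.mem_insert] at hσv ⊢; tauto)
  have hdeg := (h.family.deg_apply_le_of_bijective (t := 10) hσ hb v).trans
    (h.deg_exit_le_two (by norm_num))
  omega

theorem exit_ne_apply (h : TightNine S q z π F v c) : v ≠ π z := fun hv =>
  h.exit_ne (h.bijective.1 ((h.apply_exit h.mem h.bijective).trans hv))

theorem nbr_eq_apply (h : TightNine S q z π F v c) : c = π z := by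
  have hadj := h.adj_of_deg.2.2.1
  rw [← h.apply_exit h.mem h.bijective] at hadj
  obtain ⟨u, hu, huv⟩ := h.family.exists_adj_of_adj_apply h.mem h.bijective hadj
  rcases h.exit_nbr (by norm_num) huv with rfl | rfl
  · exact absurd hu.symm h.ne_apply_miss
  · exact h.bijective.1 (hu.trans h.apply_apply_miss.symm)

theorem eq_miss_or_eq_apply (h : TightNine S q z π F v c)
    (hx : x ∈ insert v ({π q, q} : Finset V)) (hy : (F 10).Adj x y) : y = z ∨ y = π z := by
  rcases Finset.mem_insert.1 hx with rfl | hx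
  · rw [← h.nbr_eq_apply]
    exact h.exit_nbr (by norm_num) hy
  rcases Finset.mem_insert.1 hx with rfl | hx
  · exact Or.inr (h.uniqueNbr_apply h.family (by norm_num) hy)
  · rw [Finset.mem_singleton.1 hx] at hy
    exact Or.inl (h.uniqueNbr h.family (by norm_num) hy)

theorem eq_of_adj_miss (h : TightNine S q z π F v c) (ht : 10 ≤ t) (hdeg : deg (F t) z ≤ 3)
    (hy : (F t).Adj z y) : y = q ∨ y = v ∨ y = π z := by
  obtain ⟨hqz, -, hvz, -⟩ := h.adj_of_deg
  have hcard : ({q, v, π z} : Finset V).card = 3 := Finset.card_eq_three.2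
    ⟨q, v, π z, fun hq => h.exit_notMem (by simp [← hq]),
      fun hq => h.miss_ne_apply (h.bijective.1 (by rw [h.apply_apply, ← hq])), h.exit_ne_apply, rfl⟩
  simpa using mem_of_adj_of_deg_le_card (B := {q, v, π z}) (by
    simpa using ⟨(h.family.monotone ht hqz).symm, (h.family.monotone ht hvz).symm, h.adj_miss t⟩)
    (hcard ▸ hdeg) hy

theorem eq_of_adj_apply_miss (h : TightNine S q z π F v c) (ht : 10 ≤ t)
    (hdeg : deg (F t) (π z) ≤ 3) (hy : (F t).Adj (π z) y) : y = π q ∨ y = v ∨ y = z := by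
  obtain ⟨-, hπ, -, hvc⟩ := h.adj_of_deg
  rw [h.nbr_eq_apply] at hvc
  have hcard : ({π q, v, z} : Finset V).card = 3 := Finset.card_eq_three.2
    ⟨π q, v, z, fun hq => h.exit_notMem (by simp [← hq]), h.miss_ne_apply.symm, h.exit_ne, rfl⟩
  simpa using mem_of_adj_of_deg_le_card (B := {π q, v, z}) (by
    simpa using ⟨(h.family.monotone ht hπ).symm, (h.family.monotone ht hvc).symm,
      (h.adj_miss t).symm⟩) (hcard ▸ hdeg) hy

theorem deg_le_three (h : TightNine S q z π F v c) (x : V) : deg (F 10) x ≤ 3 :=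
  h.deg_le_three_of_card_eq_nine h.card_eq h.family le_rfl (by norm_num)
    (h.card_eq ▸ h.mem_duplicated_card x)

theorem apply_mem_of_mem_pair (h : TightNine S q z π F v c) (hL : L ∈ S)
    (hx : x ∈ ({π q, q} : Finset V)) : L x ∈ insert v ({π q, q} : Finset V) := by
  by_contra hLx
  obtain ⟨c', hc⟩ := h.exists_uniqueNbr hx
  exact absurd (h.three_le_deg hLx) (Nat.lt_succ_of_le
    (hc.deg_apply_le_two h.family hL (h.defect_le L hL) (by norm_num))).not_ge

theorem apply_exit_eq (h : TightNine S q z π F v c) (hL : L ∈ S)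
    (hLv : L v ∉ insert v ({π q, q} : Finset V)) : L v = π z := by
  have hb : ¬ Function.Bijective L := fun hb => hLv (by simp [h.apply_exit hL hb])
  by_contra hne
  refine absurd (h.three_le_deg hLv) (Nat.lt_succ_of_le ((deg_le_card (A := {L z, L c})
    fun y hy => ?_).trans Finset.card_le_two)).not_ge
  rcases h.eq_or_exists_of_adj_apply h.family hL hb hy with rfl | ⟨u, rfl, hu⟩
  · rcases h.eq_of_adj_miss le_rfl (h.deg_le_three y) hy.symm with heq | heq | heq
    · exact absurd (by simp [heq]) hLv
    · exact absurd (by simp [heq]) hLv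
    · exact absurd heq hne
  · rcases h.exit_nbr (by norm_num) hu with rfl | rfl <;> simp

theorem apply_miss_mem_duplicated (h : TightNine S q z π F v c) : π z ∈ duplicated S 4 := by
  obtain ⟨x, hx, L, hL, hLx⟩ := h.stronglyConnected.exists_apply_notMem
    (B := insert v {π q, q}) ⟨v, by simp⟩
    (by rw [h.card_insert_pair h.exit_notMem, h.card_eq]; norm_num)
  rcases Finset.mem_insert.1 hx with rfl | hx
  · rw [← h.apply_exit_eq hL hLx]
    exact apply_mem_duplicated hL h.exit_mem_duplicated
  · exact absurd (h.apply_mem_of_mem_pair hL hx) hLx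

theorem miss_mem_duplicated (h : TightNine S q z π F v c) : z ∈ duplicated S 5 := by
  rw [← h.apply_apply_miss]
  exact apply_mem_duplicated h.mem h.apply_miss_mem_duplicated

/-- A letter that is not bijective and moves `y` outside the five vertices leaves `L y` with the
two possible neighbours `L v` and `L x`. -/
theorem apply_mem_of_nbrs (h : TightNine S q z π F v c) (hL : L ∈ S) (hy : y = z ∨ y = π z)
    (hnbr : ∀ u, (F 11).Adj y u → u ∈ ({π q, q} : Finset V) ∨ u = v ∨ u = x) :
    L y ∈ insert z (insert (π z) (insert v ({π q, q} : Finset V))) := by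
  by_contra hLy
  obtain ⟨hLz, hLπz, hLv⟩ : L y ≠ z ∧ L y ≠ π z ∧ L y ∉ insert v ({π q, q} : Finset V) := by
    simpa only [Finset.mem_insert, not_or] using hLy
  have hb : ¬ Function.Bijective L := fun hb => by
    have := h.sym2_apply_eq L hL hb
    grind
  refine absurd (h.three_le_deg hLv) (Nat.lt_succ_of_le ((deg_le_card (A := {L v, L x})
    fun w hw => ?_).trans Finset.card_le_two)).not_ge
  rcases h.eq_or_exists_of_adj_apply h.family hL hb hw with rfl | ⟨u, rfl, hu⟩
  · rcases h.eq_of_adj_miss le_rfl (h.deg_le_three w) hw.symm with heq | heq | heq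
    · exact absurd (by simp [heq]) hLv
    · exact absurd (by simp [heq]) hLv
    · exact absurd heq hLπz
  · rcases hnbr u hu with hupair | rfl | rfl
    · rcases h.eq_miss_or_eq_apply (h.apply_mem_of_mem_pair hL hupair) hw.symm with heq | heq
      · exact absurd heq hLz
      · exact absurd heq hLπz
    · simp
    · simp

theorem apply_mem_five (h : TightNine S q z π F v c) (hL : L ∈ S)
    (hx : x ∈ insert z (insert (π z) (insert v ({π q, q} : Finset V)))) :
    L x ∈ insert z (insert (π z) (insert v ({π q, q} : Finset V))) := by
  rcases Finset.mem_insert.1 hx with rfl | hx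
  · refine h.apply_mem_of_nbrs (x := π x) hL (Or.inl rfl) fun u hu => ?_
    rcases h.eq_of_adj_miss (by norm_num) (h.deg_le_three_of_card_eq_nine h.card_eq h.family
      (by norm_num) (by norm_num) h.miss_mem_duplicated) hu with rfl | rfl | rfl <;> simp
  rcases Finset.mem_insert.1 hx with rfl | hx
  · refine h.apply_mem_of_nbrs (x := z) hL (Or.inr rfl) fun u hu => ?_
    rcases h.eq_of_adj_apply_miss (by norm_num) (h.deg_le_three_of_card_eq_nine h.card_eq h.family
      (by norm_num) (by norm_num) h.apply_miss_mem_duplicated) hu with rfl | rfl | rfl <;> simp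
  refine Finset.mem_insert_of_mem ?_
  by_cases hLx : L x ∈ insert v ({π q, q} : Finset V)
  · exact Finset.mem_insert_of_mem hLx
  rcases Finset.mem_insert.1 hx with rfl | hx
  · exact h.apply_exit_eq hL hLx ▸ Finset.mem_insert_self _ _
  · exact absurd (h.apply_mem_of_mem_pair hL hx) hLx

theorem false (h : TightNine S q z π F v c) : False := by
  have hcard : (insert z (insert (π z) (insert v {π q, q})) : Finset V).card ≤ 5 :=
    Finset.card_le_five
  obtain ⟨x, hx, L, hL, hLx⟩ := h.stronglyConnected.exists_apply_notMem
    ⟨z, Finset.mem_insert_self _ _⟩ (hcard.trans_lt (by rw [h.card_eq]; norm_num))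
  exact hLx (h.apply_mem_five hL hx)

end TightNine

namespace OrbitTwo

theorem sum_quadruple_le (h : OrbitTwo S 17 q z π) (hn : Fintype.card V = 8)
    (hF : IsMergeFamily S 17 e F) (hx : x ∈ ({π q, q} : Finset V)) (hL : L ∈ S)
    (hLx : L x ∉ ({π q, q} : Finset V)) (hdup : ∀ y ∈ (insert (L x) {π q, q} : Finset V),
      y ∈ duplicated S 3) :
    ∃ A : Finset V, A.card = 4 ∧ ∑ y ∈ A, deg (F 12) y ≤ 6 := by
  obtain ⟨_, _, _, _, hKy, hdup'⟩ := h.stronglyConnected.exists_insert_duplicated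
    ⟨_, Finset.mem_insert_self _ _⟩ (by rw [h.card_insert_pair hLx, hn]; norm_num) hdup
  have hcap : defectCap 8 17 1 4 = 2 := by decide +kernel
  have hdeg := hF.deg_le_of_mem_duplicated h.boundsDefect (t := 12) (by norm_num)
    (hdup' _ (Finset.mem_insert_self _ _))
  rw [hn, hcap] at hdeg
  refine ⟨_, by rw [Finset.card_insert_of_notMem hKy, h.card_insert_pair hLx], ?_⟩
  rw [Finset.sum_insert hKy]
  exact Nat.add_le_add hdeg (h.sum_insert_pair_le hF hx hL hLx (by norm_num))

theorem tightNine (h : OrbitTwo S 20 q z π) (hn : Fintype.card V = 9)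
    (hx : x ∈ ({π q, q} : Finset V)) (hL : L ∈ S) (hLx : L x ∉ ({π q, q} : Finset V)) :
    ∃ c, TightNine S q z π (fun t => mergeGraph S t ⊔ SimpleGraph.edge z (π z)) (L x) c := by
  have hb : ¬ Function.Bijective L := fun hb => hLx (h.apply_mem L hL hb x hx)
  have hT : 20 = floorBound (Fintype.card V) + 1 := by rw [hn]; decide +kernel
  have hn' : Fintype.card V ∈ Finset.Ico 6 14 := by simp [hn]
  have hF := h.isMergeFamily_sup_edge_apply hT hn'
  have hzw := h.ne_apply_miss hT hn'
  obtain ⟨c, hc⟩ := h.exists_uniqueNbr hx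
  exact ⟨L c, h, hn, hF, hzw, h.ne_apply hT hn', fun _ hρ hb => h.sym2_apply_eq hT hn' hρ hb,
    fun t => by simp [SimpleGraph.edge_adj, hzw], hLx,
    h.apply_ne hL hb x, apply_mem_duplicated hL (h.mem_duplicated_two x hx), fun t ht y hy =>
      h.eq_or_eq_of_adj_apply hc hF hL hb ht hy⟩

end OrbitTwo

theorem MovesDup.card_notMem_Ico (h : MovesDup S T q z π)
    (hT : T = floorBound (Fintype.card V) + 1) : Fintype.card V ∉ Finset.Ico 6 14 := by
  intro hn
  obtain ⟨hn6, hn14⟩ := Finset.mem_Ico.1 hn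
  have hn12 := h.card_lt_twelve hT hn14
  have ho : OrbitTwo S T q z π :=
    ⟨h, fun ρ hρ hb x => h.apply_mem_pair hT (Finset.mem_Ico.2 ⟨hn6, hn12⟩) hρ hb⟩
  have hlt := lt_floorBound (Fintype.card V) (Finset.mem_Ico.2 ⟨by omega, hn14⟩)
  have hF := ho.isMergeFamily_sup_edge_apply hT hn
  obtain ⟨x, hx, L, hL, hLx, hdup⟩ := h.exists_insert_pair
  have hsum := fun t => h.sum_insert_pair_le hF hx hL hLx (t := t)
  obtain hn8 | hn8 | hn9 | hn10 : Fintype.card V < 8 ∨ Fintype.card V = 8 ∨ Fintype.card V = 9 ∨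
    10 ≤ Fintype.card V := by omega
  · have hnum : ∀ n ∈ Finset.Ico 6 8, 4 + (n - 3).choose 2 < floorBound n - 3 + 1 := by
      decide +kernel
    have hedges := hF.add_le_sum_deg_add_choose (t := floorBound (Fintype.card V) - 3) (by omega)
      (insert (L x) {π q, q})
    have := hsum (floorBound (Fintype.card V) - 3) (by omega)
    have := hnum _ (Finset.mem_Ico.2 ⟨hn6, hn8⟩)
    rw [h.card_insert_pair hLx] at hedges
    omega
  · obtain rfl : T = 17 := by rw [hT, hn8]; decide +kernel
    obtain ⟨A, hA, hAsum⟩ := ho.sum_quadruple_le hn8 hF hx hL hLx hdup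
    have hedges := hF.add_le_sum_deg_add_choose (t := 12) (by norm_num) A
    rw [hA, hn8, show Nat.choose (8 - 4) 2 = 6 from rfl] at hedges
    omega
  · obtain rfl : T = 20 := by rw [hT, hn9]; decide +kernel
    obtain ⟨c, hc⟩ := ho.tightNine hn9 hx hL hLx
    exact hc.false
  · have hnum : ∀ n ∈ Finset.Ico 10 12, 4 + ∑ i ∈ Finset.range (n - 3),
        defectCap n (floorBound n + 1) 1 (3 + 1 + i) < 2 * (floorBound n - n + 1) := by
      decide +kernel
    have hedges := h.two_mul_add_le_sum_deg_add hF ⟨_, Finset.mem_insert_self _ _⟩ hdup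
      (t := floorBound (Fintype.card V) - Fintype.card V)
      (by rw [h.card_insert_pair hLx]; omega)
    have := hsum (floorBound (Fintype.card V) - Fintype.card V) (by omega)
    have := hnum _ (Finset.mem_Ico.2 ⟨hn10, hn12⟩)
    rw [h.card_insert_pair hLx, hT] at hedges
    omega

end SameMiss

theorem mem_of_nodup_of_length_eq_card {V : Type*} [Fintype V] {l : List V} (hl : l.Nodup)
    (hcard : l.length = Fintype.card V) (v : V) : v ∈ l := by
  classical
  rw [← List.mem_toFinset,
    Finset.eq_univ_of_card _ ((List.toFinset_card_of_nodup hl).trans hcard)]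
  exact Finset.mem_univ v

section SmallCases

open scoped Classical

variable {V : Type*} [Fintype V] {S : Set (V → V)} {T t : ℕ} {q z x y b c : V}
  {σ L : V → V}

theorem SameMiss.exists_adj_one_apply_eq (h : SameMiss S T q z) (hL : L ∈ S)
    (hb : ¬ Function.Bijective L) :
    ∃ u u', (mergeGraph S 1).Adj u u' ∧ L u = q ∧ L u' = q := by
  obtain ⟨u, u', hne, hu, hu'⟩ := mem_dups.1 (h.mem_dups L hL hb)
  exact ⟨u, u', mergeGraph_adj_of_eq hL hne (hu.trans hu'.symm), hu, hu'⟩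

theorem SameMiss.numEdges_add_le (h : SameMiss S T q z) {s : ℕ} (ht : s + t < T) :
    numEdges (mergeGraph S s) + t ≤ numEdges (mergeGraph S (s + t)) := by
  obtain ⟨a, ha, hb⟩ := h.exists_not_bijective
  simpa using (isDead_bot S).numEdges_sdiff_add_le h.three_le h.tripleFree h.synchronizing ha
    (h.mem_dups a ha hb) (fun _ h => h) s t ht

/-- The situation in which all the bijective letters fix `q`. -/
structure FixesDup (S : Set (V → V)) (T : ℕ) (q z : V) : Prop extends SameMiss S T q z where
  apply_eq : ∀ σ ∈ S, Function.Bijective σ → σ q = q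

namespace FixesDup

theorem not_adj (h : FixesDup S T q z) (ht : t + 2 < T) (y : V) :
    ¬ (mergeGraph S t).Adj q y := by
  intro hy
  obtain ⟨σ, hσ, hσb, hne⟩ := h.exists_bijective_apply_ne
  have hyz := h.uniqueNbr h.isMergeFamily (by omega) hy
  rw [← h.apply_eq σ hσ hσb] at hy
  exact hne ((h.uniqueNbr.apply_eq_of_adj h.isMergeFamily hσ hσb (by omega) hy).trans hyz)

theorem deg_eq_zero (h : FixesDup S T q z) (ht : t + 2 < T) : deg (mergeGraph S t) q = 0 :=
  Nat.le_zero.1 (deg_le_card (A := ∅) fun y hy => absurd hy (h.not_adj ht y))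

theorem not_bijective (h : FixesDup S T q z) (hL : L ∈ S) (hLq : L q ≠ q) :
    ¬ Function.Bijective L :=
  fun hb => hLq (h.apply_eq L hL hb)

theorem eq_of_adj_apply (h : FixesDup S T q z) (hL : L ∈ S) (hLq : L q ≠ q) (ht : t + 3 < T)
    (hy : (mergeGraph S t).Adj (L q) y) : y = z :=
  (h.eq_or_exists_of_adj_apply h.isMergeFamily hL (h.not_bijective hL hLq) hy).resolve_right
    fun ⟨u, _, hu⟩ => h.not_adj (by omega) u hu

theorem deg_apply_le_one (h : FixesDup S T q z) (hL : L ∈ S) (hLq : L q ≠ q) (ht : t + 3 < T) :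
    deg (mergeGraph S t) (L q) ≤ 1 :=
  deg_le_card (A := {z}) fun _ hy => Finset.mem_singleton.2 (h.eq_of_adj_apply hL hLq ht hy)

theorem two_lt_sum_deg_of_card_eq_six (h : FixesDup S 11 q z) (hn : Fintype.card V = 6)
    {A : Finset V} (hA : A.card = 3) : 2 < ∑ x ∈ A, deg (mergeGraph S 6) x := by
  have hedges := h.isMergeFamily.add_le_sum_deg_add_choose (t := 6) (by norm_num) A
  rw [hn, hA, show Nat.choose (6 - 3) 2 = 3 from rfl] at hedges
  omega

theorem apply_apply_eq_of_card_eq_six (h : FixesDup S 11 q z) (hn : Fintype.card V = 6)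
    (hL : L ∈ S) (hLq : L q ≠ q) (hσ : σ ∈ S) (hb : Function.Bijective σ) :
    σ (L q) = L q := by
  by_contra hne
  have hσLq : σ (L q) ∉ ({L q, q} : Finset V) := by
    simpa [hne] using fun hq => hLq (hb.1 (hq.trans (h.apply_eq σ hσ hb).symm))
  have hsum := h.two_lt_sum_deg_of_card_eq_six hn
    (by rw [Finset.card_insert_of_notMem hσLq, Finset.card_pair hLq])
  rw [Finset.sum_insert hσLq, Finset.sum_pair hLq, h.deg_eq_zero (by norm_num)] at hsum
  have hdeg := h.deg_apply_le_one hL hLq (t := 6) (by norm_num)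
  have hdegσ := (h.isMergeFamily.deg_apply_le_of_bijective (t := 6) hσ hb (L q)).trans
    (h.deg_apply_le_one hL hLq (by norm_num))
  omega

theorem card_ne_six (h : FixesDup S 11 q z) : Fintype.card V ≠ 6 := by
  intro hn
  obtain ⟨L, hL, hLq⟩ := h.stronglyConnected.exists_apply_ne (by omega) q
  have hiso : deg (mergeGraph S 6) (L q) = 0 := by
    refine Nat.le_zero.1 (deg_le_card (A := ∅) fun y hy => ?_)
    obtain ⟨σ, hσ, hσb, hne⟩ := h.exists_bijective_apply_ne
    rw [← h.apply_apply_eq_of_card_eq_six hn hL hLq hσ hσb] at hy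
    obtain ⟨u, rfl, hu⟩ := h.isMergeFamily.exists_adj_of_adj_apply hσ hσb hy
    rw [h.apply_apply_eq_of_card_eq_six hn hL hLq hσ hσb] at hy
    rw [h.eq_of_adj_apply hL hLq (by norm_num) hu] at hy
    exact absurd (h.eq_of_adj_apply hL hLq (by norm_num) hy) hne
  obtain ⟨x, hx, M, hM, hMx⟩ := h.stronglyConnected.exists_apply_notMem
    (⟨q, by simp⟩ : ({L q, q} : Finset V).Nonempty) (by rw [Finset.card_pair hLq]; omega)
  have hsum := h.two_lt_sum_deg_of_card_eq_six hn
    (by rw [Finset.card_insert_of_notMem hMx, Finset.card_pair hLq])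
  rw [Finset.sum_insert hMx, Finset.sum_pair hLq, h.deg_eq_zero (by norm_num), hiso] at hsum
  have hdegx : deg (mergeGraph S (6 + 1)) x ≤ 1 := by
    rcases Finset.mem_insert.1 hx with rfl | hx
    · exact h.deg_apply_le_one hL hLq (by norm_num)
    · rw [Finset.mem_singleton.1 hx, h.deg_eq_zero (by norm_num)]
      exact zero_le_one
  have hdegMx := h.isMergeFamily.deg_apply_le (t := 6) hM x
  have hdef := h.defect_le M hM
  omega

theorem card_ne_four (h : FixesDup S 6 q z) : Fintype.card V ≠ 4 := by
  intro hn
  obtain ⟨a, ha, haq⟩ := h.stronglyConnected.exists_apply_ne (by omega) q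
  have hb := h.not_bijective ha haq
  have hazq : a z ≠ q := fun hazq => by
    have hdeg : deg (mergeGraph S 3) (a q) ≤ 1 :=
      deg_le_card (A := {z}) fun y hy => Finset.mem_singleton.2 <|
        (h.eq_or_eq_of_adj_apply h.uniqueNbr h.isMergeFamily ha hb (by norm_num) hy).resolve_right
          fun hyq => h.not_adj (by norm_num) (a q) (hazq ▸ hyq ▸ hy).symm
    have hedges := h.isMergeFamily.add_le_sum_deg_add_choose (t := 3) (by norm_num) {a q, q}
    rw [Finset.sum_pair haq, Finset.card_pair haq, h.deg_eq_zero (by norm_num), hn,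
      show Nat.choose (4 - 2) 2 = 1 from rfl] at hedges
    omega
  obtain ⟨u, u', hadj, hu, hu'⟩ := h.exists_adj_one_apply_eq ha hb
  have hnodup : [q, z, u, u'].Nodup := by
    have := h.ne
    have := hadj.ne
    grind
  have hmem : a q = u ∨ a q = u' := by
    have := mem_of_nodup_of_length_eq_card hnodup hn.symm (a q)
    have := h.apply_ne ha hb q
    grind
  rcases hmem with hmem | hmem
  · exact hazq (h.eq_of_adj_apply ha haq (by norm_num) (hmem ▸ hadj) ▸ hu')
  · exact hazq (h.eq_of_adj_apply ha haq (by norm_num) (hmem ▸ hadj.symm) ▸ hu)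

end FixesDup

/-- The five states in the situation where the bijective letters fix `q`: some letter maps `q` to
`x`, and all the letters that are not bijective merge `b` and `c`. -/
structure FixedFive (S : Set (V → V)) (q z x b c : V) : Prop extends FixesDup S 8 q z where
  card_eq : Fintype.card V = 5
  nodup : [q, z, x, b, c].Nodup
  eq_of_adj : ∀ {t y}, t ≤ 4 → (mergeGraph S t).Adj x y → y = z
  adj_one : (mergeGraph S 1).Adj b c
  adj_two : (mergeGraph S 2).Adj x z

namespace FixesDup

theorem exists_adj_apply (h : FixesDup S 8 q z) (hqz : (mergeGraph S 6).Adj q z) :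
    ∃ L ∈ S, L q ≠ q ∧ L z ≠ q ∧ (mergeGraph S 5).Adj (L q) (L z) := by
  obtain ⟨hne, L, hL, heq | hadj⟩ := mergeGraph_succ_adj.1 hqz
  · exact absurd (mergeGraph_adj_of_eq (t := 0) hL hne heq) (h.not_adj (by norm_num) z)
  · exact ⟨L, hL, fun hq => h.not_adj (by norm_num) _ (hq ▸ hadj),
      fun hq => h.not_adj (by norm_num) _ (hq ▸ hadj.symm), hadj⟩

theorem exists_fixedFive (h : FixesDup S 8 q z) (hn : Fintype.card V = 5)
    (hqz : (mergeGraph S 6).Adj q z) : ∃ x b c, FixedFive S q z x b c := by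
  obtain ⟨L, hL, hLq, hLz, _⟩ := h.exists_adj_apply hqz
  have hb := h.not_bijective hL hLq
  have hLqz := h.apply_ne hL hb q
  obtain ⟨b, c, hbc, hLb, hLc⟩ := h.exists_adj_one_apply_eq hL hb
  have hx : ∀ {t y}, t ≤ 4 → (mergeGraph S t).Adj (L q) y → y = z := fun ht hy =>
    h.eq_of_adj_apply hL hLq (by omega) hy
  have hxb : L q ≠ b := fun e => hLz (hx (by norm_num) (e ▸ hbc) ▸ hLc)
  have hxc : L q ≠ c := fun e => hLz (hx (by norm_num) (e ▸ hbc.symm) ▸ hLb)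
  have hnodup : [q, z, L q, b, c].Nodup := by
    have := h.ne
    have := hbc.ne
    grind
  have hpre : ∀ y, y ≠ z → y ≠ q → y ≠ L q → y = L (L q) ∨ y = L z := fun y hyz hyq hyx => by
    obtain ⟨u, rfl⟩ := h.exists_apply_eq hL hb hyz
    have := mem_of_nodup_of_length_eq_card hnodup hn.symm u
    grind
  refine ⟨L q, b, c, h, hn, hnodup, hx, hbc, mergeGraph_adj_of_letter hL ?_⟩
  have hb' := hpre b (by grind) (by grind) hxb.symm
  have hc' := hpre c (by grind) (by grind) hxc.symm
  have := hbc.symm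
  grind

end FixesDup

namespace FixedFive

theorem swap (h : FixedFive S q z x b c) : FixedFive S q z x c b :=
  ⟨h.toFixesDup, h.card_eq, by have := h.nodup; grind, h.eq_of_adj, h.adj_one.symm, h.adj_two⟩

theorem eq_or (h : FixedFive S q z x b c) (v : V) : v = q ∨ v = z ∨ v = x ∨ v = b ∨ v = c := by
  simpa using mem_of_nodup_of_length_eq_card h.nodup h.card_eq.symm v

theorem numEdges_four_le (h : FixedFive S q z x b c) : numEdges (mergeGraph S 4) ≤ 4 := by
  have hx : deg (mergeGraph S 4) x ≤ 1 :=
    deg_le_card (A := {z}) fun _ hy => Finset.mem_singleton.2 (h.eq_of_adj le_rfl hy)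
  have hqx : q ≠ x := by have := h.nodup; grind
  have hedges := numEdges_le (mergeGraph S 4) {q, x}
  rw [Finset.sum_pair hqx, Finset.card_pair hqx, h.card_eq, h.deg_eq_zero (by norm_num),
    show Nat.choose (5 - 2) 2 = 3 from rfl] at hedges
  omega

theorem adj_one_iff (h : FixedFive S q z x b c) {u v : V} :
    (mergeGraph S 1).Adj u v ↔ s(u, v) = s(b, c) := by
  have hcard : numEdges (mergeGraph S 1) ≤ 1 := by
    have := h.numEdges_add_le (s := 1) (t := 3) (by norm_num)
    exact Nat.le_of_add_le_add_right (this.trans h.numEdges_four_le)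
  refine ⟨fun huv => (Set.ncard_le_one_iff).1 hcard huv h.adj_one, fun huv => ?_⟩
  rw [← SimpleGraph.mem_edgeSet, huv]
  exact h.adj_one

theorem eq_or_eq_of_adj_two (h : FixedFive S q z x b c) {u v : V}
    (huv : (mergeGraph S 2).Adj u v) : s(u, v) = s(b, c) ∨ s(u, v) = s(x, z) := by
  have hcard : numEdges (mergeGraph S 2) ≤ 2 := by
    have := h.numEdges_add_le (s := 2) (t := 2) (by norm_num)
    exact Nat.le_of_add_le_add_right (this.trans h.numEdges_four_le)
  have hbc : (mergeGraph S 2).Adj b c := mergeGraph_mono one_le_two h.adj_one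
  have hne : s(b, c) ≠ s(x, z) := by have := h.nodup; grind
  have heq : ({s(b, c), s(x, z)} : Set (Sym2 V)) = (mergeGraph S 2).edgeSet :=
    Set.eq_of_subset_of_ncard_le (Set.insert_subset hbc (Set.singleton_subset_iff.2 h.adj_two))
      (by rwa [Set.ncard_pair hne]) (Set.toFinite _)
  exact heq.ge huv

theorem exists_adj_three (h : FixedFive S q z x b c) :
    (mergeGraph S 3).Adj z b ∨ (mergeGraph S 3).Adj z c := by
  by_contra! hno
  have hsub : (mergeGraph S 3).edgeSet ⊆ {s(b, c), s(x, z)} := by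
    rintro ⟨u, v⟩ (huv : (mergeGraph S 3).Adj u v)
    have hq := h.not_adj (t := 3) (by norm_num)
    have hx := fun y => h.eq_of_adj (t := 3) (y := y) (by norm_num)
    have := huv.symm
    have := huv.ne
    rcases h.eq_or u with rfl | rfl | rfl | rfl | rfl <;>
      rcases h.eq_or v with rfl | rfl | rfl | rfl | rfl <;> grind
  have hthree : 3 ≤ numEdges (mergeGraph S 3) :=
    h.isMergeFamily.add_le_numEdges (t := 3) (by norm_num)
  have htwo : numEdges (mergeGraph S 3) ≤ 2 := (Set.ncard_le_ncard hsub (Set.toFinite _)).trans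
    ((Set.ncard_insert_le _ _).trans (by rw [Set.ncard_singleton]))
  omega

theorem not_adj_three (h : FixedFive S q z x b c) : ¬ (mergeGraph S 3).Adj z b := by
  intro hzb
  have hnodup := h.nodup
  obtain ⟨hne, M, hM, heq | hadj⟩ := mergeGraph_succ_adj.1 hzb
  · have := h.adj_one_iff.1 (mergeGraph_adj_of_eq (t := 0) hM hne heq)
    grind
  by_cases hb : Function.Bijective M
  · have hzb : ¬ (s(z, b) = s(b, c) ∨ s(z, b) = s(x, z)) := by grind
    have hxc : ¬ (s(x, c) = s(b, c) ∨ s(x, c) = s(x, z)) := by grind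
    have hpull : ∀ u v, s(M u, M v) = s(b, c) → s(u, v) = s(b, c) ∨ s(u, v) = s(x, z) :=
      fun _ _ huv => h.eq_or_eq_of_adj_two (mergeGraph_adj_of_letter hM (h.adj_one_iff.2 huv))
    rcases h.eq_or_eq_of_adj_two hadj with hMzb | hMzb
    · exact hzb (hpull z b hMzb)
    · refine hxc (hpull x c ?_)
      have hMnodup := hnodup.map hb.1
      have hMx := h.eq_or (M x)
      have hMc := h.eq_or (M c)
      simp only [List.map_cons, List.map_nil, h.apply_eq M hM hb, List.nodup_cons, List.mem_cons,
        List.not_mem_nil, or_false, not_or] at hMnodup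
      rw [Sym2.eq_iff] at hMzb ⊢
      clear hpull hzb hxc
      grind
  · obtain ⟨u, u', huu', hu, hu'⟩ := h.exists_adj_one_apply_eq hM hb
    have hMb : M b = q := by
      have := h.adj_one_iff.1 huu'
      grind
    exact h.not_adj (by norm_num) _ (hMb ▸ hadj.symm)

theorem false (h : FixedFive S q z x b c) : False :=
  h.exists_adj_three.elim h.not_adj_three h.swap.not_adj_three

end FixedFive

theorem FixesDup.not_adj_six (h : FixesDup S 8 q z) (hn : Fintype.card V = 5) :
    ¬ (mergeGraph S 6).Adj q z := fun hqz =>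
  let ⟨_, _, _, hfive⟩ := h.exists_fixedFive hn hqz
  hfive.false

theorem FixesDup.card_notMem_Ico (h : FixesDup S T q z)
    (hT : T = floorBound (Fintype.card V) + 1) : Fintype.card V ∉ Finset.Ico 4 14 := by
  intro hn
  obtain ⟨hn4, hn14⟩ := Finset.mem_Ico.1 hn
  have hlt := lt_floorBound _ hn
  obtain hn4' | hn5 | hn6 | hn7 : Fintype.card V = 4 ∨ Fintype.card V = 5 ∨ Fintype.card V = 6 ∨
    7 ≤ Fintype.card V := by omega
  · obtain rfl : T = 6 := by rw [hT, hn4']; decide +kernel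
    exact h.card_ne_four hn4'
  · obtain rfl : T = 8 := by rw [hT, hn5]; decide +kernel
    obtain ⟨y, hy⟩ := h.exists_adj_of_card_lt_seven hn4 (by omega) (hT ▸ h.tripleFree)
      h.stronglyConnected h.synchronizing
    rw [show floorBound (Fintype.card V) - 1 = 6 by omega] at hy
    exact h.not_adj_six hn5 (h.uniqueNbr h.isMergeFamily (by norm_num) hy ▸ hy)
  · obtain rfl : T = 11 := by rw [hT, hn6]; decide +kernel
    exact h.card_ne_six hn6
  · obtain ⟨y, hy⟩ := h.exists_adj_of_seven_le_card hn7 hn14 (hT ▸ h.tripleFree)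
      h.stronglyConnected h.synchronizing
    exact h.not_adj (by omega) y hy

end SmallCases

theorem adj_apply_or_adj_apply {V : Type*} [Finite V] {G H : SimpleGraph V} {σ : V → V}
    (hσ : Function.Bijective σ) (hGH : G.comap σ ≤ H) (hcard : numEdges H ≤ numEdges G + 1)
    {a b c d : V} (hab : H.Adj a b) (hcd : H.Adj c d) (hne : s(a, b) ≠ s(c, d)) :
    G.Adj (σ a) (σ b) ∨ G.Adj (σ c) (σ d) := by
  by_contra! hno
  have hcomap : numEdges (G.comap σ) = numEdges G :=
    Set.ncard_congr' (SimpleGraph.Iso.comap (Equiv.ofBijective σ hσ) G).mapEdgeSet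
  have hlt : numEdges (G.comap σ) < numEdges (G.comap σ ⊔ SimpleGraph.edge a b) :=
    numEdges_lt (SimpleGraph.lt_sup_edge _ a b hab.ne hno.1)
  have hlt' : numEdges (G.comap σ ⊔ SimpleGraph.edge a b) < numEdges H := by
    refine numEdges_lt (lt_of_le_of_ne
      (sup_le hGH ((SimpleGraph.edge_le_iff _).2 (Or.inr hab))) fun heq => ?_)
    rw [← heq, SimpleGraph.sup_adj, SimpleGraph.edge_adj] at hcd
    exact hcd.elim hno.2 fun hcd => hne (Sym2.eq_iff.2 (by grind))
  omega

section MovesDup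

open scoped Classical

variable {V : Type*} [Fintype V] {S : Set (V → V)} {T t : ℕ} {q z v x y : V}
  {π ρ σ : V → V}

/-- The pairs of states that can be merged late when `q` and `π q` have no other neighbours than
`z` and `π z`. -/
noncomputable def possibleEdges (q z : V) (π : V → V) : Finset (Sym2 V) :=
  {s(q, z), s(π q, π z)} ∪
    ({π q, q} : Finset V)ᶜ.offDiag.image (Sym2.mk : V → V → Sym2 V).uncurry

theorem mem_possibleEdges_of_notMem (hx : x ∉ ({π q, q} : Finset V))
    (hy : y ∉ ({π q, q} : Finset V)) (hxy : x ≠ y) : s(x, y) ∈ possibleEdges q z π :=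
  Finset.mem_union_right _ (Finset.mem_image.2 ⟨(x, y), Finset.mem_offDiag.2
    ⟨Finset.mem_compl.2 hx, Finset.mem_compl.2 hy, hxy⟩, rfl⟩)

theorem MovesDup.edgeSet_subset (h : MovesDup S T q z π) (ht : t + 2 < T) :
    (mergeGraph S t).edgeSet ⊆ possibleEdges q z π := by
  have hq : ∀ {y}, (mergeGraph S t).Adj q y → y = z :=
    fun hy => h.uniqueNbr h.isMergeFamily (by omega) hy
  have hπq : ∀ {y}, (mergeGraph S t).Adj (π q) y → y = π z :=
    fun hy => h.uniqueNbr_apply h.isMergeFamily ht hy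
  rintro ⟨x, y⟩ (hxy : (mergeGraph S t).Adj x y)
  by_cases hmem : x ∈ ({π q, q} : Finset V) ∨ y ∈ ({π q, q} : Finset V)
  · refine Finset.mem_union_left _ ?_
    simp only [Finset.mem_insert, Finset.mem_singleton] at hmem
    rcases hmem with (rfl | rfl) | (rfl | rfl)
    · rw [hπq hxy]; simp
    · rw [hq hxy]; simp
    · rw [hπq hxy.symm]; simp
    · rw [hq hxy.symm]; simp
  · rw [not_or] at hmem
    exact mem_possibleEdges_of_notMem hmem.1 hmem.2 hxy.ne

theorem MovesDup.card_possibleEdges_le (h : MovesDup S T q z π) :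
    (possibleEdges q z π).card ≤
      ({s(q, z), s(π q, π z)} : Finset (Sym2 V)).card + (Fintype.card V - 2).choose 2 := by
  refine (Finset.card_union_le _ _).trans_eq ?_
  rw [Sym2.card_image_offDiag, Finset.card_compl, Finset.card_pair h.apply_ne_self]

/-- The small cases of `MovesDup`, in which the number of edges forced at time `T - 3` equals the
number of possible edges. -/
structure TightMovesDup (S : Set (V → V)) (T : ℕ) (q z : V) (π : V → V) : Prop
    extends MovesDup S T q z π where
  eq_choose_add : T = (Fintype.card V - 2).choose 2 + 5

namespace TightMovesDup

theorem sub_three_add_two_lt (h : TightMovesDup S T q z π) : T - 3 + 2 < T := by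
  have := h.eq_choose_add
  omega

theorem choose_add_two_le_card (h : TightMovesDup S T q z π) :
    (Fintype.card V - 2).choose 2 + 2 ≤ numEdges (mergeGraph S (T - 3)) :=
  (h.isMergeFamily.add_le_numEdges (by have := h.sub_three_add_two_lt; omega)).trans'
    (by have := h.eq_choose_add; omega)

theorem sym2_ne (h : TightMovesDup S T q z π) : s(q, z) ≠ s(π q, π z) := fun heq => by
  have hle := Set.ncard_le_ncard (h.edgeSet_subset h.sub_three_add_two_lt) (Set.toFinite _)
  have hcard := h.card_possibleEdges_le
  rw [heq, Finset.pair_eq_singleton, Finset.card_singleton] at hcard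
  rw [Set.ncard_coe_finset] at hle
  have := h.choose_add_two_le_card.trans hle
  omega

theorem edgeSet_eq (h : TightMovesDup S T q z π) :
    (mergeGraph S (T - 3)).edgeSet = possibleEdges q z π := by
  refine Set.eq_of_subset_of_ncard_le (h.edgeSet_subset h.sub_three_add_two_lt) ?_
    (Set.toFinite _)
  rw [Set.ncard_coe_finset]
  refine h.card_possibleEdges_le.trans (h.choose_add_two_le_card.trans' ?_)
  rw [add_comm]
  exact Nat.add_le_add_left Finset.card_le_two _

theorem adj (h : TightMovesDup S T q z π) : (mergeGraph S (T - 3)).Adj q z := by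
  rw [← SimpleGraph.mem_edgeSet, h.edgeSet_eq]
  simp [possibleEdges]

theorem adj_apply (h : TightMovesDup S T q z π) : (mergeGraph S (T - 3)).Adj (π q) (π z) := by
  rw [← SimpleGraph.mem_edgeSet, h.edgeSet_eq]
  simp [possibleEdges]

theorem adj_of_notMem (h : TightMovesDup S T q z π) (hx : x ∉ ({π q, q} : Finset V))
    (hy : y ∉ ({π q, q} : Finset V)) (hxy : x ≠ y) : (mergeGraph S (T - 3)).Adj x y := by
  rw [← SimpleGraph.mem_edgeSet, h.edgeSet_eq]
  exact mem_possibleEdges_of_notMem hx hy hxy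

theorem eq_of_adj (h : TightMovesDup S T q z π) (ht : t + 2 < T)
    (hy : (mergeGraph S t).Adj q y) : y = z :=
  h.uniqueNbr h.isMergeFamily (by omega) hy

theorem eq_of_adj_apply (h : TightMovesDup S T q z π) (ht : t + 2 < T)
    (hy : (mergeGraph S t).Adj (π q) y) : y = π z :=
  h.uniqueNbr_apply h.isMergeFamily ht hy

theorem ne_apply (h : TightMovesDup S T q z π) : z ≠ π q := by
  intro hz
  refine h.sym2_ne ?_
  rw [← h.eq_of_adj_apply h.sub_three_add_two_lt (hz ▸ h.adj.symm), ← hz, Sym2.eq_swap]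

theorem apply_ne_dup (h : TightMovesDup S T q z π) : π z ≠ q := by
  intro hπz
  refine h.sym2_ne ?_
  rw [hπz, ← h.eq_of_adj h.sub_three_add_two_lt (hπz ▸ h.adj_apply.symm), Sym2.eq_swap]

theorem notMem (h : TightMovesDup S T q z π) : z ∉ ({π q, q} : Finset V) := by
  simpa using ⟨h.ne_apply, h.ne.symm⟩

theorem apply_notMem (h : TightMovesDup S T q z π) : π z ∉ ({π q, q} : Finset V) := by
  simpa using ⟨fun heq => h.ne.symm (h.bijective.1 heq), h.apply_ne_dup⟩

theorem apply_miss_ne (h : TightMovesDup S T q z π) : π z ≠ z := by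
  intro hπz
  have hadj : ∀ x, x ≠ z → (mergeGraph S (T - 3)).Adj x z := fun x hx => by
    by_cases hmem : x ∈ ({π q, q} : Finset V)
    · rcases Finset.mem_insert.1 hmem with rfl | hmem
      · exact hπz ▸ h.adj_apply
      · exact Finset.mem_singleton.1 hmem ▸ h.adj
    · exact h.adj_of_notMem hmem h.notMem hx
  obtain ⟨σ, hσ, hb, hσz⟩ := h.exists_bijective_apply_ne
  have huniq : ∀ {y}, (mergeGraph S (T - 3)).Adj (σ q) y → y = σ z :=
    fun hy => h.uniqueNbr.apply_of_bijective hσ hb h.isMergeFamily h.sub_three_add_two_lt hy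
  by_cases hσq : σ q = z
  · refine h.apply_ne_self ((huniq ?_).trans (huniq ?_).symm)
    · exact hσq ▸ (hadj _ h.ne_apply.symm).symm
    · exact hσq ▸ h.adj.symm
  · exact hσz (huniq (hadj _ hσq)).symm

theorem apply_eq_or (h : TightMovesDup S T q z π) (hσ : σ ∈ S) (hb : Function.Bijective σ) :
    σ q = q ∧ σ z = z ∨ σ q = π q ∧ σ z = π z := by
  have huniq : ∀ {y}, (mergeGraph S (T - 3)).Adj (σ q) y → y = σ z :=
    fun hy => h.uniqueNbr.apply_of_bijective hσ hb h.isMergeFamily h.sub_three_add_two_lt hy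
  have hmem : σ q ∈ ({π q, q} : Finset V) := by
    by_contra hmem
    by_cases hz : σ q = z
    · refine h.apply_ne_dup ((huniq ?_).trans (huniq ?_).symm)
      · exact hz.symm ▸ h.adj_of_notMem h.notMem h.apply_notMem h.apply_miss_ne.symm
      · exact hz ▸ h.adj.symm
    by_cases hπz : σ q = π z
    · refine h.ne_apply ((huniq ?_).trans (huniq ?_).symm)
      · exact hπz.symm ▸ h.adj_of_notMem h.apply_notMem h.notMem h.apply_miss_ne
      · exact hπz ▸ h.adj_apply.symm
    · exact h.apply_miss_ne ((huniq (h.adj_of_notMem hmem h.apply_notMem hπz)).trans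
        (huniq (h.adj_of_notMem hmem h.notMem hz)).symm)
  rcases Finset.mem_insert.1 hmem with hq | hq
  · exact Or.inr ⟨hq, (huniq (hq ▸ h.adj_apply)).symm⟩
  · rw [Finset.mem_singleton] at hq
    exact Or.inl ⟨hq, (huniq (hq.symm ▸ h.adj)).symm⟩

theorem exists_sym2_ne (h : TightMovesDup S T q z π) :
    ∃ ρ ∈ S, Function.Bijective ρ ∧ s(ρ z, ρ (π z)) ≠ s(z, π z) := by
  by_contra! hperm
  have hF := h.isMergeFamily_sup_edge h.apply_miss_ne.symm h.apply_ne_dup.symm hperm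
  have hedges := hF.add_le_sum_deg_add_choose (t := T - 3)
    (by have := h.sub_three_add_two_lt; omega) {π q, q}
  have hsum := h.sum_pair_le hF h.sub_three_add_two_lt
  have hT := h.eq_choose_add
  rw [Finset.card_pair h.apply_ne_self] at hedges
  omega

theorem nodup (h : TightMovesDup S T q z π) : [q, π q, z, π z].Nodup := by
  have := h.notMem
  have := h.apply_notMem
  have := h.apply_ne_self
  have := h.apply_miss_ne
  grind

theorem adj_miss (h : TightMovesDup S T q z π) : (mergeGraph S (T - 3)).Adj z (π z) :=
  h.adj_of_notMem h.notMem h.apply_notMem h.apply_miss_ne.symm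

theorem not_adj_miss_two (h : TightMovesDup S 6 q z π) (hn : Fintype.card V = 4) :
    ¬ (mergeGraph S 2).Adj z (π z) := by
  obtain ⟨ρ, hρ, hb, hne⟩ := h.exists_sym2_ne
  have hsym : s(ρ z, ρ (π q)) = s(z, π z) := by
    have hρmem := fun x => mem_of_nodup_of_length_eq_card h.nodup hn.symm (ρ x)
    have hρnodup := h.nodup.map hb.1
    have := h.apply_eq_or hρ hb
    have := h.nodup
    rw [ne_eq, Sym2.eq_iff] at hne
    rw [Sym2.eq_iff]
    have := hρmem (π z)
    have := hρmem (π q)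
    clear hρmem
    simp only [List.map_cons, List.map_nil] at hρnodup
    grind
  intro hadj
  rw [← SimpleGraph.mem_edgeSet, ← hsym] at hadj
  exact h.apply_miss_ne.symm
    (h.eq_of_adj_apply (by norm_num) (mergeGraph_adj_of_letter hρ hadj).symm)

theorem apply_ne_dup_of_adj (h : TightMovesDup S T q z π) (hL : L ∈ S)
    (hb : ¬ Function.Bijective L) (ht : t + 2 < T) (hadj : (mergeGraph S t).Adj (L x) (L y)) :
    L x ≠ q :=
  fun hLx => h.apply_ne hL hb y (h.eq_of_adj ht (hLx ▸ hadj))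

theorem false_of_card_eq_four (h : TightMovesDup S T q z π) (hn : Fintype.card V = 4) :
    False := by
  obtain rfl : T = 6 := by rw [h.eq_choose_add, hn]; rfl
  have hmem := mem_of_nodup_of_length_eq_card h.nodup hn.symm
  have hzw := h.not_adj_miss_two hn
  obtain ⟨hne, L, hL, heq | hadj⟩ := mergeGraph_succ_adj.1 h.adj_miss
  · exact hzw (mergeGraph_adj_of_eq (t := 1) hL hne heq)
  by_cases hb : Function.Bijective L
  · have hq : L (π z) ≠ L q := hb.1.ne h.apply_ne_dup
    have hπq : (mergeGraph S 2).Adj (π q) (L z) → L z = π z := h.eq_of_adj_apply (by norm_num)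
    have hqz : (mergeGraph S 2).Adj q (L z) → L z = z := h.eq_of_adj (by norm_num)
    have hwz := mt SimpleGraph.Adj.symm hzw
    have := h.apply_eq_or hL hb
    have := hadj.ne
    have := hmem (L (π z))
    have := hadj.symm
    have := h.nodup
    grind
  · obtain ⟨u, u', huu', hu, hu'⟩ := h.exists_adj_one_apply_eq hL hb
    have := h.eq_of_adj (t := 1) (y := u') (by norm_num)
    have := h.eq_of_adj_apply (t := 1) (y := u') (by norm_num)
    have := h.apply_ne_dup_of_adj hL hb (by norm_num) hadj
    have := h.apply_ne_dup_of_adj hL hb (by norm_num) hadj.symm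
    have := hmem u
    grind

end TightMovesDup

/-- The configuration to which `TightMovesDup` is reduced on five vertices `q`, `π q`, `z`, `π z`
and `v`. -/
structure TightFive (S : Set (V → V)) (q z : V) (π : V → V) (v : V) : Prop
    extends TightMovesDup S 8 q z π where
  card_eq : Fintype.card V = 5
  nodup_cons : [v, q, π q, z, π z].Nodup

theorem TightMovesDup.exists_tightFive (h : TightMovesDup S T q z π) (hn : Fintype.card V = 5) :
    ∃ v, TightFive S q z π v := by
  obtain rfl : T = 8 := by rw [h.eq_choose_add, hn]; rfl
  have hlt : ([q, π q, z, π z].toFinset).card < Fintype.card V :=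
    (List.toFinset_card_le _).trans_lt (by rw [hn]; norm_num)
  obtain ⟨v, hv⟩ := Finset.exists_mem_notMem_of_card_lt_card (t := Finset.univ) hlt
  exact ⟨v, h, hn, List.nodup_cons.2 ⟨fun hmem => hv.2 (List.mem_toFinset.2 hmem), h.nodup⟩⟩

namespace TightFive

theorem eq_or (h : TightFive S q z π v) (u : V) :
    u = v ∨ u = q ∨ u = π q ∨ u = z ∨ u = π z := by
  simpa using mem_of_nodup_of_length_eq_card h.nodup_cons h.card_eq.symm u

theorem notMem_pair (h : TightFive S q z π v) : v ∉ ({π q, q} : Finset V) := by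
  have := h.nodup_cons
  grind

theorem adj_fifth (h : TightFive S q z π v) (hx : x ∉ ({π q, q} : Finset V)) (hxv : x ≠ v) :
    (mergeGraph S 5).Adj x v :=
  h.adj_of_notMem hx h.notMem_pair hxv

theorem adj_four_or (h : TightFive S q z π v) (hσ : σ ∈ S) (hb : Function.Bijective σ)
    {a b c d : V} (hab : (mergeGraph S 5).Adj a b) (hcd : (mergeGraph S 5).Adj c d)
    (hne : s(a, b) ≠ s(c, d)) :
    (mergeGraph S 4).Adj (σ a) (σ b) ∨ (mergeGraph S 4).Adj (σ c) (σ d) := by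
  refine adj_apply_or_adj_apply (G := mergeGraph S 4) (H := mergeGraph S 5) hb
    (fun _ _ huv => mergeGraph_adj_of_letter hσ huv) ?_ hab hcd hne
  have hfour : 4 ≤ numEdges (mergeGraph S 4) := h.isMergeFamily.add_le_numEdges (by norm_num)
  have hfive := numEdges_le (mergeGraph S 5) {π q, q}
  have hsum := h.sum_pair_le h.isMergeFamily (t := 5) (by norm_num)
  rw [Finset.card_pair h.apply_ne_self, h.card_eq] at hfive
  norm_num [Nat.choose] at hfive
  omega

theorem of_fixes (h : TightFive S q z π v) (hρ : ρ ∈ S) (hb : Function.Bijective ρ)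
    (hq : ρ q = q) (hz : ρ z = z) (hπz : ρ (π z) ≠ π z) :
    ρ (π z) = v ∧ ρ v = π z ∧ ρ (π q) = π q := by
  have hnodup := h.nodup_cons
  have hρnodup := hnodup.map hb.1
  have hzv := h.adj_fifth h.notMem (by grind)
  have hwv := h.adj_fifth h.apply_notMem (by grind)
  have hzw_pw := h.adj_four_or hρ hb h.adj_miss h.adj_apply (by grind)
  have hzw_wv := h.adj_four_or hρ hb h.adj_miss hwv (by grind)
  have hzv_wv := h.adj_four_or hρ hb hzv hwv (by grind)
  have hp : ∀ y, (mergeGraph S 4).Adj (π q) y → y = π z := fun _ => h.eq_of_adj_apply (by norm_num)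
  have hp' : ∀ y, (mergeGraph S 4).Adj y (π q) → y = π z := fun y hy => hp y hy.symm
  have hw := h.eq_or (ρ (π z))
  have hp := h.eq_or (ρ (π q))
  have hv := h.eq_or (ρ v)
  simp only [List.map_cons, List.map_nil, List.nodup_cons, List.mem_cons,
        List.not_mem_nil, or_false, not_or] at hρnodup hnodup
  clear h hzv hwv
  grind

theorem of_moves (h : TightFive S q z π v) (hρ : ρ ∈ S) (hb : Function.Bijective ρ)
    (hq : ρ q = π q) (hz : ρ z = π z) (hπz : ρ (π z) ≠ z) :
    ρ (π z) = v ∧ ρ v = z ∧ ρ (π q) = q := by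
  have hnodup := h.nodup_cons
  have hρnodup := hnodup.map hb.1
  have hzv := h.adj_fifth h.notMem (by grind)
  have hwv := h.adj_fifth h.apply_notMem (by grind)
  have hzw_wv := h.adj_four_or hρ hb h.adj_miss hwv (by grind)
  have hzw_pw := h.adj_four_or hρ hb h.adj_miss h.adj_apply (by grind)
  have hzv_wv := h.adj_four_or hρ hb hzv hwv (by grind)
  have hp : ∀ y, (mergeGraph S 4).Adj q y → y = z := fun _ => h.eq_of_adj (by norm_num)
  have hp' : ∀ y, (mergeGraph S 4).Adj y q → y = z := fun y hy => hp y hy.symm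
  have hw := h.eq_or (ρ (π z))
  have hp := h.eq_or (ρ (π q))
  have hv := h.eq_or (ρ v)
  simp only [List.map_cons, List.map_nil, List.nodup_cons, List.mem_cons,
        List.not_mem_nil, or_false, not_or] at hρnodup hnodup
  clear h hzv hwv
  grind

theorem not_adj_fifth (h : TightFive S q z π v) : ¬ (mergeGraph S 5).Adj (π q) v := fun hadj => by
  have := h.nodup_cons
  have := h.eq_of_adj_apply (by norm_num) hadj
  grind

theorem apply_apply_eq_of_not_adj (h : TightFive S q z π v) (hπz : π (π z) = z)
    (hpw : ¬ (mergeGraph S 4).Adj (π q) (π z)) : π (π q) = q := by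
  have hadj : ∀ a b, (mergeGraph S 5).Adj a b → s(q, z) ≠ s(a, b) →
      (mergeGraph S 4).Adj (π a) (π b) := fun a b hab hne =>
    (h.adj_four_or h.mem h.bijective h.adj hab hne).resolve_left hpw
  have hnodup := h.nodup_cons
  have := hadj z (π z) h.adj_miss (by grind)
  have hzv := hadj z v (h.adj_fifth h.notMem (by grind)) (by grind)
  have hq : ∀ {y}, (mergeGraph S 4).Adj q y → y = z := h.eq_of_adj (by norm_num)
  have hππq := h.eq_or (π (π q))
  have hπv := h.eq_or (π v)
  have hqz := h.ne
  have hinj := h.bijective.1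
  have hne : π v ≠ π q ∧ π v ≠ π z ∧ π v ≠ π (π q) ∧ π v ≠ π (π z) ∧ π (π q) ≠ π q ∧
    π (π q) ≠ π z ∧ π (π q) ≠ π (π z) := by
    simp only [ne_eq, hinj.eq_iff]
    grind
  have := hzv.symm
  clear hadj h
  grind

theorem not_adj_of_fixes (h : TightFive S q z π v) (hρ : ρ ∈ S) (hb : Function.Bijective ρ)
    (hq : ρ q = q) (hz : ρ z = z) (hπz : ρ (π z) ≠ π z) :
    (mergeGraph S 4).Adj q z ∧ ¬ (mergeGraph S 3).Adj q z ∧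
      ¬ (mergeGraph S 3).Adj (π q) (π z) := by
  obtain ⟨hρw, hρv, hρp⟩ := h.of_fixes hρ hb hq hz hπz
  have hpw : ¬ (mergeGraph S 4).Adj (π q) (π z) := fun hadj =>
    h.not_adj_fifth (mergeGraph_adj_of_letter hρ (by rwa [hρp, hρv]))
  have hqz : (mergeGraph S 4).Adj q z := by
    have hor := h.adj_four_or hρ hb h.adj h.adj_apply h.sym2_ne
    rw [hq, hz, hρp, hρw] at hor
    exact hor.resolve_right fun hadj => h.not_adj_fifth (mergeGraph_mono (Nat.le_succ 4) hadj)
  have hππz : π (π z) = z := by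
    by_contra hne
    obtain ⟨-, hπv, hπp⟩ := h.of_moves h.mem h.bijective rfl rfl hne
    exact h.not_adj_fifth (mergeGraph_adj_of_letter h.mem (by rwa [hπp, hπv]))
  have hππq := h.apply_apply_eq_of_not_adj hππz hpw
  exact ⟨hqz, fun hadj => hpw (mergeGraph_adj_of_letter h.mem (by rwa [hππq, hππz])),
    fun hadj => hpw (mergeGraph_mono (Nat.le_succ 3) hadj)⟩

theorem not_adj_of_moves (h : TightFive S q z π v) (hρ : ρ ∈ S) (hb : Function.Bijective ρ)
    (hq : ρ q = π q) (hz : ρ z = π z) (hπz : ρ (π z) ≠ z) :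
    (mergeGraph S 4).Adj (π q) (π z) ∧ ¬ (mergeGraph S 3).Adj q z ∧
      ¬ (mergeGraph S 3).Adj (π q) (π z) := by
  obtain ⟨hρw, hρv, hρp⟩ := h.of_moves hρ hb hq hz hπz
  have hqz : ¬ (mergeGraph S 4).Adj q z := fun hadj =>
    h.not_adj_fifth (mergeGraph_adj_of_letter hρ (by rwa [hρp, hρv]))
  have hpw : (mergeGraph S 4).Adj (π q) (π z) := by
    have hor := h.adj_four_or hρ hb h.adj h.adj_apply h.sym2_ne
    rw [hq, hz, hρp, hρw] at hor
    refine hor.resolve_right fun hadj => ?_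
    have := h.nodup_cons
    have := h.eq_of_adj (by norm_num) hadj
    grind
  exact ⟨hpw, fun hadj => hqz (mergeGraph_mono (Nat.le_succ 3) hadj),
    fun hadj => hqz (mergeGraph_adj_of_letter hρ (by rwa [hq, hz]))⟩

theorem triangle (h : TightFive S q z π v) (hq : ¬ (mergeGraph S 3).Adj q z)
    (hπq : ¬ (mergeGraph S 3).Adj (π q) (π z)) :
    (mergeGraph S 3).Adj z (π z) ∧ (mergeGraph S 3).Adj z v ∧ (mergeGraph S 3).Adj (π z) v := by
  have hsub : (mergeGraph S 3).edgeSet ⊆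
      (({s(z, π z), s(z, v), s(π z, v)} : Finset (Sym2 V)) : Set (Sym2 V)) := by
    rintro ⟨x, y⟩ (hxy : (mergeGraph S 3).Adj x y)
    have hq' : ∀ y, ¬ (mergeGraph S 3).Adj q y := fun y hy =>
      hq (h.eq_of_adj (by norm_num) hy ▸ hy)
    have hπq' : ∀ y, ¬ (mergeGraph S 3).Adj (π q) y := fun y hy =>
      hπq (h.eq_of_adj_apply (by norm_num) hy ▸ hy)
    have hne := hxy.ne
    rw [Finset.mem_coe, Finset.mem_insert, Finset.mem_insert, Finset.mem_singleton]
    change s(x, y) = _ ∨ s(x, y) = _ ∨ s(x, y) = _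
    have hx : x ≠ q ∧ x ≠ π q := ⟨fun e => hq' y (e ▸ hxy), fun e => hπq' y (e ▸ hxy)⟩
    have hy : y ≠ q ∧ y ≠ π q := ⟨fun e => hq' x (e ▸ hxy.symm), fun e => hπq' x (e ▸ hxy.symm)⟩
    have hx' := h.eq_or x
    have hy' := h.eq_or y
    simp only [Sym2.eq_iff]
    clear h hq hπq hq' hπq' hxy
    grind
  have hcard : 3 ≤ numEdges (mergeGraph S 3) := h.isMergeFamily.add_le_numEdges (by norm_num)
  have heq := Set.eq_of_subset_of_ncard_le hsub
    ((Set.ncard_coe_finset _).trans_le (Finset.card_le_three.trans hcard)) (Set.toFinite _)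
  simp only [← SimpleGraph.mem_edgeSet, heq]
  simp

theorem exists_adj_four_not_adj_three (h : TightFive S q z π v) :
    ¬ (mergeGraph S 3).Adj q z ∧ ¬ (mergeGraph S 3).Adj (π q) (π z) ∧
      ∃ x y, UniqueNbr S 8 2 x y ∧ (mergeGraph S 4).Adj x y ∧ ¬ (mergeGraph S 3).Adj x y ∧
        ∀ u u', (mergeGraph S 1).Adj u u' → u ≠ y → u' ≠ y → (mergeGraph S 2).Adj (π z) v := by
  obtain ⟨ρ, hρ, hb, hne⟩ := h.exists_sym2_ne
  have hmono : mergeGraph S 1 ≤ mergeGraph S 3 := mergeGraph_mono (by norm_num)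
  have hq : ∀ {y}, (mergeGraph S 1).Adj q y → y = z := h.eq_of_adj (by norm_num)
  have hπq : ∀ {y}, (mergeGraph S 1).Adj (π q) y → y = π z := h.eq_of_adj_apply (by norm_num)
  rcases h.apply_eq_or hρ hb with ⟨hρq, hρz⟩ | ⟨hρq, hρz⟩
  · obtain ⟨hadj, hqz, hpw⟩ := h.not_adj_of_fixes hρ hb hρq hρz (by grind)
    refine ⟨hqz, hpw, q, z, h.uniqueNbr.mono one_le_two, hadj, hqz, fun u u' huu' hu hu' => ?_⟩
    have hwv : (mergeGraph S 1).Adj (π z) v := by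
      have hpw := mt (@hmono _ _) hpw
      have hu_mem := h.eq_or u
      have hu_mem' := h.eq_or u'
      have := huu'.symm
      have := huu'.ne
      clear h
      grind
    exact mergeGraph_mono one_le_two hwv
  · have hρw : ρ (π z) ≠ z := by grind
    obtain ⟨hadj, hqz, hpw⟩ := h.not_adj_of_moves hρ hb hρq hρz hρw
    refine ⟨hqz, hpw, π q, π z, h.uniqueNbr_apply, hadj, hpw, fun u u' huu' hu hu' => ?_⟩
    have hvz : (mergeGraph S 1).Adj v z := by
      have hqz := mt (@hmono _ _) hqz
      have hu_mem := h.eq_or u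
      have hu_mem' := h.eq_or u'
      have := huu'.symm
      have := huu'.ne
      clear h
      grind
    obtain ⟨hρw, hρv, -⟩ := h.of_moves hρ hb hρq hρz hρw
    exact mergeGraph_adj_of_letter hρ (by rwa [hρw, hρv])

theorem contradiction (h : TightFive S q z π v) : False := by
  obtain ⟨hqz, hpw, x, y, huniq, hadj, hnot, hmerged⟩ := h.exists_adj_four_not_adj_three
  obtain ⟨hzw, hzv, hwv⟩ := h.triangle hqz hpw
  have hnodup := h.nodup_cons
  obtain ⟨hxy, L, hL, heq | hLxy⟩ := mergeGraph_succ_adj.1 hadj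
  · exact hnot (mergeGraph_mono (by norm_num) (mergeGraph_adj_of_eq (t := 0) hL hxy heq))
  have hmem : ∀ {a b}, (mergeGraph S 3).Adj a b → a = z ∨ a = π z ∨ a = v := fun {a b} hab => by
    have hq : ¬ a = q := fun ha => hqz (h.eq_of_adj (by norm_num) (ha ▸ hab) ▸ ha ▸ hab)
    have hπq : ¬ a = π q := fun ha =>
      hpw (h.eq_of_adj_apply (by norm_num) (ha ▸ hab) ▸ ha ▸ hab)
    have := h.eq_or a
    tauto
  have hLx := hmem hLxy
  have hLy := hmem hLxy.symm
  have hne := hLxy.ne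
  by_cases hb : Function.Bijective L
  · have : ∀ {c}, (mergeGraph S 3).Adj (L x) c → c = L y := fun hc =>
      huniq.apply_of_bijective hL hb h.isMergeFamily (by norm_num) hc
    have := hzw.symm
    have := hzv.symm
    have := hwv.symm
    clear h
    grind
  · obtain ⟨u, u', huu', hu, hu'⟩ := h.exists_adj_one_apply_eq hL hb
    have hLyq : L y ≠ q := by grind
    have hwv := hmerged u u' huu' (by grind) (by grind)
    have hx := h.apply_ne hL hb x
    have hy := h.apply_ne hL hb y
    refine hnot (mergeGraph_adj_of_letter hL ?_)
    have := hwv.symm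
    clear h
    grind

end TightFive

theorem TightMovesDup.false_of_card_eq_five (h : TightMovesDup S T q z π)
    (hn : Fintype.card V = 5) : False :=
  let ⟨_, hv⟩ := h.exists_tightFive hn
  hv.contradiction

theorem SameMiss.card_notMem_Ico (h : SameMiss S T q z)
    (hT : T = floorBound (Fintype.card V) + 1) : Fintype.card V ∉ Finset.Ico 4 14 := by
  intro hn
  by_cases hfix : ∀ σ ∈ S, Function.Bijective σ → σ q = q
  · exact FixesDup.card_notMem_Ico ⟨h, hfix⟩ hT hn
  push Not at hfix
  obtain ⟨π, hπ, hb, hπq⟩ := hfix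
  have hmoves : MovesDup S T q z π := ⟨h, hπ, hb, hπq⟩
  have hsmall : Fintype.card V = 4 ∨ Fintype.card V = 5 := by
    have := hmoves.card_notMem_Ico hT
    rw [Finset.mem_Ico] at this hn
    omega
  have hbound : floorBound 4 = 5 ∧ floorBound 5 = 7 := by decide +kernel
  rcases hsmall with hcard | hcard
  · exact TightMovesDup.false_of_card_eq_four ⟨hmoves, by rw [hT, hcard, hbound.1]; rfl⟩ hcard
  · exact TightMovesDup.false_of_card_eq_five ⟨hmoves, by rw [hT, hcard, hbound.2]; rfl⟩ hcard

end MovesDup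

section Bound

variable {V : Type*} [Fintype V] {S : Set (V → V)} {T : ℕ} {q : V}

theorem SameDup.card_notMem_Ico (h : SameDup S q)
    (hT : TripleFree S (floorBound (Fintype.card V) + 1)) (hsc : StronglyConnected S)
    (hsync : Synchronizing S) : Fintype.card V ∉ Finset.Ico 4 14 := by
  intro hn
  have hlt := lt_floorBound _ hn
  have hn' := Finset.mem_Ico.1 hn
  obtain ⟨t, ht, z, hz⟩ : ∃ t, t < floorBound (Fintype.card V) ∧
      ∃ z, (mergeGraph S t).Adj q z := by
    rcases Nat.lt_or_ge (Fintype.card V) 7 with h7 | h7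
    · exact ⟨_, by omega, h.exists_adj_of_card_lt_seven hn'.1 h7 hT hsc hsync⟩
    · exact ⟨_, by omega, h.exists_adj_of_seven_le_card h7 hn'.2 hT hsc hsync⟩
  have hmiss : SameMiss S (floorBound (Fintype.card V) + 1) q z :=
    ⟨h, by omega, hT, hsc, hsync, fun _ ha hb => h.range_eq_of_adj hT (by omega) hz ha hb, hz.ne⟩
  exact hmiss.card_notMem_Ico rfl hn

theorem Synchronizing.exists_max_defect (hsync : Synchronizing S) (hn : 1 < Fintype.card V) :
    ∃ a ∈ S, 0 < defect a ∧ ∀ L ∈ S, defect L ≤ defect a := by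
  obtain ⟨L, hL, hpos⟩ : ∃ L ∈ S, 0 < defect L := by
    by_contra! hbij
    obtain ⟨x, t, f, hf, hx⟩ := hsync
    have hdef : defect f = 0 := Nat.le_zero.1 (hf.defect_le hbij)
    obtain ⟨y, z, hyz⟩ := Fintype.exists_pair_of_one_lt_card hn
    exact hyz ((defect_eq_zero_iff.1 hdef).1 ((hx y).trans (hx z).symm))
  obtain ⟨a, ha, hmax⟩ := Set.exists_max_image S defect (Set.toFinite _) ⟨L, hL⟩
  exact ⟨a, ha, hpos.trans_le (hmax L hL), hmax⟩

theorem TripleFree.two_mul_defect_le (hT : TripleFree S T) (hT' : 1 < T) {a : V → V}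
    (ha : a ∈ S) : 2 * defect a ≤ Fintype.card V :=
  (Nat.le_add_right _ _).trans (hT.two_mul_defect_add_deficiency_le (IsWord.letter ha) hT')

theorem TripleFree.two_mul_add_defect_le (hT : TripleFree S T) (hn : 3 ≤ Fintype.card V)
    (hsc : StronglyConnected S) (hsync : Synchronizing S) {a : V → V} (ha : a ∈ S)
    (hmax : ∀ L ∈ S, defect L ≤ defect a) (hpos : 0 < defect a) {t : ℕ} (ht : 1 ≤ t)
    (htT : t + (Fintype.card V - defect a + 1) < T) :
    2 * (t + defect a) ≤ 2 + degreeSumCap (Fintype.card V) T (defect a) := by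
  have hedges := hT.add_defect_le_numEdges hn hsync ha hpos ht (by omega)
  have hsum := hT.two_mul_numEdges_le_degreeSumCap hn hsc hsync ha hmax hpos htT
  omega

theorem TripleFree.sameDup (hT : TripleFree S (floorBound (Fintype.card V) + 1))
    (hn : Fintype.card V ∈ Finset.Ico 4 14) (hsc : StronglyConnected S) (hsync : Synchronizing S)
    (hr : ∀ L ∈ S, defect L ≤ 1) {a : V → V} (ha : a ∈ S) (hq : q ∈ dups a) : SameDup S q where
  defect_le := hr
  mem_dups L hL hb := by
    obtain ⟨p, hp⟩ := exists_mem_dups (mt defect_eq_zero_iff.1 hb)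
    rw [Finset.mem_Ico] at hn
    exact hT.dups_unique hn.1 hn.2 hsc hsync hr hL ha hp hq ▸ hp
  exists_not_bijective := by
    obtain ⟨u, u', hne, hu, hu'⟩ := mem_dups.1 hq
    exact ⟨a, ha, fun hb => hne (hb.1 (hu.trans hu'.symm))⟩

theorem not_tripleFree_floorBound_add_one (hn : Fintype.card V ∈ Finset.Ico 4 28)
    (hsc : StronglyConnected S) (hsync : Synchronizing S) :
    ¬ TripleFree S (floorBound (Fintype.card V) + 1) := by
  intro hT
  have hn' := Finset.mem_Ico.1 hn
  obtain ⟨a, ha, hpos, hmax⟩ := hsync.exists_max_defect (by omega)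
  by_cases hsmall : Fintype.card V < 14 ∧ defect a ≤ 1
  · have hn14 := Finset.mem_Ico.2 ⟨hn'.1, hsmall.1⟩
    obtain ⟨q, hq⟩ := exists_mem_dups hpos.ne'
    have hdup : SameDup S q :=
      hT.sameDup hn14 hsc hsync (fun L hL => (hmax L hL).trans hsmall.2) ha hq
    exact hdup.card_notMem_Ico hT hsc hsync hn14
  · have hfloor : ∀ n ∈ Finset.Ico 4 28, 0 < floorBound n := by decide +kernel
    have hdef := hT.two_mul_defect_le (Nat.succ_lt_succ (hfloor _ hn)) ha
    obtain ⟨hlt, hcap⟩ := degreeSumCap_floorBound_lt _ hn (defect a)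
      (Finset.mem_Icc.2 ⟨by split_ifs <;> omega, by omega⟩)
    have := hT.two_mul_add_defect_le (by omega) hsc hsync ha hmax hpos
      (t := floorBound (Fintype.card V) - (Fintype.card V - defect a + 1)) (by omega) (by omega)
    omega

theorem TripleFree.le_tripleBound_of_large (hT : TripleFree S T) (hn : 28 ≤ Fintype.card V)
    (hsc : StronglyConnected S) (hsync : Synchronizing S) :
    (T : ℝ) ≤ tripleBound (Fintype.card V) := by
  obtain ⟨a, ha, hpos, hmax⟩ := hsync.exists_max_defect (by omega)
  by_contra! hlt
  have hn' : (28 : ℝ) ≤ Fintype.card V := by exact_mod_cast hn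
  have hsq := Real.sq_sqrt (show 0 ≤ 5 * (Fintype.card V : ℝ) ^ 2 + 4 * Fintype.card V - 12 by
    nlinarith)
  have hs : 2 * (Fintype.card V : ℝ) ≤
      √(5 * (Fintype.card V : ℝ) ^ 2 + 4 * Fintype.card V - 12) :=
    Real.le_sqrt_of_sq_le (by nlinarith)
  rw [tripleBound] at hlt
  set s := √(5 * (Fintype.card V : ℝ) ^ 2 + 4 * Fintype.card V - 12)
  have hcardT : Fintype.card V + 3 < T := by
    have : (Fintype.card V : ℝ) + 3 < T := by nlinarith
    exact_mod_cast this
  have hdef := hT.two_mul_defect_le (by omega) ha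
  have hcount := hT.two_mul_add_defect_le (by omega) hsc hsync ha hmax hpos
    (t := T - (Fintype.card V - defect a + 2)) (by omega) (by omega)
  refine hcount.not_gt (degreeSumCap_lt_of_large hn hpos (by omega)
    (u := (s - Fintype.card V) / 2) (by linarith) (by linarith) (by linarith) (by omega))

theorem TripleFree.le_tripleBound (hT : TripleFree S T) (hn : 4 ≤ Fintype.card V)
    (hsc : StronglyConnected S) (hsync : Synchronizing S) :
    (T : ℝ) ≤ tripleBound (Fintype.card V) := by
  rcases Nat.lt_or_ge (Fintype.card V) 28 with h28 | h28
  · refine le_trans ?_ (floorBound_le_tripleBound (by omega))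
    by_contra! hlt
    exact not_tripleFree_floorBound_add_one (Finset.mem_Ico.2 ⟨hn, h28⟩) hsc hsync
      (hT.mono (by exact_mod_cast hlt))
  · exact hT.le_tripleBound_of_large h28 hsc hsync

end Bound

section Translation

variable {n : ℕ} {S : Set (Matrix (Fin n) (Fin n) ℕ)}

/-- The matrix of a map of states, acting on row vectors: it has a one at `(i, f i)`, so that
matrix products are compositions read from left to right. -/
def mapMatrix (f : Fin n → Fin n) : Matrix (Fin n) (Fin n) ℕ :=
  fun i j => if f i = j then 1 else 0

theorem mapMatrix_mul (f g : Fin n → Fin n) : mapMatrix f * mapMatrix g = mapMatrix (g ∘ f) := by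
  ext i j
  rw [Matrix.mul_apply, Finset.sum_eq_single (f i)]
  · simp [mapMatrix]
  · intro k _ hk
    simp [mapMatrix, Ne.symm hk]
  · simp

theorem mapMatrix_id : mapMatrix (id : Fin n → Fin n) = 1 := by
  ext i j
  simp [mapMatrix, Matrix.one_apply]

theorem mapMatrix_apply_ne_zero {f : Fin n → Fin n} {i j : Fin n} :
    mapMatrix f i j ≠ 0 ↔ f i = j := by
  simp [mapMatrix]

/-- The letters of an automaton, as maps of the set of states. -/
def letterMaps (S : Set (Matrix (Fin n) (Fin n) ℕ)) : Set (Fin n → Fin n) :=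
  {f | mapMatrix f ∈ S}

theorem IsAutomaton.exists_map (hS : IsAutomaton S) {L : Matrix (Fin n) (Fin n) ℕ} (hL : L ∈ S) :
    ∃ f, mapMatrix f = L := by
  obtain ⟨h01, hsum⟩ := hS L hL
  have hrow : ∀ i, ∃ j, ∀ k, (if j = k then 1 else 0) = L i k := by
    intro i
    have hone : ∑ j, L i j = 1 := by simpa [Matrix.mulVec, dotProduct] using congrFun hsum i
    obtain ⟨j, -, hj⟩ := Finset.exists_ne_zero_of_sum_ne_zero (hone.trans_ne one_ne_zero)
    have hij : L i j = 1 := (h01 i j).resolve_left hj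
    have hle : ∀ k, j ≠ k → L i j + L i k ≤ 1 := fun k hk => by
      rw [← hone, ← Finset.sum_pair hk]
      exact Finset.sum_le_sum_of_subset (Finset.subset_univ _)
    refine ⟨j, fun k => ?_⟩
    split_ifs with hk
    · rw [← hk, hij]
    · have := hle k hk
      omega
  choose f hf using hrow
  exact ⟨f, Matrix.ext hf⟩

theorem IsAutomaton.mem_wordsOfLength (hS : IsAutomaton S) {t : ℕ}
    {W : Matrix (Fin n) (Fin n) ℕ} :
    W ∈ wordsOfLength S t ↔ ∃ f, IsWord (letterMaps S) t f ∧ mapMatrix f = W := by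
  constructor
  · rintro ⟨l, rfl, hl, rfl⟩
    induction l with
    | nil => exact ⟨id, IsWord.nil, mapMatrix_id⟩
    | cons L l ih =>
      obtain ⟨g, hg, hprod⟩ := ih fun L' hL' => hl L' (List.mem_cons_of_mem _ hL')
      have hL := hl L List.mem_cons_self
      obtain ⟨f, rfl⟩ := hS.exists_map hL
      exact ⟨g ∘ f, IsWord.cons hL hg, by rw [List.prod_cons, ← hprod, mapMatrix_mul]⟩
  · rintro ⟨f, hf, rfl⟩
    induction hf with
    | nil => exact ⟨[], rfl, List.forall_mem_nil _, mapMatrix_id.symm⟩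
    | @cons t f g hf _ ih =>
      obtain ⟨l, hlen, hl, hprod⟩ := ih
      exact ⟨mapMatrix f :: l, congrArg (· + 1) hlen, List.forall_mem_cons.2 ⟨hf, hl⟩,
        by rw [List.prod_cons, hprod, mapMatrix_mul]⟩

theorem IsAutomaton.stronglyConnected (hS : IsAutomaton S) (h : IsStronglyConnected S) :
    StronglyConnected (letterMaps S) := by
  intro i j
  obtain ⟨t, W, hW, hij⟩ := h i j
  obtain ⟨f, hf, rfl⟩ := hS.mem_wordsOfLength.1 hW
  exact ⟨t, f, hf, mapMatrix_apply_ne_zero.1 (by rw [hij]; exact one_ne_zero)⟩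

theorem IsAutomaton.synchronizing (hS : IsAutomaton S) (h : IsSynchronizing S) :
    Synchronizing (letterMaps S) := by
  obtain ⟨i, t, hW⟩ := h
  obtain ⟨f, hf, hW⟩ := hS.mem_wordsOfLength.1 hW
  refine ⟨i, t, f, hf, fun y => mapMatrix_apply_ne_zero.1 ?_⟩
  rw [hW]
  simp [Matrix.vecMulVec_apply]

theorem IsAutomaton.mem_tripleTimes (hS : IsAutomaton S) {t : ℕ} :
    t ∈ tripleTimes S ↔
      ∃ s ≤ t, ∃ f, IsWord (letterMaps S) s f ∧ ∃ j, 3 ≤ {i | f i = j}.ncard := by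
  constructor
  · rintro ⟨v, ⟨W, ⟨s, hs, hW⟩, j, rfl⟩, hv⟩
    obtain ⟨f, hf, rfl⟩ := hS.mem_wordsOfLength.1 hW
    exact ⟨s, hs, f, hf, j, by simpa only [weight, mapMatrix_apply_ne_zero] using hv⟩
  · rintro ⟨s, hs, f, hf, j, hj⟩
    refine ⟨_, ⟨mapMatrix f, ⟨s, hs, hS.mem_wordsOfLength.2 ⟨f, hf, rfl⟩⟩, j, rfl⟩, ?_⟩
    simpa only [weight, mapMatrix_apply_ne_zero] using hj

theorem IsAutomaton.tripleTimes_nonempty (hS : IsAutomaton S) (hn : 3 ≤ n)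
    (h : IsSynchronizing S) : (tripleTimes S).Nonempty := by
  obtain ⟨x, t, f, hf, hx⟩ := hS.synchronizing h
  refine ⟨t, hS.mem_tripleTimes.2 ⟨t, le_rfl, f, hf, x, ?_⟩⟩
  simpa [hx, Set.ncard_univ] using hn

theorem IsAutomaton.tripleFree (hS : IsAutomaton S) :
    TripleFree (letterMaps S) (tripleRendezvousTime S) := by
  intro t ht f hf x y z hxy hyz
  by_contra! hne
  refine Nat.notMem_of_lt_sInf ht (hS.mem_tripleTimes.2 ⟨t, le_rfl, f, hf, f x, ?_⟩)
  rw [← Set.ncard_eq_three.2 ⟨x, y, z, hne.1, hne.2.2, hne.2.1, rfl⟩]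
  refine Set.ncard_le_ncard ?_ (Set.toFinite _)
  rintro w (rfl | rfl | rfl)
  · rfl
  · exact hxy.symm
  · exact (hxy.trans hyz).symm

theorem IsAutomaton.tripleRendezvousTime_le (hS : IsAutomaton S) (hn : 4 ≤ n)
    (hsc : IsStronglyConnected S) (hsync : IsSynchronizing S) :
    (tripleRendezvousTime S : ℝ) ≤ tripleBound n := by
  have := hS.tripleFree.le_tripleBound (by rwa [Fintype.card_fin]) (hS.stronglyConnected hsc)
    (hS.synchronizing hsync)
  rwa [Fintype.card_fin] at this

end Translation

theorem tendsto_tripleBound :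
    Tendsto (fun n : ℕ => tripleBound n / (n : ℝ) ^ 2) atTop (𝓝 ((Real.sqrt 5 - 1) / 8)) := by
  have hinv : Tendsto (fun n : ℕ => ((n : ℝ))⁻¹) atTop (𝓝 0) := tendsto_inv_atTop_nhds_zero_nat
  have hcont : Continuous fun x : ℝ => (√(5 + 4 * x - 12 * x ^ 2) - 1 + 6 * x) / 8 := by fun_prop
  have hlim := (hcont.tendsto 0).comp hinv
  simp only [mul_zero, add_zero, ne_eq, OfNat.ofNat_ne_zero, not_false_eq_true, zero_pow,
    sub_zero] at hlim
  refine hlim.congr' ?_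
  filter_upwards [eventually_gt_atTop 0] with n hn
  have hn' : (0 : ℝ) < n := by exact_mod_cast hn
  have hfactor : 5 * (n : ℝ) ^ 2 + 4 * n - 12 =
      n ^ 2 * (5 + 4 * (n : ℝ)⁻¹ - 12 * ((n : ℝ)⁻¹) ^ 2) := by
    field_simp
  simp only [Function.comp, tripleBound]
  rw [hfactor, Real.sqrt_mul (sq_nonneg _), Real.sqrt_sq hn'.le]
  field_simp

theorem sqrt_five_sub_one_div_eight_lt : (Real.sqrt 5 - 1) / 8 < 1 / 6.4 := by
  have : Real.sqrt 5 < 2.25 := (Real.sqrt_lt' (by norm_num)).2 (by norm_num)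
  norm_num at this ⊢
  linarith

theorem mainTheorem1 :
    (∀ (n : ℕ), 4 ≤ n → ∀ (S : Set (Matrix (Fin n) (Fin n) ℕ)),
      IsAutomaton S → IsStronglyConnected S → IsSynchronizing S →
        (tripleTimes S).Nonempty ∧ (tripleRendezvousTime S : ℝ) ≤ tripleBound n) ∧
    Tendsto (fun n : ℕ => tripleBound n / (n : ℝ) ^ 2) atTop (𝓝 ((Real.sqrt 5 - 1) / 8)) ∧
    (∃ N : ℕ, ∀ (n : ℕ), N ≤ n → ∀ (S : Set (Matrix (Fin n) (Fin n) ℕ)),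
      IsAutomaton S → IsStronglyConnected S → IsSynchronizing S →
        (tripleRendezvousTime S : ℝ) < (n : ℝ) ^ 2 / 6.4) := by
  refine ⟨fun n hn S hS hsc hsync => ⟨hS.tripleTimes_nonempty (by omega) hsync,
    hS.tripleRendezvousTime_le hn hsc hsync⟩, tendsto_tripleBound, ?_⟩
  obtain ⟨N, hN⟩ := eventually_atTop.1
    ((tendsto_tripleBound.eventually_lt_const
      sqrt_five_sub_one_div_eight_lt).and (eventually_ge_atTop 4))
  refine ⟨N, fun n hn S hS hsc hsync => ?_⟩
  obtain ⟨hlt, hn4⟩ := hN n hn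
  refine (hS.tripleRendezvousTime_le hn4 hsc hsync).trans_lt ?_
  rwa [div_lt_iff₀ (by positivity), one_div_mul_eq_div] at hlt
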